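/- Let $H$ be a (real or complex) Hilbert space with norm $|\cdot|$, and let $A:D(A)\subset H\to H$ satisfy (A1) $A$ is self-adjoint and nonnegative, has a compact resolvent, and $|Au|\ge\omega|u|$ for all $u\in D(A)$, for some $\omega>0$. For $k\in\mathbb Z$ put $|u|_k=|A^{k/2}u|$; for $k\ge 0$ let $H_k=D(A^{k/2})$ with norm $|\cdot|_k$ (so $H_0=H$). For a pair $W=(w,w')$ let $e_k(W)=\tfrac12\big(|A^{k/2}w|^2+|A^{(k-1)/2}w'|^2\big)$. In complex spaces, $\langle\cdot,\cdot\rangle$ below stands for its real part. Let $n\ge 2$, and let $C_{i\,i-1},\Pi_i\in\mathcal L(H)$ for $2\le i\le n$. Consider the cascade system $$u_1''+Au_1=0,\qquad u_i''+Au_i+C_{i\,i-1}u_{i-1}=0\quad(2\le i\le n). \tag{S}$$ Its solutions $U=(u_1,\dots,u_n,u_1',\dots,u_n')$ are the finite energy (weak) solutions in $C([0,\infty);H_1^n\times H^n)$; strong solutions are those in $C([0,\infty);H_2^n\times H_1^n)\cap C^1([0,\infty);H_1^n\times H^n)$. Write $U_i=(u_i,u_i')$. Assume: (A2)$_n$ For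 all $i\in\{2,\dots,n\}$: $C_{i\,i-1}^*\in\mathcal L(H_k)$ for $k\in\{0,\dots,n-i+1\}$; with $\beta_i=\|C_{i\,i-1}\|$ we have $|C_{i\,i-1}w|^2\le\beta_i\langle C_{i\,i-1}w,w\rangle$ for all $w\in H$; and there is $\alpha_i>0$ with $\alpha_i|\Pi_iw|^2\le\langle C_{i\,i-1}w,w\rangle$ for all $w\in H$. (A3)$_n$ For all $i\in\{2,\dots,n\}$ there is $T_{0,i}>0$ such that for all $T>T_{0,i}$ there is $\gamma_i(T)>0$ such that all finite energy solutions $w$ of $w''+Aw=0$ satisfy $\int_0^T|\Pi_iw'|^2\,dt\ge\gamma_i(T)\,e_1(W)(0)$, where $W=(w,w')$. Let $G_n$ be a Hilbert space and let $\mathbf B_n^*:H_2\times H\to G_n$ be linear with (A4)$_n$ $\mathbf B_n^*\in\mathcal L(H_2\times H;G_n)$, and for all $T>0$ there is $D_n(T)>0$ such that for all strong solutions $w\in C([0,T];H_2)\cap C^1([0,T];H_1)\cap C^2([0,T];H)$ of $w''+Aw=f$, $$\int_0^T\|\mathbf B_n^*W\|_{G_n}^2dt\le D_n(T)\Big(e_1(W)(0)+e_1(W)(T)+\int_0^Te_1(W)(t)\,dt+\int_0^T|f|^2dt\Big).$$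 (A5)$_n$ There is $T_{0,n}>0$ such that for all $T>T_{0,n}$ there is $R_n(T)>0$ such that all strong solutions of $w''+Aw=0$ satisfy $\int_0^T\|\mathbf B_n^*W\|_{G_n}^2dt\ge R_n(T)\,e_1(W)(0)$. For a solution $W$ of (S), $\mathbf B_n^*W_n\in L^2(0,T;G_n)$ is defined pointwise if $W$ is a strong solution, and in general as the limit in $L^2(0,T;G_n)$ of $\mathbf B_n^*W_n^{(m)}$ for strong solutions $W^{(m)}$ of (S) with $W^{(m)}(0)\to W(0)$ in $H_1^n\times H^n$. Then there exist $T_n^*>0$, a constant $K>0$ and numbers $d_{i,n}(T)>0$ ($1\le i\le n$, $T>T_n^*$) such that for all solutions $W$ of (S) and all $T>T_n^*$ the observation $\mathbf B_n^*W_n\in L^2(0,T;G_n)$ exists and $$e_{1+i-n}(W_i)(0)\le d_{i,n}(T)\int_0^T\|\mathbf B_n^*W_n\|_{G_n}^2\,dt\qquad\forall\, i\in\{1,\dots,n\},$$ with $d_{i,n}(T)\le K/T^3$ for $i\in\{1,\dots,n-1\}$ and $d_{n,n}(T)\le K/T$, where $K$ does not depend on $T$. -/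

import Mathlib

open MeasureTheory Filter Topology Set

namespace CascadeObs

variable {𝕜 : Type*} [RCLike 𝕜] {H : Type*} [NormedAddCommGroup H] [InnerProductSpace 𝕜 H]

/-- The eigenspace `ker (A - μ)` of an unbounded operator `A` for a real number `μ`: all `x` such
that `(x, μ x)` lies in the graph of `A`. -/
def eigenspace (A : H →ₗ.[𝕜] H) (μ : ℝ) : Submodule 𝕜 H :=
  A.graph.comap (LinearMap.id.prod ((μ : 𝕜) • LinearMap.id))

/-- The operator `A` has a compact resolvent: for some `z` the operator `A - z` has an everywhere
defined inverse, and this inverse is compact. -/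
def HasCompactResolvent (A : H →ₗ.[𝕜] H) : Prop :=
  ∃ (z : 𝕜) (R : H →L[𝕜] H), IsCompactOperator R ∧
    (∀ x : H, ∃ h : R x ∈ A.domain, A ⟨R x, h⟩ - z • R x = x) ∧
    ∀ x : A.domain, R (A x - z • (x : H)) = x

/-- Assumption (A1): `A` is self-adjoint, nonnegative (so that its powers make sense), satisfies
`|A u| ≥ ω |u|` for some `ω > 0`, and has a compact resolvent. -/
structure A1 [CompleteSpace H] (A : H →ₗ.[𝕜] H) : Prop where
  selfAdjoint : IsSelfAdjoint A
  nonneg : ∀ u : A.domain, 0 ≤ RCLike.re (inner 𝕜 (A u) (u : H))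
  bounded_below : ∃ ω : ℝ, 0 < ω ∧ ∀ u : A.domain, ω * ‖(u : H)‖ ≤ ‖A u‖
  compactResolvent : HasCompactResolvent A

variable [CompleteSpace H]

/-- The orthogonal projection of `u` on the eigenspace of `A` for `μ`. -/
noncomputable def eigenProj (A : H →ₗ.[𝕜] H) (μ : ℝ) (u : H) : H :=
  (eigenspace A μ).topologicalClosure.starProjection u

/-- `u ∈ H_k = D(A^{k/2})`, through the spectral decomposition of `A`: `∑_μ μ^k |P_μ u|² < ∞`. For
`k ≤ 0` and under (A1) this holds for every `u ∈ H`. -/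
def MemH (A : H →ₗ.[𝕜] H) (k : ℤ) (u : H) : Prop :=
  Summable fun μ : ℝ => μ ^ k * ‖eigenProj A μ u‖ ^ 2

/-- The norm `|u|_k = |A^{k/2} u| = (∑_μ μ^k |P_μ u|²)^{1/2}`. -/
noncomputable def normH (A : H →ₗ.[𝕜] H) (k : ℤ) (u : H) : ℝ :=
  √(∑' μ : ℝ, μ ^ k * ‖eigenProj A μ u‖ ^ 2)

/-- The energy of level `k`: `e_k(u, v) = (|A^{k/2} u|² + |A^{(k-1)/2} v|²) / 2`. -/
noncomputable def energy (A : H →ₗ.[𝕜] H) (k : ℤ) (u v : H) : ℝ :=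
  (1 / 2) * (normH A k u ^ 2 + normH A (k - 1) v ^ 2)

/-- `u` is continuous on `S` with values in `H_k`. -/
def ContinuousInH (A : H →ₗ.[𝕜] H) (k : ℤ) (S : Set ℝ) (u : ℝ → H) : Prop :=
  ∀ t ∈ S, MemH A k (u t) ∧ Tendsto (fun s => normH A k (u s - u t)) (𝓝[S] t) (𝓝 0)

variable [NormedSpace ℝ H]

/-- `u` is differentiable on `S` with derivative `v`, for the norm of `H_k`. -/
def HasDerivInH (A : H →ₗ.[𝕜] H) (k : ℤ) (S : Set ℝ) (u v : ℝ → H) : Prop :=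
  ∀ t ∈ S, Tendsto (fun s => normH A k ((s - t)⁻¹ • (u s - u t) - v t)) (𝓝[S \ {t}] t) (𝓝 0)

/-- Finite energy (weak) solution `(w, w') = (w, v)` of `w'' + A w = f` on the time interval `S`:
`w ∈ C(S; H_1) ∩ C¹(S; H)`, and `(d/dt) ⟨φ, w'⟩ + ⟨A φ, w⟩ = ⟨φ, f⟩` for all `φ ∈ D(A)`. -/
structure IsWeakSol (A : H →ₗ.[𝕜] H) (f : ℝ → H) (S : Set ℝ) (w v : ℝ → H) : Prop where
  continuous_fst : ContinuousInH A 1 S w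
  continuous_snd : ContinuousOn v S
  deriv_fst : ∀ t ∈ S, HasDerivWithinAt w (v t) S t
  deriv_snd : ∀ φ : A.domain, ∀ t ∈ S,
    HasDerivWithinAt (fun s => inner 𝕜 (φ : H) (v s))
      (inner 𝕜 (φ : H) (f t) - inner 𝕜 (A φ) (w t)) S t

/-- Strong solution `(w, w') = (w, v)` of `w'' + A w = f` on the time interval `S`:
`w ∈ C(S; H_2) ∩ C¹(S; H_1) ∩ C²(S; H)`, where `H_2 = D(A)` has the norm `|A ·|`. -/
structure IsStrongSol (A : H →ₗ.[𝕜] H) (f : ℝ → H) (S : Set ℝ) (w : ℝ → A.domain) (v : ℝ → H) :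
    Prop where
  continuous_source : ContinuousOn f S
  continuous_fst : ContinuousOn (fun t => A (w t)) S
  continuous_snd : ContinuousInH A 1 S v
  deriv_fst : HasDerivInH A 1 S (fun t => (w t : H)) v
  deriv_snd : ∀ t ∈ S, HasDerivWithinAt v (f t - A (w t)) S t

/-- The source term of the `i`-th equation of the bi-diagonal cascade system: `0` for `i = 1` and
`-C_{i,i-1} w_{i-1}` for `i ≥ 2`. The operator `C_{i,i-1}` is written `C i`. -/
def cascadeSource (C : ℕ → H →L[𝕜] H) (w : ℕ → ℝ → H) (i : ℕ) (t : ℝ) : H :=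
  if 2 ≤ i then -(C i (w (i - 1) t)) else 0

/-- `W = (w_1, …, w_n, v_1, …, v_n)` is a finite energy solution on `[0, ∞)` of the cascade system
`w_1'' + A w_1 = 0`, `w_i'' + A w_i + C_{i,i-1} w_{i-1} = 0` for `2 ≤ i ≤ n`; here `v_i = w_i'`.
Components whose index is not in `{1, …, n}` play no role. -/
def IsCascadeSol (A : H →ₗ.[𝕜] H) (C : ℕ → H →L[𝕜] H) (n : ℕ) (w v : ℕ → ℝ → H) : Prop :=
  ∀ i, 1 ≤ i → i ≤ n → IsWeakSol A (cascadeSource C w i) (Ici 0) (w i) (v i)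

/-- Strong solution on `[0, ∞)` of the cascade system, that is, a solution in
`C([0, ∞); H_2^n × H_1^n) ∩ C¹([0, ∞); H_1^n × H^n)`. -/
def IsStrongCascadeSol (A : H →ₗ.[𝕜] H) (C : ℕ → H →L[𝕜] H) (n : ℕ)
    (w : ℕ → ℝ → A.domain) (v : ℕ → ℝ → H) : Prop :=
  ∀ i, 1 ≤ i → i ≤ n →
    IsStrongSol A (cascadeSource C (fun j t => (w j t : H)) i) (Ici 0) (w i) (v i)

/-- Assumption (A2) for the coupling operators `C_{i,i-1} = C i`, relative to the operators
`Π_i = P i`, `2 ≤ i ≤ n`. Here `β_i = ‖C i‖`. -/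
structure A2 (A : H →ₗ.[𝕜] H) (C P : ℕ → H →L[𝕜] H) (n : ℕ) : Prop where
  adjoint_bounded : ∀ i k : ℕ, 2 ≤ i → i ≤ n → k + i ≤ n + 1 → ∃ c : ℝ, ∀ u : H, MemH A k u →
    MemH A k (ContinuousLinearMap.adjoint (C i) u) ∧
      normH A k (ContinuousLinearMap.adjoint (C i) u) ≤ c * normH A k u
  sq_le : ∀ i : ℕ, 2 ≤ i → i ≤ n → ∀ w : H,
    ‖C i w‖ ^ 2 ≤ ‖C i‖ * RCLike.re (inner 𝕜 (C i w) w)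
  coercive : ∀ i : ℕ, 2 ≤ i → i ≤ n → ∃ α : ℝ, 0 < α ∧ ∀ w : H,
    α * ‖P i w‖ ^ 2 ≤ RCLike.re (inner 𝕜 (C i w) w)

/-- Assumption (A3): for `2 ≤ i ≤ n`, the operator `Π_i = P i`, applied to the velocity, observes
the free equation in all sufficiently large times. -/
def A3 (A : H →ₗ.[𝕜] H) (P : ℕ → H →L[𝕜] H) (n : ℕ) : Prop :=
  ∀ i : ℕ, 2 ≤ i → i ≤ n → ∃ T₀ : ℝ, 0 < T₀ ∧ ∀ T : ℝ, T₀ < T → ∃ γ : ℝ, 0 < γ ∧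
    ∀ w v : ℝ → H, IsWeakSol A (fun _ => 0) (Ici 0) w v →
      γ * energy A 1 (w 0) (v 0) ≤ ∫ t in (0 : ℝ)..T, ‖P i (v t)‖ ^ 2

variable {G : Type*} [NormedAddCommGroup G] [InnerProductSpace 𝕜 G]

/-- Assumption (A4): the observation operator `B` is bounded from `H_2 × H` to `G`, and it is
admissible. The inequality is required for the strong solutions only, for which `B (w, w')` is
defined pointwise; it extends to all finite energy solutions with square integrable source by
density. -/
structure A4 (A : H →ₗ.[𝕜] H) (B : A.domain × H →ₗ[𝕜] G) : Prop where
  bounded : ∃ c : ℝ, ∀ (u : A.domain) (v : H), ‖B (u, v)‖ ≤ c * (‖A u‖ + ‖v‖)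
  admissible : ∀ T : ℝ, 0 < T → ∃ D : ℝ, 0 < D ∧
    ∀ (f : ℝ → H) (w : ℝ → A.domain) (v : ℝ → H), IsStrongSol A f (Icc 0 T) w v →
      ∫ t in (0 : ℝ)..T, ‖B (w t, v t)‖ ^ 2 ≤
        D * (energy A 1 (w 0) (v 0) + energy A 1 (w T) (v T) +
          (∫ t in (0 : ℝ)..T, energy A 1 (w t) (v t)) + ∫ t in (0 : ℝ)..T, ‖f t‖ ^ 2)

/-- Assumption (A5): `B` observes the free equation in all sufficiently large times (required for
strong solutions only, as in (A4)). -/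
def A5 (A : H →ₗ.[𝕜] H) (B : A.domain × H →ₗ[𝕜] G) : Prop :=
  ∃ T₀ : ℝ, 0 < T₀ ∧ ∀ T : ℝ, T₀ < T → ∃ R : ℝ, 0 < R ∧
    ∀ (w : ℝ → A.domain) (v : ℝ → H), IsStrongSol A (fun _ => 0) (Ici 0) w v →
      R * energy A 1 (w 0) (v 0) ≤ ∫ t in (0 : ℝ)..T, ‖B (w t, v t)‖ ^ 2

/-- `y ∈ L²(0, T; G)` is the observation `B (W_n)` on `[0, T]` of the finite energy solution
`W = (w, v)` of the cascade system. For a strong solution it is the function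
`t ↦ B (w_n(t), w_n'(t))`; in general it is the limit in `L²(0, T; G)` of such functions for strong
solutions whose initial data converge to those of `W` in `H_1^n × H^n`. -/
def IsObservation (A : H →ₗ.[𝕜] H) (C : ℕ → H →L[𝕜] H) (n : ℕ) (B : A.domain × H →ₗ[𝕜] G)
    (w v : ℕ → ℝ → H) (T : ℝ) (y : ℝ → G) : Prop :=
  MemLp y 2 (volume.restrict (Ioc 0 T)) ∧
  ∃ (a : ℕ → ℕ → ℝ → A.domain) (b : ℕ → ℕ → ℝ → H),
    (∀ m, IsStrongCascadeSol A C n (a m) (b m)) ∧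
    (∀ i, 1 ≤ i → i ≤ n →
      Tendsto (fun m => normH A 1 ((a m i 0 : H) - w i 0)) atTop (𝓝 0) ∧
      Tendsto (fun m => b m i 0) atTop (𝓝 (v i 0))) ∧
    Tendsto (fun m => eLpNorm (fun t => B (a m n t, b m n t) - y t) 2 (volume.restrict (Ioc 0 T)))
      atTop (𝓝 0)

end CascadeObs

/-! A compact resolvent diagonalises `A`, so `Λ = A^{-1/2}` is a bounded, injective, symmetric
operator. A strong solution of `w'' + A w = f` is encoded by continuous `H`-valued curves `r = A w`
and `q` with `w' = Λ q`. Every energy of level `1 - k` then becomes a norm of `Λ ^ (k + 1)` applied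
to `r` and `q`, and no unbounded operator remains in the argument.

The core is an induction on the length of the cascade, for an arbitrary observer of the last
component (`IsObservable.one`, `IsObservable.succ`). Observers first yield window estimates: the
energy at time `s` is bounded by the observation and the source on `[s, s + τ]`
(`IsObserver.window`).

For the step from `n` to `n + 1`, let `X` be the integral of `⟨C_{n+1,n} w_n, w_n⟩` over `[L, 2L]`,
with `T = 4L`. The cascade of length `n` is observable through the velocity observation `Π_{n+1}`.
Applied to a time primitive of the solution, whose velocity is `w`, this bounds the weakened
energies of `w_1, …, w_n` at time `L` by `X` (`IsObservable.energy_le_couplingIntegral`). Energy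
estimates along the cascade spread these bounds to `[0, 4L]`, with explicit powers of `L`
(`IsObservable.uniform_bounds`).

In the other direction, the derivative of `⟨w_n', w_{n+1}⟩ - ⟨w_n, w_{n+1}'⟩` is the coupling
integrand plus a source term, because the two contributions of `A` cancel. Hence `X` is at most a
constant times `√(X / L) / L` times the integral of the square root of the energy of `w_{n+1}`
(`IsWaveCascade.couplingIntegral_le`). The window estimate bounds the integral of that energy by `O
+ c X`, where `O` is the observation. Together, `L² X ≤ c (O + c' X)`; for large `L` the term in `X`
is absorbed and `X ≤ c O / L²`. This factor `L⁻²` turns the decay `1 / T` of the last component into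
`1 / T³` for the preceding one.

Finite energy solutions are reached by averaging in time over `[t, t + h]`: averaging commutes with
the couplings and turns weak solutions into strong ones (`IsWeakSol.exists_average`). Admissibility
makes the observations of the averages Cauchy in `L²`, and the inequality passes to the limit. -/

namespace CascadeObs

/-! ### Spectral decomposition of `A` and the operator `A^{-1/2}`. -/

section Spectral

variable {𝕜 : Type*} [RCLike 𝕜] {H : Type*} [NormedAddCommGroup H] [InnerProductSpace 𝕜 H]
  {A : H →ₗ.[𝕜] H}

theorem mem_eigenspace_iff {μ : ℝ} {x : H} :
    x ∈ eigenspace A μ ↔ ∃ h : x ∈ A.domain, A ⟨x, h⟩ = (μ : 𝕜) • x := by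
  unfold eigenspace
  rw [Submodule.mem_comap]
  simp only [LinearMap.prod_apply]
  rw [LinearPMap.mem_graph_iff]
  constructor
  · rintro ⟨y, hy, hy'⟩
    obtain ⟨y, hyd⟩ := y
    simp only at hy hy'
    subst hy
    exact ⟨hyd, hy'⟩
  · rintro ⟨h, h'⟩
    exact ⟨⟨x, h⟩, rfl, h'⟩

theorem eigenspace_eq_of_inverse {R : H →L[𝕜] H}
    (h1 : ∀ x : H, ∃ h : R x ∈ A.domain, A ⟨R x, h⟩ = x) (h2 : ∀ x : A.domain, R (A x) = x)
    {μ : ℝ} (hμ : μ ≠ 0) :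
    eigenspace A μ = Module.End.eigenspace (R : Module.End 𝕜 H) ((μ⁻¹ : ℝ) : 𝕜) := by
  have hμ' : (μ : 𝕜) ≠ 0 := by simpa using hμ
  ext x
  rw [_root_.CascadeObs.mem_eigenspace_iff, Module.End.mem_eigenspace_iff]
  change _ ↔ R x = _
  rw [RCLike.ofReal_inv]
  constructor
  · rintro ⟨h, hx⟩
    have := h2 ⟨x, h⟩
    rw [hx, map_smul] at this
    simp only at this
    conv_rhs => rw [← this]
    rw [smul_smul, inv_mul_cancel₀ hμ', one_smul]
  · intro hx
    obtain ⟨h, hx'⟩ := h1 x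
    have hxd : x = (μ : 𝕜) • R x := by rw [hx, smul_smul, mul_inv_cancel₀ hμ', one_smul]
    have hm : x ∈ A.domain := by rw [hxd]; exact A.domain.smul_mem _ h
    refine ⟨hm, ?_⟩
    have : (⟨x, hm⟩ : A.domain) = (μ : 𝕜) • ⟨R x, h⟩ := Subtype.ext hxd
    rw [this, LinearPMap.map_smul, hx']

variable [CompleteSpace H]

theorem A1.symmetric (hA : A1 A) (x y : A.domain) :
    inner 𝕜 (A x) (y : H) = inner 𝕜 (x : H) (A y) := by
  have hd := hA.selfAdjoint.dense_domain
  have h := LinearPMap.adjoint_isFormalAdjoint hd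
  rw [LinearPMap.isSelfAdjoint_def.1 hA.selfAdjoint] at h
  exact h x y

theorem A1.apply_eq_zero (hA : A1 A) (x : A.domain) (hx : A x = 0) : (x : H) = 0 := by
  obtain ⟨ω, hω, h⟩ := hA.bounded_below
  have := h x
  rw [hx, norm_zero] at this
  have h2 : ‖(x : H)‖ ≤ 0 := by
    by_contra! hc
    nlinarith
  simpa using h2

/-- Under (A1) the operator `A` has a compact, everywhere defined, symmetric inverse. -/
theorem A1.exists_inverse (hA : A1 A) : ∃ R : H →L[𝕜] H, IsCompactOperator R ∧
    (R : H →ₗ[𝕜] H).IsSymmetric ∧ (∀ x : H, ∃ h : R x ∈ A.domain, A ⟨R x, h⟩ = x) ∧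
    ∀ x : A.domain, R (A x) = x := by
  obtain ⟨z, Rz, hc, h1, h2⟩ := hA.compactResolvent
  have key : ∃ R : H →L[𝕜] H, IsCompactOperator R ∧ ∀ x : H, ∃ h : R x ∈ A.domain,
      A ⟨R x, h⟩ = x := by
    by_cases hz : z = 0
    · refine ⟨Rz, hc, fun x => ?_⟩
      obtain ⟨h, hx⟩ := h1 x
      exact ⟨h, by simpa [hz] using hx⟩
    · have hz' : -z⁻¹ ≠ 0 := by simpa using hz
      -- Fredholm alternative: an eigenvector of the resolvent for `-z⁻¹` would give a nonzero
      -- element of the kernel of `A`, so `-z⁻¹ - Rz` is invertible and `A⁻¹` is the composition of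
      -- `Rz` with `-z⁻¹` times that inverse.
      have hne : ¬ Module.End.HasEigenvalue (Rz : Module.End 𝕜 H) (-z⁻¹) := by
        intro he
        obtain ⟨x, hx⟩ := he.exists_hasEigenvector
        have hx1 : Rz x = (-z⁻¹) • x := hx.apply_eq_smul
        obtain ⟨h, hx2⟩ := h1 x
        have h3 : A ⟨Rz x, h⟩ = 0 := by
          have : z • Rz x = -x := by rw [hx1, smul_smul]; simp [hz]
          rw [this, sub_neg_eq_add] at hx2
          simpa using hx2
        have h4 := hA.apply_eq_zero _ h3
        simp only at h4
        rw [hx1] at h4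
        exact hx.2 ((smul_eq_zero.1 h4).resolve_left hz')
      have hr := (hc.hasEigenvalue_or_mem_resolventSet hz').resolve_left hne
      rw [spectrum.mem_resolventSet_iff] at hr
      obtain ⟨S, hS⟩ := hr.exists_right_inv
      have hS' : ∀ x, (-z⁻¹) • S x - Rz (S x) = x := by
        intro x
        have := congrArg (fun T : H →L[𝕜] H => T x) hS
        simpa [Algebra.algebraMap_eq_smul_one] using this
      refine ⟨Rz ∘L ((-z⁻¹) • S), hc.comp_clm _, fun x => ?_⟩
      obtain ⟨h, hx⟩ := h1 (((-z⁻¹) • S) x)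
      refine ⟨h, ?_⟩
      change A ⟨Rz (((-z⁻¹) • S) x), h⟩ = x
      rw [sub_eq_iff_eq_add] at hx
      rw [hx]
      conv_rhs => rw [← hS' x]
      simp only [_root_.smul_apply, map_smul, smul_smul]
      rw [mul_neg, mul_inv_cancel₀ hz]
      simp [sub_eq_add_neg]
  obtain ⟨R, hRc, hR⟩ := key
  refine ⟨R, hRc, ?_, hR, ?_⟩
  · intro x y
    obtain ⟨hx, hx'⟩ := hR x
    obtain ⟨hy, hy'⟩ := hR y
    have := hA.symmetric ⟨R x, hx⟩ ⟨R y, hy⟩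
    rw [hx', hy'] at this
    simpa using this.symm
  · intro x
    obtain ⟨hx, hx'⟩ := hR (A x)
    have h0 : A (⟨R (A x), hx⟩ - x) = 0 := by rw [LinearPMap.map_sub, hx', sub_self]
    have := hA.apply_eq_zero _ h0
    simpa [sub_eq_zero] using this

/-- Nonnegativity excludes negative eigenvalues, and the lower bound excludes those in `[0, ω)`. -/
theorem A1.eigenspace_eq_bot (hA : A1 A) : ∃ ω : ℝ, 0 < ω ∧ ∀ μ < ω, eigenspace A μ = ⊥ := by
  obtain ⟨ω, hω, h⟩ := hA.bounded_below
  refine ⟨ω, hω, fun μ hμ => (Submodule.eq_bot_iff _).2 fun x hx => ?_⟩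
  obtain ⟨hx, hx'⟩ := mem_eigenspace_iff.1 hx
  by_contra hne
  have hpos : 0 < ‖x‖ := norm_pos_iff.2 hne
  have h1 := h ⟨x, hx⟩
  have h2 := hA.nonneg ⟨x, hx⟩
  rw [hx'] at h1 h2
  rw [inner_smul_left, RCLike.conj_ofReal, RCLike.re_ofReal_mul, inner_self_eq_norm_sq] at h2
  have hμ0 : 0 ≤ μ := by
    by_contra! hc
    have : 0 < ‖x‖ ^ 2 := by positivity
    nlinarith
  rw [norm_smul, RCLike.norm_ofReal, abs_of_nonneg hμ0] at h1
  simp only at h1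
  nlinarith

/-- The spectral projection on the eigenspace for `μ`, as a bounded operator. -/
noncomputable def eigenProjL (A : H →ₗ.[𝕜] H) (μ : ℝ) : H →L[𝕜] H :=
  (eigenspace A μ).topologicalClosure.starProjection

theorem A1.isClosed_eigenspace (hA : A1 A) (μ : ℝ) : IsClosed (eigenspace A μ : Set H) := by
  obtain ⟨ω, hω, h0⟩ := hA.eigenspace_eq_bot
  obtain ⟨R, -, -, h1, h2⟩ := hA.exists_inverse
  by_cases hμ : μ = 0
  · rw [h0 μ (hμ ▸ hω)]
    exact isClosed_singleton
  · rw [eigenspace_eq_of_inverse h1 h2 hμ]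
    have : (Module.End.eigenspace (R : Module.End 𝕜 H) ((μ⁻¹ : ℝ) : 𝕜) : Set H) =
        {x | R x = ((μ⁻¹ : ℝ) : 𝕜) • x} := by
      ext x; simp
    rw [this]
    exact isClosed_eq R.continuous (continuous_const_smul _)

theorem A1.topologicalClosure_eigenspace (hA : A1 A) (μ : ℝ) :
    (eigenspace A μ).topologicalClosure = eigenspace A μ :=
  (hA.isClosed_eigenspace μ).submodule_topologicalClosure_eq

theorem A1.inner_eq_zero_of_ne (hA : A1 A) {μ ν : ℝ} (hμν : μ ≠ ν) {x y : H}
    (hx : x ∈ eigenspace A μ) (hy : y ∈ eigenspace A ν) : inner 𝕜 x y = 0 := by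
  obtain ⟨hx, hx'⟩ := mem_eigenspace_iff.1 hx
  obtain ⟨hy, hy'⟩ := mem_eigenspace_iff.1 hy
  have := hA.symmetric ⟨x, hx⟩ ⟨y, hy⟩
  rw [hx', hy', inner_smul_left, inner_smul_right, RCLike.conj_ofReal, ← sub_eq_zero,
    ← sub_mul] at this
  refine (mul_eq_zero.1 this).resolve_left ?_
  exact sub_ne_zero.2 (by exact_mod_cast hμν)

/-- The spectral theorem for the compact symmetric operator `A⁻¹` says that its eigenspaces span a
dense subspace. Its eigenvalues are real by symmetry and nonzero by injectivity, so each of its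
nontrivial eigenspaces is the eigenspace of `A` for the inverse real number. -/
theorem A1.isHilbertSum (hA : A1 A) : IsHilbertSum 𝕜
    (fun μ : ℝ => (eigenspace A μ).topologicalClosure)
    (fun μ => ((eigenspace A μ).topologicalClosure).subtypeₗᵢ) := by
  obtain ⟨ω, hω, h0⟩ := hA.eigenspace_eq_bot
  obtain ⟨R, hc, hs, h1, h2⟩ := hA.exists_inverse
  have hcomp : ∀ μ : ℝ, CompleteSpace (eigenspace A μ).topologicalClosure := fun μ =>
    (Submodule.isClosed_topologicalClosure _).completeSpace_coe
  refine IsHilbertSum.mkInternal (F := fun μ : ℝ => (eigenspace A μ).topologicalClosure) ?_ ?_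
  · rintro μ ν hμν ⟨x, hx⟩ ⟨y, hy⟩
    rw [hA.topologicalClosure_eigenspace] at hx hy
    exact hA.inner_eq_zero_of_ne hμν hx hy
  · simp only [hA.topologicalClosure_eigenspace]
    rw [top_le_iff, Submodule.topologicalClosure_eq_top_iff]
    have := ContinuousLinearMap.orthogonalComplement_iSup_eigenspaces_eq_bot hc hs
    rw [eq_bot_iff, ← this]
    apply Submodule.orthogonal_le
    refine iSup_le fun z => ?_
    by_cases hz : Module.End.eigenspace (R : Module.End 𝕜 H) z = ⊥
    · rw [hz]; exact bot_le
    have hev : Module.End.HasEigenvalue (R : Module.End 𝕜 H) z := by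
      rwa [Module.End.hasEigenvalue_iff]
    have hz0 : z ≠ 0 := by
      rintro rfl
      apply hz
      rw [Submodule.eq_bot_iff]
      intro x hx
      rw [Module.End.mem_eigenspace_iff, zero_smul] at hx
      obtain ⟨h, hx'⟩ := h1 x
      have : (⟨R x, h⟩ : A.domain) = 0 := Subtype.ext hx
      rw [← hx', this, LinearPMap.map_zero]
    have hre := RCLike.conj_eq_iff_real.1 (hs.conj_eigenvalue_eq_self hev)
    obtain ⟨ν, rfl⟩ := hre
    have hν : ν ≠ 0 := by simpa using hz0
    refine le_trans (le_of_eq ?_) (le_iSup _ ν⁻¹)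
    rw [eigenspace_eq_of_inverse h1 h2 (inv_ne_zero hν), inv_inv]

theorem A1.eigenProj_mem (hA : A1 A) (μ : ℝ) (u : H) : eigenProj A μ u ∈ eigenspace A μ := by
  rw [← hA.topologicalClosure_eigenspace μ]
  exact Submodule.starProjection_apply_mem _ _

theorem A1.eigenProj_of_mem (hA : A1 A) {μ : ℝ} {u : H} (hu : u ∈ eigenspace A μ) :
    eigenProj A μ u = u := by
  rw [← hA.topologicalClosure_eigenspace μ] at hu
  exact Submodule.starProjection_eq_self_iff.2 hu

theorem A1.eigenProj_of_mem_of_ne (hA : A1 A) {μ ν : ℝ} (h : μ ≠ ν) {u : H}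
    (hu : u ∈ eigenspace A μ) : eigenProj A ν u = 0 := by
  refine (Submodule.starProjection_apply_eq_zero_iff _).2 ?_
  rw [Submodule.mem_orthogonal]
  intro y hy
  rw [hA.topologicalClosure_eigenspace] at hy
  exact hA.inner_eq_zero_of_ne h.symm hy hu

theorem inner_eigenProj_left (μ : ℝ) (u v : H) :
    inner 𝕜 (eigenProj A μ u) v = inner 𝕜 u (eigenProj A μ v) :=
  Submodule.inner_starProjection_left_eq_right _ u v

theorem A1.eigenProj_hasSum (hA : A1 A) {c : ℝ → H} (hc : ∀ μ, c μ ∈ eigenspace A μ) {u : H}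
    (hu : HasSum c u) (μ : ℝ) : eigenProj A μ u = c μ := by
  have h1 := hu.mapL (eigenProjL A μ)
  refine h1.unique ?_
  have h2 : (fun ν => eigenProjL A μ (c ν)) = fun ν => if ν = μ then c μ else 0 := by
    funext ν
    split_ifs with h
    · rw [h]; exact hA.eigenProj_of_mem (hc μ)
    · exact hA.eigenProj_of_mem_of_ne h (hc ν)
  rw [h2]
  exact hasSum_ite_eq μ (c μ)

theorem A1.exists_lp (hA : A1 A) (u : H) :
    HasSum (fun μ => eigenProj A μ u) u ∧ HasSum (fun μ => ‖eigenProj A μ u‖ ^ 2) (‖u‖ ^ 2) := by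
  have hV := hA.isHilbertSum
  set f := hV.linearIsometryEquiv u with hf
  have h1 := hV.hasSum_linearIsometryEquiv_symm f
  rw [hf, LinearIsometryEquiv.symm_apply_apply, ← hf] at h1
  have h2 : ∀ μ, eigenProj A μ u = (f μ : H) := fun μ =>
    hA.eigenProj_hasSum (c := fun μ => (f μ : H))
      (fun μ => (hA.topologicalClosure_eigenspace μ).le (f μ).2) h1 μ
  constructor
  · simp only [h2]
    exact h1
  · have h3 := lp.hasSum_norm (p := 2) (by norm_num) f
    have h4 : ‖f‖ = ‖u‖ := hV.linearIsometryEquiv.norm_map u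
    simp only [h2]
    rw [h4] at h3
    simpa using h3

theorem A1.hasSum_eigenProj (hA : A1 A) (u : H) : HasSum (fun μ => eigenProj A μ u) u :=
  (hA.exists_lp u).1

/-- The Parseval identity. -/
theorem A1.hasSum_norm_sq (hA : A1 A) (u : H) :
    HasSum (fun μ => ‖eigenProj A μ u‖ ^ 2) (‖u‖ ^ 2) :=
  (hA.exists_lp u).2

theorem A1.ext_eigenProj (hA : A1 A) {u v : H} (h : ∀ μ, eigenProj A μ u = eigenProj A μ v) :
    u = v := by
  have h1 := hA.hasSum_eigenProj u
  simp only [h] at h1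
  exact h1.unique (hA.hasSum_eigenProj v)

/-- Riesz–Fischer: vectors are built from prescribed square summable components, which is how
functions of `A` are defined below. -/
theorem A1.exists_of_summable (hA : A1 A) {c : ℝ → H} (hc : ∀ μ, c μ ∈ eigenspace A μ)
    (hs : Summable fun μ => ‖c μ‖ ^ 2) : ∃ u : H, ∀ μ, eigenProj A μ u = c μ := by
  have hV := hA.isHilbertSum
  have hc' : ∀ μ, c μ ∈ (eigenspace A μ).topologicalClosure := fun μ => by
    rw [hA.topologicalClosure_eigenspace μ]; exact hc μ
  have h1 : Summable c := (hV.OrthogonalFamily.summable_iff_norm_sq_summable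
    (fun μ => ⟨c μ, hc' μ⟩)).2 hs
  exact ⟨_, hA.eigenProj_hasSum hc h1.hasSum⟩

theorem eigenProj_add (μ : ℝ) (u v : H) :
    eigenProj A μ (u + v) = eigenProj A μ u + eigenProj A μ v := map_add (eigenProjL A μ) u v

theorem eigenProj_smul (μ : ℝ) (a : 𝕜) (u : H) :
    eigenProj A μ (a • u) = a • eigenProj A μ u := map_smul (eigenProjL A μ) a u

theorem eigenProj_sub (μ : ℝ) (u v : H) :
    eigenProj A μ (u - v) = eigenProj A μ u - eigenProj A μ v := map_sub (eigenProjL A μ) u v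

theorem eigenProj_neg (μ : ℝ) (u : H) :
    eigenProj A μ (-u) = -eigenProj A μ u := map_neg (eigenProjL A μ) u

theorem A1.eigenProj_eq_zero (hA : A1 A) : ∃ ω : ℝ, 0 < ω ∧ ∀ μ < ω, ∀ u, eigenProj A μ u = 0 := by
  obtain ⟨ω, hω, h0⟩ := hA.eigenspace_eq_bot
  refine ⟨ω, hω, fun μ hμ u => ?_⟩
  have := hA.eigenProj_mem μ u
  rw [h0 μ hμ] at this
  simpa using this

theorem A1.eigenProj_nonpos (hA : A1 A) {μ : ℝ} (hμ : μ ≤ 0) (u : H) : eigenProj A μ u = 0 := by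
  obtain ⟨ω, hω, h⟩ := hA.eigenProj_eq_zero
  exact h μ (by linarith) u

theorem A1.eigenProj_apply (hA : A1 A) (μ : ℝ) (x : A.domain) :
    eigenProj A μ (A x) = (μ : 𝕜) • eigenProj A μ (x : H) := by
  refine ext_inner_right 𝕜 fun y => ?_
  obtain ⟨hy, hy'⟩ := mem_eigenspace_iff.1 (hA.eigenProj_mem μ y)
  rw [inner_eigenProj_left, inner_smul_left, inner_eigenProj_left, RCLike.conj_ofReal]
  have := hA.symmetric x ⟨_, hy⟩
  rw [this, hy', inner_smul_right]

/-- Bounded functions of `A`. -/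
theorem A1.exists_specOp (hA : A1 A) (φ : ℝ → ℝ) (c : ℝ)
    (hφ : ∀ μ, eigenspace A μ ≠ ⊥ → |φ μ| ≤ c) :
    ∃ M : H →L[𝕜] H, ∀ u μ, eigenProj A μ (M u) = (φ μ : 𝕜) • eigenProj A μ u := by
  have hb : ∀ u μ, ‖(φ μ : 𝕜) • eigenProj A μ u‖ ^ 2 ≤ c ^ 2 * ‖eigenProj A μ u‖ ^ 2 := by
    intro u μ
    by_cases h : eigenspace A μ = ⊥
    · have := hA.eigenProj_mem μ u
      rw [h, Submodule.mem_bot] at this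
      simp [this]
    · rw [norm_smul, mul_pow, RCLike.norm_ofReal]
      have := hφ μ h
      gcongr
  have hex : ∀ u, ∃ x : H, ∀ μ, eigenProj A μ x = (φ μ : 𝕜) • eigenProj A μ u := fun u =>
    hA.exists_of_summable (fun μ => Submodule.smul_mem _ _ (hA.eigenProj_mem μ u))
      (((hA.hasSum_norm_sq u).summable.mul_left (c ^ 2)).of_nonneg_of_le
        (fun μ => by positivity) (hb u))
  choose M hM using hex
  have hnorm : ∀ u, ‖M u‖ ≤ |c| * ‖u‖ := by
    intro u
    rw [← abs_of_nonneg (norm_nonneg u), ← abs_mul]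
    refine Real.le_sqrt_of_sq_le ?_ |>.trans_eq (Real.sqrt_sq_eq_abs _)
    rw [mul_pow]
    refine hasSum_le (fun μ => ?_) (hA.hasSum_norm_sq (M u)) ((hA.hasSum_norm_sq u).mul_left _)
    rw [hM]
    exact hb u μ
  let M' : H →ₗ[𝕜] H :=
    { toFun := M
      map_add' := fun x y => hA.ext_eigenProj fun μ => by
        simp only [eigenProj_add, hM, smul_add]
      map_smul' := fun a x => hA.ext_eigenProj fun μ => by
        simp only [eigenProj_smul, hM, RingHom.id_apply]
        rw [smul_comm] }
  exact ⟨M'.mkContinuous |c| hnorm, hM⟩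

/-- `Λ` is the operator `A^{-1/2}`. -/
def IsInvSqrt (A : H →ₗ.[𝕜] H) (Λ : H →L[𝕜] H) : Prop :=
  ∀ u μ, eigenProj A μ (Λ u) = (((√μ)⁻¹ : ℝ) : 𝕜) • eigenProj A μ u

theorem A1.exists_isInvSqrt (hA : A1 A) : ∃ Λ : H →L[𝕜] H, IsInvSqrt A Λ := by
  obtain ⟨ω, hω, h0⟩ := hA.eigenspace_eq_bot
  refine hA.exists_specOp (fun μ => (√μ)⁻¹) (√ω)⁻¹ fun μ hμ => ?_
  have : ω ≤ μ := by
    by_contra! h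
    exact hμ (h0 μ h)
  rw [abs_of_nonneg (by positivity)]
  have := Real.sqrt_pos.2 hω
  gcongr

namespace IsInvSqrt

variable {Λ : H →L[𝕜] H}

theorem inner_left (hΛ : IsInvSqrt A Λ) (hA : A1 A) (x y : H) :
    inner 𝕜 (Λ x) y = inner 𝕜 x (Λ y) := by
  have h1 : HasSum (fun μ => inner 𝕜 y (eigenProj A μ (Λ x))) (inner 𝕜 y (Λ x)) :=
    (hA.hasSum_eigenProj (Λ x)).mapL (innerSL 𝕜 y)
  have h2 : HasSum (fun μ => inner 𝕜 (Λ y) (eigenProj A μ x)) (inner 𝕜 (Λ y) x) :=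
    (hA.hasSum_eigenProj x).mapL (innerSL 𝕜 (Λ y))
  have h3 : (fun μ => inner 𝕜 y (eigenProj A μ (Λ x))) =
      fun μ => inner 𝕜 (Λ y) (eigenProj A μ x) := by
    funext μ
    have hi : eigenProj A μ (eigenProj A μ x) = eigenProj A μ x :=
      hA.eigenProj_of_mem (hA.eigenProj_mem μ x)
    rw [hΛ, inner_smul_right, ← hi, ← inner_eigenProj_left μ (Λ y), hΛ, inner_smul_left,
      RCLike.conj_ofReal, inner_eigenProj_left]
  rw [h3] at h1
  have := h1.unique h2
  rw [← inner_conj_symm, this, inner_conj_symm]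

/-- For `μ > 0` the factor `(√μ)⁻²` lowers the exponent by one. For `μ ≤ 0` the projection vanishes,
so the default values of the root and of the inverse have no effect. -/
theorem term_eq (hΛ : IsInvSqrt A Λ) (hA : A1 A) (k : ℤ) (u : H) (μ : ℝ) :
    μ ^ k * ‖eigenProj A μ (Λ u)‖ ^ 2 = μ ^ (k - 1) * ‖eigenProj A μ u‖ ^ 2 := by
  rcases le_or_gt μ 0 with h | h
  · simp [hA.eigenProj_nonpos h]
  · rw [hΛ, norm_smul, RCLike.norm_ofReal, mul_pow, sq_abs, inv_pow, Real.sq_sqrt h.le,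
      zpow_sub_one₀ h.ne']
    ring

theorem memH_iff (hΛ : IsInvSqrt A Λ) (hA : A1 A) (k : ℤ) (u : H) :
    MemH A k (Λ u) ↔ MemH A (k - 1) u := by
  unfold MemH
  simp only [hΛ.term_eq hA]

theorem normH_apply (hΛ : IsInvSqrt A Λ) (hA : A1 A) (k : ℤ) (u : H) :
    normH A k (Λ u) = normH A (k - 1) u := by
  unfold normH
  simp only [hΛ.term_eq hA]

end IsInvSqrt

theorem A1.memH_zero (hA : A1 A) (u : H) : MemH A 0 u := by
  unfold MemH
  simpa using (hA.hasSum_norm_sq u).summable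

theorem A1.normH_zero (hA : A1 A) (u : H) : normH A 0 u = ‖u‖ := by
  unfold normH
  simp only [zpow_zero, one_mul]
  rw [(hA.hasSum_norm_sq u).tsum_eq, Real.sqrt_sq (norm_nonneg u)]

namespace IsInvSqrt

variable {Λ : H →L[𝕜] H}

theorem injective (hΛ : IsInvSqrt A Λ) (hA : A1 A) : Function.Injective Λ := by
  rw [injective_iff_map_eq_zero]
  intro u hu
  have h := hΛ.normH_apply hA 1 u
  have h0 : normH A 1 (0 : H) = 0 := by
    unfold normH
    have : ∀ μ, eigenProj A μ (0 : H) = 0 := fun μ => map_zero (eigenProjL A μ)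
    simp [this]
  rw [hu, h0, sub_self, hA.normH_zero] at h
  simpa using h.symm

theorem normH_neg (hΛ : IsInvSqrt A Λ) (hA : A1 A) (k : ℕ) (u : H) :
    normH A (-(k : ℤ)) u = ‖(Λ ^ k) u‖ := by
  induction k generalizing u with
  | zero => simpa using hA.normH_zero u
  | succ k ih =>
    rw [pow_succ, mul_apply_eq_comp, ← ih, hΛ.normH_apply hA]
    congr 1
    push_cast; ring

theorem normH_pow (hΛ : IsInvSqrt A Λ) (hA : A1 A) (k : ℕ) (u : H) :
    normH A k ((Λ ^ k) u) = ‖u‖ := by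
  induction k generalizing u with
  | zero => simpa using hA.normH_zero u
  | succ k ih =>
    rw [pow_succ', mul_apply_eq_comp, hΛ.normH_apply hA]
    rw [← ih u]
    congr 1
    push_cast; ring

theorem memH_pow (hΛ : IsInvSqrt A Λ) (hA : A1 A) (k : ℕ) (u : H) :
    MemH A k ((Λ ^ k) u) := by
  induction k generalizing u with
  | zero => simpa using hA.memH_zero u
  | succ k ih =>
    rw [pow_succ', mul_apply_eq_comp, hΛ.memH_iff hA]
    convert ih u using 1
    push_cast; ring

/-- The preimage has components `√μ P_μ u`. They are square summable because `μ ≤ ω⁻ᵏ μ^{k+1}` on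
the spectrum, which lies in `[ω, ∞)`. -/
theorem exists_of_memH_succ (hΛ : IsInvSqrt A Λ) (hA : A1 A) (k : ℕ) {u : H}
    (hu : MemH A (k + 1) u) : ∃ x, Λ x = u := by
  obtain ⟨ω, hω, h0⟩ := hA.eigenProj_eq_zero
  have hs : Summable fun μ : ℝ => ‖((√μ : ℝ) : 𝕜) • eigenProj A μ u‖ ^ 2 := by
    refine (hu.mul_left (ω ^ k)⁻¹).of_nonneg_of_le (fun μ => by positivity) fun μ => ?_
    rcases lt_or_ge μ ω with h | h
    · simp [h0 μ h]
    · have hμ : 0 < μ := by linarith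
      rw [norm_smul, RCLike.norm_ofReal, mul_pow, sq_abs, Real.sq_sqrt hμ.le, ← mul_assoc]
      gcongr
      rw [inv_mul_eq_div, le_div_iff₀ (by positivity), zpow_add_one₀ hμ.ne', zpow_natCast,
        mul_comm]
      gcongr
  obtain ⟨x, hx⟩ := hA.exists_of_summable
    (fun μ => Submodule.smul_mem _ _ (hA.eigenProj_mem μ u)) hs
  refine ⟨x, hA.ext_eigenProj fun μ => ?_⟩
  rcases le_or_gt μ 0 with h | h
  · simp [hA.eigenProj_nonpos h]
  · rw [hΛ, hx, smul_smul, ← RCLike.ofReal_mul, inv_mul_cancel₀ (Real.sqrt_pos.2 h).ne']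
    simp

theorem exists_pow_of_memH (hΛ : IsInvSqrt A Λ) (hA : A1 A) (k : ℕ) {u : H}
    (hu : MemH A k u) : ∃ x, (Λ ^ k) x = u := by
  induction k generalizing u with
  | zero => exact ⟨u, rfl⟩
  | succ k ih =>
    obtain ⟨y, rfl⟩ := hΛ.exists_of_memH_succ hA k (by exact_mod_cast hu)
    rw [hΛ.memH_iff hA] at hu
    obtain ⟨x, rfl⟩ := ih (u := y) (by convert hu using 1; push_cast; ring)
    exact ⟨x, by rw [pow_succ', mul_apply_eq_comp]⟩

theorem apply_apply_domain (hΛ : IsInvSqrt A Λ) (hA : A1 A) (x : A.domain) :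
    Λ (Λ (A x)) = x := by
  refine hA.ext_eigenProj fun μ => ?_
  rcases le_or_gt μ 0 with h | h
  · simp [hA.eigenProj_nonpos h]
  · rw [hΛ, hΛ, hA.eigenProj_apply, smul_smul, smul_smul, ← RCLike.ofReal_mul,
      ← RCLike.ofReal_mul]
    have : (√μ)⁻¹ * ((√μ)⁻¹ * μ) = 1 := by
      rw [← mul_assoc, ← mul_inv, Real.mul_self_sqrt h.le, inv_mul_cancel₀ h.ne']
    rw [← mul_assoc] at this
    simp [this]

theorem exists_mem_domain (hΛ : IsInvSqrt A Λ) (hA : A1 A) (g : H) :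
    ∃ h : Λ (Λ g) ∈ A.domain, A ⟨Λ (Λ g), h⟩ = g := by
  obtain ⟨R, -, -, h1, h2⟩ := hA.exists_inverse
  obtain ⟨h, hg⟩ := h1 g
  have := hΛ.apply_apply_domain hA ⟨R g, h⟩
  rw [hg] at this
  simp only at this
  have hm : Λ (Λ g) ∈ A.domain := by rw [this]; exact h
  refine ⟨hm, ?_⟩
  have he : (⟨Λ (Λ g), hm⟩ : A.domain) = ⟨R g, h⟩ := Subtype.ext this
  rw [he, hg]

end IsInvSqrt

end Spectral

/-! ### Strong solutions in the variables `(r, q)` and the energy inequality. -/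

section WaveSol

theorem integral_eq_sub_of_hasDerivWithinAt {E : Type*} [NormedAddCommGroup E] [NormedSpace ℝ E]
    [CompleteSpace E] {g g' : ℝ → E} {a b : ℝ}
    (hd : ∀ t ∈ Icc a b, HasDerivWithinAt g (g' t) (Icc a b) t) (hc : ContinuousOn g' (Icc a b))
    {s t : ℝ} (hs : a ≤ s) (hst : s ≤ t) (ht : t ≤ b) : ∫ x in s..t, g' x = g t - g s := by
  have hsub : Icc s t ⊆ Icc a b := Icc_subset_Icc hs ht
  refine intervalIntegral.integral_eq_sub_of_hasDerivAt_of_le hst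
    (fun x hx => ((hd x (hsub hx)).mono hsub).continuousWithinAt) (fun x hx => ?_) ?_
  · exact (hd x (hsub (Ioo_subset_Icc_self hx))).hasDerivAt
      (Icc_mem_nhds (hs.trans_lt hx.1) (hx.2.trans_le ht))
  · refine ContinuousOn.intervalIntegrable ?_
    rw [uIcc_of_le hst]
    exact hc.mono hsub

variable {𝕜 : Type*} [RCLike 𝕜] {H : Type*} [NormedAddCommGroup H] [InnerProductSpace 𝕜 H]

/-- Twice the energy of level `1 - k`, for `r = A w` and `w' = Λ q`. -/
noncomputable def waveEnergy (Λ : H →L[𝕜] H) (k : ℕ) (r q : H) : ℝ :=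
  ‖(Λ ^ k) (Λ r)‖ ^ 2 + ‖(Λ ^ k) (Λ q)‖ ^ 2

theorem waveEnergy_nonneg (Λ : H →L[𝕜] H) (k : ℕ) (r q : H) : 0 ≤ waveEnergy Λ k r q := by
  unfold waveEnergy; positivity

theorem pow_apply_comm (Λ : H →L[𝕜] H) (k : ℕ) (x : H) : (Λ ^ k) (Λ x) = Λ ((Λ ^ k) x) := by
  rw [← mul_apply_eq_comp, ← mul_apply_eq_comp, ← pow_succ, ← pow_succ']

variable [NormedSpace ℝ H]

/-- A strong solution of `w'' + A w = f`, written with `r = A w`, `w' = Λ q` and `Λ = A^{-1/2}`. -/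
structure IsWaveSol (Λ : H →L[𝕜] H) (f : ℝ → H) (S : Set ℝ) (r q : ℝ → H) : Prop where
  continuous_source : ContinuousOn f S
  continuous_fst : ContinuousOn r S
  continuous_snd : ContinuousOn q S
  deriv_fst : ∀ t ∈ S, HasDerivWithinAt (fun s => Λ (r s)) (q t) S t
  deriv_snd : ∀ t ∈ S, HasDerivWithinAt (fun s => Λ (q s)) (f t - r t) S t

variable {Λ : H →L[𝕜] H} {f g r q r' q' : ℝ → H} {S S' : Set ℝ}

theorem IsWaveSol.mono (h : IsWaveSol Λ f S r q) (hS : S' ⊆ S) : IsWaveSol Λ f S' r q where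
  continuous_source := h.continuous_source.mono hS
  continuous_fst := h.continuous_fst.mono hS
  continuous_snd := h.continuous_snd.mono hS
  deriv_fst t ht := (h.deriv_fst t (hS ht)).mono hS
  deriv_snd t ht := (h.deriv_snd t (hS ht)).mono hS

theorem IsWaveSol.congr_source {f g r q : ℝ → H} {S : Set ℝ} (h : IsWaveSol Λ f S r q)
    (hfg : ∀ t ∈ S, g t = f t) : IsWaveSol Λ g S r q where
  continuous_source := h.continuous_source.congr hfg
  continuous_fst := h.continuous_fst
  continuous_snd := h.continuous_snd
  deriv_fst := h.deriv_fst
  deriv_snd t ht := by rw [hfg t ht]; exact h.deriv_snd t ht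

theorem IsWaveSol.sub (h : IsWaveSol Λ f S r q) (h' : IsWaveSol Λ g S r' q') :
    IsWaveSol Λ (fun t => f t - g t) S (fun t => r t - r' t) (fun t => q t - q' t) where
  continuous_source := h.continuous_source.sub h'.continuous_source
  continuous_fst := h.continuous_fst.sub h'.continuous_fst
  continuous_snd := h.continuous_snd.sub h'.continuous_snd
  deriv_fst t ht := by
    simpa only [map_sub] using! (h.deriv_fst t ht).sub (h'.deriv_fst t ht)
  deriv_snd t ht := by
    simp only [map_sub]
    exact ((h.deriv_snd t ht).fun_sub (h'.deriv_snd t ht)).congr_deriv (by abel)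

theorem IsWaveSol.shift (h : IsWaveSol Λ f (Ici 0) r q) {a : ℝ} (ha : 0 ≤ a) :
    IsWaveSol Λ (fun t => f (a + t)) (Ici 0) (fun t => r (a + t)) (fun t => q (a + t)) := by
  have hm : MapsTo (fun t : ℝ => a + t) (Ici 0) (Ici 0) := fun t ht => by
    simp only [mem_Ici] at *; linarith
  have hc : ContinuousOn (fun t : ℝ => a + t) (Ici 0) := by fun_prop
  have hd : ∀ t, HasDerivWithinAt (fun t : ℝ => a + t) 1 (Ici 0) t := fun t =>
    ((hasDerivAt_id t).const_add a).hasDerivWithinAt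
  refine ⟨h.continuous_source.comp hc hm, h.continuous_fst.comp hc hm,
    h.continuous_snd.comp hc hm, fun t ht => ?_, fun t ht => ?_⟩
  · simpa using! (h.deriv_fst (a + t) (hm ht)).scomp t (hd t) hm
  · simpa using! (h.deriv_snd (a + t) (hm ht)).scomp t (hd t) hm

theorem hasDerivWithinAt_re_inner {g₁ g₂ : ℝ → H} {g₁' g₂' : H} {t : ℝ}
    (h₁ : HasDerivWithinAt g₁ g₁' S t) (h₂ : HasDerivWithinAt g₂ g₂' S t) :
    HasDerivWithinAt (fun s => RCLike.re (inner 𝕜 (g₁ s) (g₂ s)))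
      (RCLike.re (inner 𝕜 (g₁ t) g₂') + RCLike.re (inner 𝕜 g₁' (g₂ t))) S t := by
  have := (RCLike.reCLM (K := 𝕜)).hasFDerivAt.comp_hasDerivWithinAt t (h₁.inner 𝕜 h₂)
  simpa using! this

theorem IsWaveSol.continuousOn_energy (h : IsWaveSol Λ f S r q) (k : ℕ) :
    ContinuousOn (fun t => waveEnergy Λ k (r t) (q t)) S := by
  unfold waveEnergy
  have h1 := ((Λ ^ k).continuous.comp Λ.continuous).comp_continuousOn h.continuous_fst
  have h2 := ((Λ ^ k).continuous.comp Λ.continuous).comp_continuousOn h.continuous_snd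
  exact (h1.norm.pow 2).add (h2.norm.pow 2)

variable [IsScalarTower ℝ 𝕜 H]

theorem hasDerivWithinAt_clm {E : Type*} [NormedAddCommGroup E] [NormedSpace 𝕜 E]
    [NormedSpace ℝ E] [IsScalarTower ℝ 𝕜 E] (L : H →L[𝕜] E) {g : ℝ → H} {g' : H} {t : ℝ}
    (h : HasDerivWithinAt g g' S t) : HasDerivWithinAt (fun s => L (g s)) (L g') S t :=
  ((L.restrictScalars ℝ).hasFDerivAt.comp_hasDerivWithinAt t h)

theorem map_real_smul_clm (L : H →L[𝕜] H) (c : ℝ) (x : H) : L (c • x) = c • L x :=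
  (L.restrictScalars ℝ).map_smul c x

theorem hasDerivWithinAt_norm_sq (𝕜 : Type*) [RCLike 𝕜] [InnerProductSpace 𝕜 H]
    [IsScalarTower ℝ 𝕜 H] {g : ℝ → H} {g' : H} {t : ℝ} (h : HasDerivWithinAt g g' S t) :
    HasDerivWithinAt (fun s => ‖g s‖ ^ 2) (2 * RCLike.re (inner 𝕜 (g t) g')) S t := by
  have := hasDerivWithinAt_re_inner (𝕜 := 𝕜) h h
  rw [inner_re_symm (𝕜 := 𝕜) g' (g t)] at this
  simpa only [inner_self_eq_norm_sq, two_mul] using this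

/-- Powers of `Λ` commute with the equation, so estimates in weaker norms reduce to the case `k =
0`. -/
theorem IsWaveSol.map_pow (h : IsWaveSol Λ f S r q) (k : ℕ) :
    IsWaveSol Λ (fun t => (Λ ^ k) (f t)) S (fun t => (Λ ^ k) (r t)) (fun t => (Λ ^ k) (q t)) where
  continuous_source := (Λ ^ k).continuous.comp_continuousOn h.continuous_source
  continuous_fst := (Λ ^ k).continuous.comp_continuousOn h.continuous_fst
  continuous_snd := (Λ ^ k).continuous.comp_continuousOn h.continuous_snd
  deriv_fst t ht := by
    simpa only [pow_apply_comm] using hasDerivWithinAt_clm (Λ ^ k) (h.deriv_fst t ht)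
  deriv_snd t ht := by
    simpa only [pow_apply_comm, map_sub] using hasDerivWithinAt_clm (Λ ^ k) (h.deriv_snd t ht)

theorem IsWaveSol.deriv_energy (h : IsWaveSol Λ f S r q)
    (hΛ : ∀ x y, inner 𝕜 (Λ x) y = inner 𝕜 x (Λ y)) {t : ℝ} (ht : t ∈ S) :
    HasDerivWithinAt (fun s => waveEnergy Λ 0 (r s) (q s))
      (2 * RCLike.re (inner 𝕜 (Λ (q t)) (f t))) S t := by
  have := (hasDerivWithinAt_norm_sq 𝕜 (h.deriv_fst t ht)).fun_add
    (hasDerivWithinAt_norm_sq 𝕜 (h.deriv_snd t ht))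
  refine this.congr_deriv ?_
  rw [inner_sub_right, map_sub, hΛ (r t) (q t), inner_re_symm (𝕜 := 𝕜) (r t)]
  ring

/-- The energy inequality, forward and backward in time. -/
theorem IsWaveSol.sqrt_energy_le_zero {a b : ℝ} (h : IsWaveSol Λ f (Icc a b) r q)
    (hΛ : ∀ x y, inner 𝕜 (Λ x) y = inner 𝕜 x (Λ y)) {s t : ℝ} (hs : s ∈ Icc a b)
    (ht : t ∈ Icc a b) :
    √(waveEnergy Λ 0 (r t) (q t)) ≤ √(waveEnergy Λ 0 (r s) (q s)) + ∫ x in a..b, ‖f x‖ := by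
  have hab : a ≤ b := hs.1.trans hs.2
  have hcf : ContinuousOn (fun x => ‖f x‖) (Icc a b) := h.continuous_source.norm
  set E : ℝ → ℝ := fun x => waveEnergy Λ 0 (r x) (q x) with hE
  have hE0 : ∀ x, 0 ≤ E x := fun x => waveEnergy_nonneg _ _ _ _
  have hdE : ∀ x ∈ Icc a b, HasDerivWithinAt E
      (2 * RCLike.re (inner 𝕜 (Λ (q x)) (f x))) (Icc a b) x := fun x hx => h.deriv_energy hΛ hx
  have hcE : ContinuousOn E (Icc a b) := fun x hx => (hdE x hx).continuousWithinAt
  -- The energy may vanish, where its square root need not be differentiable; `ε ^ 2` is added under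
  -- the root and removed at the end. The regularised root has derivative at most `‖f‖` in absolute
  -- value, which gives the estimate in both directions of time.
  have key : ∀ ε : ℝ, 0 < ε → √(E t) ≤ √(E s) + ε + ∫ x in a..b, ‖f x‖ := by
    intro ε hε
    have hpos : ∀ x, 0 < E x + ε ^ 2 := fun x => by have := hE0 x; positivity
    set N' : ℝ → ℝ := fun x => (2 * RCLike.re (inner 𝕜 (Λ (q x)) (f x))) / (2 * √(E x + ε ^ 2))
      with hN'
    have hd : ∀ x ∈ Icc a b, HasDerivWithinAt (fun x => √(E x + ε ^ 2)) (N' x) (Icc a b) x :=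
      fun x hx => ((hdE x hx).add_const _).sqrt (hpos x).ne'
    have hcN : ContinuousOn N' (Icc a b) := by
      refine ContinuousOn.div ?_ ?_ fun x _ => ?_
      · exact continuousOn_const.mul (RCLike.continuous_re.comp_continuousOn
          ((Λ.continuous.comp_continuousOn h.continuous_snd).inner (𝕜 := 𝕜) h.continuous_source))
      · exact continuousOn_const.mul (hcE.add continuousOn_const).sqrt
      · have := Real.sqrt_pos.2 (hpos x); positivity
    have hbd : ∀ x, |N' x| ≤ ‖f x‖ := by
      intro x
      have h1 := Real.sqrt_pos.2 (hpos x)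
      have h2 : ‖Λ (q x)‖ ≤ √(E x + ε ^ 2) := by
        refine Real.le_sqrt_of_sq_le ?_
        have : E x = ‖Λ (r x)‖ ^ 2 + ‖Λ (q x)‖ ^ 2 := by simp [hE, waveEnergy]
        rw [this]
        nlinarith [sq_nonneg ‖Λ (r x)‖, sq_nonneg ε]
      rw [hN']
      simp only
      rw [mul_div_mul_left _ _ two_ne_zero, abs_div, abs_of_pos h1, div_le_iff₀ h1]
      calc |RCLike.re (inner 𝕜 (Λ (q x)) (f x))| ≤ ‖inner 𝕜 (Λ (q x)) (f x)‖ :=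
            RCLike.abs_re_le_norm _
        _ ≤ ‖Λ (q x)‖ * ‖f x‖ := norm_inner_le_norm _ _
        _ ≤ ‖f x‖ * √(E x + ε ^ 2) := by rw [mul_comm]; gcongr
    have hIle : ∀ u v, a ≤ u → u ≤ v → v ≤ b →
        |√(E v + ε ^ 2) - √(E u + ε ^ 2)| ≤ ∫ x in a..b, ‖f x‖ := by
      intro u v hu huv hv
      rw [← integral_eq_sub_of_hasDerivWithinAt hd hcN hu huv hv]
      refine (intervalIntegral.abs_integral_le_integral_abs huv).trans ?_
      have hi : ∀ {c d : ℝ}, a ≤ c → c ≤ d → d ≤ b →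
          IntervalIntegrable (fun x => ‖f x‖) volume c d := fun {c d} hc hcd hd => by
        refine ContinuousOn.intervalIntegrable ?_
        rw [uIcc_of_le hcd]
        exact hcf.mono (Icc_subset_Icc hc hd)
      have hi' : IntervalIntegrable (fun x => |N' x|) volume u v := by
        refine ContinuousOn.intervalIntegrable ?_
        rw [uIcc_of_le huv]
        exact (hcN.mono (Icc_subset_Icc hu hv)).abs
      refine (intervalIntegral.integral_mono_on huv hi' (hi hu huv hv) fun x _ => hbd x).trans ?_
      exact intervalIntegral.integral_mono_interval hu huv hv
        (ae_of_all _ fun x => norm_nonneg _) (hi le_rfl hab le_rfl)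
    have h3 : |√(E t + ε ^ 2) - √(E s + ε ^ 2)| ≤ ∫ x in a..b, ‖f x‖ := by
      rcases le_total s t with hst | hst
      · exact hIle s t hs.1 hst ht.2
      · rw [abs_sub_comm]; exact hIle t s ht.1 hst hs.2
    have h4 : √(E t) ≤ √(E t + ε ^ 2) := Real.sqrt_le_sqrt (by nlinarith)
    have h5 : √(E s + ε ^ 2) ≤ √(E s) + ε := by
      refine Real.sqrt_le_iff.2 ⟨by positivity, ?_⟩
      nlinarith [Real.sq_sqrt (hE0 s), Real.sqrt_nonneg (E s)]
    have := (abs_le.1 h3).2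
    linarith
  refine le_of_forall_pos_le_add fun ε hε => ?_
  have := key ε hε
  linarith

theorem IsWaveSol.sqrt_energy_le {a b : ℝ} (h : IsWaveSol Λ f (Icc a b) r q)
    (hΛ : ∀ x y, inner 𝕜 (Λ x) y = inner 𝕜 x (Λ y)) (k : ℕ) {s t : ℝ} (hs : s ∈ Icc a b)
    (ht : t ∈ Icc a b) :
    √(waveEnergy Λ k (r t) (q t)) ≤
      √(waveEnergy Λ k (r s) (q s)) + ∫ x in a..b, ‖(Λ ^ k) (f x)‖ := by
  have := (h.map_pow k).sqrt_energy_le_zero hΛ hs ht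
  simpa only [waveEnergy, pow_apply_comm, pow_zero, one_apply_eq_self] using this

end WaveSol

/-! ### The free equation, solved by functional calculus. -/

section Free

variable {𝕜 : Type*} [RCLike 𝕜] {H : Type*} [NormedAddCommGroup H] [InnerProductSpace 𝕜 H]
  [CompleteSpace H] {A : H →ₗ.[𝕜] H}

/-- Continuity is dominated convergence in the Parseval sum of `‖g s - g t‖²`, with dominating terms
`4 ‖P_μ x‖²`. -/
theorem A1.exists_curve (hA : A1 A) (φ : ℝ → ℝ → ℝ) (hb : ∀ t μ, |φ t μ| ≤ 1)
    (hc : ∀ μ, Continuous fun t => φ t μ) (x : H) :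
    ∃ g : ℝ → H, Continuous g ∧ ∀ t μ, eigenProj A μ (g t) = (φ t μ : 𝕜) • eigenProj A μ x := by
  have hex : ∀ t, ∃ y : H, ∀ μ, eigenProj A μ y = (φ t μ : 𝕜) • eigenProj A μ x := by
    intro t
    obtain ⟨M, hM⟩ := hA.exists_specOp (φ t) 1 fun μ _ => hb t μ
    exact ⟨M x, hM x⟩
  choose g hg using hex
  refine ⟨g, ?_, hg⟩
  rw [continuous_iff_continuousAt]
  intro t
  rw [ContinuousAt, tendsto_iff_norm_sub_tendsto_zero]
  have hsq : Tendsto (fun s => ‖g s - g t‖ ^ 2) (𝓝 t) (𝓝 0) := by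
    have h1 : ∀ s, ‖g s - g t‖ ^ 2 = ∑' μ, |φ s μ - φ t μ| ^ 2 * ‖eigenProj A μ x‖ ^ 2 := by
      intro s
      rw [← (hA.hasSum_norm_sq (g s - g t)).tsum_eq]
      refine tsum_congr fun μ => ?_
      rw [eigenProj_sub, hg, hg, ← sub_smul, norm_smul, mul_pow, ← RCLike.ofReal_sub,
        RCLike.norm_ofReal]
    simp only [h1]
    have h2 := tendsto_tsum_of_dominated_convergence (𝓕 := 𝓝 t)
      (f := fun s μ => |φ s μ - φ t μ| ^ 2 * ‖eigenProj A μ x‖ ^ 2) (g := fun _ => (0 : ℝ))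
      (bound := fun μ => 2 ^ 2 * ‖eigenProj A μ x‖ ^ 2)
      ((hA.hasSum_norm_sq x).summable.mul_left _) ?_ ?_
    · simpa using h2
    · intro μ
      have : ContinuousAt (fun s => |φ s μ - φ t μ| ^ 2 * ‖eigenProj A μ x‖ ^ 2) t := by
        have := (hc μ).continuousAt (x := t)
        fun_prop
      simpa [ContinuousAt] using this
    · refine Eventually.of_forall fun s μ => ?_
      rw [Real.norm_of_nonneg (by positivity)]
      have : |φ s μ - φ t μ| ≤ 2 := (abs_sub _ _).trans (by linarith [hb s μ, hb t μ])
      gcongr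
  have := hsq.sqrt
  simpa [Real.sqrt_sq] using this

variable [NormedSpace ℝ H] [IsScalarTower ℝ 𝕜 H]

/-- Differentiability of each spectral component suffices once the candidate derivative is
continuous: `g` and the integral of `g'` have the same components, since the differences have zero
derivative and vanish at `0`. -/
theorem A1.hasDerivAt_of_eigenProj (hA : A1 A) {g g' : ℝ → H} (hc : Continuous g')
    (h : ∀ μ t, HasDerivAt (fun s => eigenProj A μ (g s)) (eigenProj A μ (g' t)) t) (t : ℝ) :
    HasDerivAt g (g' t) t := by
  set G : ℝ → H := fun t => g 0 + ∫ s in (0 : ℝ)..t, g' s with hG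
  have hGd : ∀ t, HasDerivAt G (g' t) t := fun t =>
    (intervalIntegral.integral_hasDerivAt_right (hc.intervalIntegrable _ _)
      (hc.stronglyMeasurableAtFilter _ _) hc.continuousAt).const_add _
  have heq : g = G := by
    funext t
    refine hA.ext_eigenProj fun μ => ?_
    have hd : ∀ t, HasDerivAt (fun s => eigenProj A μ (g s) - eigenProj A μ (G s)) 0 t := by
      intro t
      have h1 := hasDerivWithinAt_clm (eigenProjL A μ) (hGd t).hasDerivWithinAt (S := univ)
      rw [hasDerivWithinAt_univ] at h1
      exact ((h μ t).fun_sub h1).congr_deriv (sub_self _)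
    have hconst := is_const_of_deriv_eq_zero (fun t => (hd t).differentiableAt)
      (fun t => (hd t).deriv) t 0
    have h0 : G 0 = g 0 := by simp [hG]
    simp only [h0, sub_self] at hconst
    exact sub_eq_zero.1 hconst
  rw [heq]
  exact hGd t

/-- The free wave equation has a strong solution for all smooth initial data. -/
theorem A1.exists_free (hA : A1 A) {Λ : H →L[𝕜] H} (hΛ : IsInvSqrt A Λ) (r₀ q₀ : H) :
    ∃ r q : ℝ → H, r 0 = r₀ ∧ q 0 = q₀ ∧ IsWaveSol Λ (fun _ => 0) (Ici 0) r q := by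
  have hcos : ∀ μ : ℝ, Continuous fun t => Real.cos (√μ * t) := fun μ => by fun_prop
  have hsin : ∀ μ : ℝ, Continuous fun t => Real.sin (√μ * t) := fun μ => by fun_prop
  obtain ⟨r₁, hr₁c, hr₁⟩ := hA.exists_curve (fun t μ => Real.cos (√μ * t))
    (fun t μ => Real.abs_cos_le_one _) hcos r₀
  obtain ⟨r₂, hr₂c, hr₂⟩ := hA.exists_curve (fun t μ => Real.sin (√μ * t))
    (fun t μ => Real.abs_sin_le_one _) hsin q₀
  obtain ⟨q₁, hq₁c, hq₁⟩ := hA.exists_curve (fun t μ => Real.sin (√μ * t))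
    (fun t μ => Real.abs_sin_le_one _) hsin r₀
  obtain ⟨q₂, hq₂c, hq₂⟩ := hA.exists_curve (fun t μ => Real.cos (√μ * t))
    (fun t μ => Real.abs_cos_le_one _) hcos q₀
  have hdc : ∀ (μ t : ℝ) (x : H), 0 < μ →
      HasDerivAt (fun s => (((√μ)⁻¹ : ℝ) : 𝕜) • ((Real.cos (√μ * s) : ℝ) : 𝕜) • x)
        (-(((Real.sin (√μ * t) : ℝ) : 𝕜) • x)) t := by
    intro μ t x hμ
    have hs := (Real.sqrt_pos.2 hμ).ne'
    have h1 : HasDerivAt (fun s => (√μ)⁻¹ * Real.cos (√μ * s)) (-Real.sin (√μ * t)) t := by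
      have := (((hasDerivAt_id t).const_mul (√μ)).cos).const_mul (√μ)⁻¹
      refine this.congr_deriv ?_
      field_simp
      rfl
    have h2 := h1.smul_const x
    have e1 : ∀ a : ℝ, (a : ℝ) • x = (a : 𝕜) • x := fun a => (algebraMap_smul 𝕜 a x).symm
    simp only [e1, RCLike.ofReal_mul, RCLike.ofReal_neg, neg_smul] at h2
    simpa only [smul_smul] using h2
  have hds : ∀ (μ t : ℝ) (x : H), 0 < μ →
      HasDerivAt (fun s => (((√μ)⁻¹ : ℝ) : 𝕜) • ((Real.sin (√μ * s) : ℝ) : 𝕜) • x)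
        (((Real.cos (√μ * t) : ℝ) : 𝕜) • x) t := by
    intro μ t x hμ
    have hs := (Real.sqrt_pos.2 hμ).ne'
    have h1 : HasDerivAt (fun s => (√μ)⁻¹ * Real.sin (√μ * s)) (Real.cos (√μ * t)) t := by
      have := (((hasDerivAt_id t).const_mul (√μ)).sin).const_mul (√μ)⁻¹
      refine this.congr_deriv ?_
      field_simp
      rfl
    have h2 := h1.smul_const x
    have e1 : ∀ a : ℝ, (a : ℝ) • x = (a : 𝕜) • x := fun a => (algebraMap_smul 𝕜 a x).symm
    simp only [e1, RCLike.ofReal_mul] at h2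
    simpa only [smul_smul] using h2
  have hz : ∀ μ : ℝ, μ ≤ 0 → ∀ g g' : ℝ → H, ∀ t,
      HasDerivAt (fun s => eigenProj A μ (g s)) (eigenProj A μ (g' t)) t := by
    intro μ hμ g g' t
    simpa only [hA.eigenProj_nonpos hμ] using hasDerivAt_const t (0 : H)
  have hrc : Continuous fun t => r₁ t + r₂ t := hr₁c.add hr₂c
  have hqc : Continuous fun t => q₂ t - q₁ t := hq₂c.sub hq₁c
  -- In terms of `A`: `r = cos(√A t) r₀ + sin(√A t) q₀` and `q = cos(√A t) q₀ - sin(√A t) r₀`.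
  refine ⟨fun t => r₁ t + r₂ t, fun t => q₂ t - q₁ t, ?_, ?_, continuousOn_const, hrc.continuousOn,
    hqc.continuousOn, fun t _ => ?_, fun t _ => ?_⟩
  · refine hA.ext_eigenProj fun μ => ?_
    simp [eigenProj_add, hr₁, hr₂]
  · refine hA.ext_eigenProj fun μ => ?_
    simp [eigenProj_sub, hq₁, hq₂]
  · refine (hA.hasDerivAt_of_eigenProj hqc (fun μ t => ?_) t).hasDerivWithinAt
    rcases le_or_gt μ 0 with hμ | hμ
    · exact hz μ hμ (fun s => Λ (r₁ s + r₂ s)) (fun t => q₂ t - q₁ t) t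
    · simp only [hΛ _ μ, eigenProj_add, eigenProj_sub, hr₁, hr₂, hq₁, hq₂, smul_add]
      exact ((hdc μ t _ hμ).fun_add (hds μ t _ hμ)).congr_deriv (by abel)
  · refine (hA.hasDerivAt_of_eigenProj (g' := fun t => 0 - (r₁ t + r₂ t))
      (continuous_const.sub hrc) (fun μ t => ?_) t).hasDerivWithinAt
    rcases le_or_gt μ 0 with hμ | hμ
    · exact hz μ hμ (fun s => Λ (q₂ s - q₁ s)) (fun t => 0 - (r₁ t + r₂ t)) t
    · simp only [hΛ _ μ, zero_sub, eigenProj_neg, eigenProj_add, eigenProj_sub, hr₁, hr₂, hq₁,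
        hq₂, smul_sub]
      exact ((hdc μ t _ hμ).fun_sub (hds μ t _ hμ)).congr_deriv (by abel)

end Free

/-! ### Elementary integral inequalities. -/

section Calculus

theorem intervalIntegrable_of_Ici {E : Type*} [NormedAddCommGroup E] {g : ℝ → E}
    (hg : ContinuousOn g (Ici 0)) {a b : ℝ} (ha : 0 ≤ a) (hb : 0 ≤ b) :
    IntervalIntegrable g volume a b := by
  refine ContinuousOn.intervalIntegrable (hg.mono fun x hx => ?_)
  rw [mem_uIcc] at hx
  simp only [mem_Ici]
  rcases hx with h | h <;> linarith [h.1]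

theorem norm_sub_sq_le_two_mul {E : Type*} [NormedAddCommGroup E] (x y : E) :
    ‖x - y‖ ^ 2 ≤ 2 * ‖x‖ ^ 2 + 2 * ‖y‖ ^ 2 := by
  have h := pow_le_pow_left₀ (norm_nonneg _) (norm_sub_le x y) 2
  nlinarith [sq_nonneg (‖x‖ - ‖y‖)]

theorem integral_mono_Ici {g h : ℝ → ℝ} (hg : ContinuousOn g (Ici 0)) (hh : ContinuousOn h (Ici 0))
    {a b : ℝ} (ha : 0 ≤ a) (hab : a ≤ b) (hle : ∀ x ∈ Icc a b, g x ≤ h x) :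
    ∫ x in a..b, g x ≤ ∫ x in a..b, h x :=
  intervalIntegral.integral_mono_on hab (intervalIntegrable_of_Ici hg ha (ha.trans hab))
    (intervalIntegrable_of_Ici hh ha (ha.trans hab)) hle

theorem integral_mono_interval_Ici {g : ℝ → ℝ} (hg : ContinuousOn g (Ici 0)) (h0 : ∀ x, 0 ≤ g x)
    {a b c d : ℝ} (hc : 0 ≤ c) (hca : c ≤ a) (hab : a ≤ b) (hbd : b ≤ d) :
    ∫ x in a..b, g x ≤ ∫ x in c..d, g x :=
  intervalIntegral.integral_mono_interval hca hab hbd (ae_of_all _ h0)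
    (intervalIntegrable_of_Ici hg hc (hc.trans (hca.trans (hab.trans hbd))))

/-- Cauchy–Schwarz, from the nonnegativity of the integral of the squared deviation from the mean.
-/
theorem sq_integral_le {g : ℝ → ℝ} {a b : ℝ} (hab : a ≤ b) (hg : ContinuousOn g (Icc a b)) :
    (∫ x in a..b, g x) ^ 2 ≤ (b - a) * ∫ x in a..b, g x ^ 2 := by
  rcases hab.eq_or_lt with rfl | hlt
  · simp
  have hi : IntervalIntegrable g volume a b := by
    refine ContinuousOn.intervalIntegrable ?_
    rwa [uIcc_of_le hab]
  have hi2 : IntervalIntegrable (fun x => g x ^ 2) volume a b := by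
    refine ContinuousOn.intervalIntegrable ?_
    rw [uIcc_of_le hab]
    exact hg.pow 2
  set m := ∫ x in a..b, g x with hm
  have hba : 0 < b - a := sub_pos.2 hlt
  have h1 : 0 ≤ ∫ x in a..b, (g x - m / (b - a)) ^ 2 :=
    intervalIntegral.integral_nonneg hab fun x _ => sq_nonneg _
  have h2 : ∫ x in a..b, (g x - m / (b - a)) ^ 2 =
      (∫ x in a..b, g x ^ 2) - 2 * (m / (b - a)) * m + (b - a) * (m / (b - a)) ^ 2 := by
    have : ∀ x, (g x - m / (b - a)) ^ 2 =
        (g x ^ 2 - 2 * (m / (b - a)) * g x) + (m / (b - a)) ^ 2 := fun x => by ring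
    simp only [this]
    rw [intervalIntegral.integral_add (hi2.sub (hi.const_mul _)) (by simp),
      intervalIntegral.integral_sub hi2 (hi.const_mul _), intervalIntegral.integral_const_mul,
      intervalIntegral.integral_const]
    simp [hm]
  rw [h2] at h1
  have h3 : (b - a) * ((∫ x in a..b, g x ^ 2) - 2 * (m / (b - a)) * m +
      (b - a) * (m / (b - a)) ^ 2) = (b - a) * (∫ x in a..b, g x ^ 2) - m ^ 2 := by
    field_simp
    ring
  have := mul_nonneg hba.le h1
  rw [h3] at this
  linarith

theorem exists_mul_le_integral {g : ℝ → ℝ} {a b : ℝ} (hab : a ≤ b) (hg : ContinuousOn g (Icc a b)) :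
    ∃ s ∈ Icc a b, (b - a) * g s ≤ ∫ x in a..b, g x := by
  obtain ⟨s, hs, hmin⟩ := isCompact_Icc.exists_isMinOn (nonempty_Icc.2 hab) hg
  refine ⟨s, hs, ?_⟩
  have h1 : ∫ _ in a..b, g s = (b - a) * g s := by simp
  rw [← h1]
  refine intervalIntegral.integral_mono_on hab (by simp) ?_ fun x hx => hmin hx
  refine ContinuousOn.intervalIntegrable ?_
  rwa [uIcc_of_le hab]

/-- If `e(s)` is bounded by the integral of `g` over the window `[s, s + τ]` for all `s`, then the
integral of `e` is bounded by the integral of `g`. -/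
theorem integral_le_of_window {e g : ℝ → ℝ} (he : ContinuousOn e (Ici 0))
    (hg : ContinuousOn g (Ici 0)) (h0 : ∀ x, 0 ≤ g x) {c τ a : ℝ} (hc : 0 ≤ c) (hτ : 0 ≤ τ)
    (ha : 0 ≤ a) (h : ∀ s, 0 ≤ s → e s ≤ c * ∫ x in s..s + τ, g x) :
    ∫ s in (0 : ℝ)..a, e s ≤ c * τ * ∫ x in (0 : ℝ)..a + τ, g x := by
  -- Extending `g` by a constant to negative times gives a primitive `F` that is continuous on the
  -- whole line.
  set g' : ℝ → ℝ := fun x => g (max x 0) with hg'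
  have hg'c : Continuous g' := by
    refine hg.comp_continuous (by fun_prop) fun x => ?_
    simp
  have hcongr : ∀ {u v : ℝ}, 0 ≤ u → u ≤ v → ∫ x in u..v, g x = ∫ x in u..v, g' x := by
    intro u v hu huv
    refine intervalIntegral.integral_congr fun x hx => ?_
    rw [uIcc_of_le huv] at hx
    simp [hg', max_eq_left (hu.trans hx.1)]
  set F : ℝ → ℝ := fun t => ∫ x in (0 : ℝ)..t, g' x with hF
  have hFc : Continuous F := intervalIntegral.continuous_primitive
    (fun a b => hg'c.intervalIntegrable a b) 0
  have hmono : Monotone F := by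
    intro u v huv
    rw [hF]
    simp only
    rw [← sub_nonneg, intervalIntegral.integral_interval_sub_left (hg'c.intervalIntegrable _ _)
      (hg'c.intervalIntegrable _ _)]
    exact intervalIntegral.integral_nonneg huv fun x _ => h0 _
  have hF0 : F 0 = 0 := by simp [hF]
  have hii : ∀ u v, IntervalIntegrable F volume u v := fun u v => hFc.intervalIntegrable u v
  have hs : ∀ s, 0 ≤ s → e s ≤ c * (F (s + τ) - F s) := by
    intro s hs
    refine (h s hs).trans (le_of_eq ?_)
    rw [hcongr hs (by linarith), hF]
    simp only
    rw [intervalIntegral.integral_interval_sub_left (hg'c.intervalIntegrable _ _)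
      (hg'c.intervalIntegrable _ _)]
  have h1 : ∫ s in (0 : ℝ)..a, e s ≤ ∫ s in (0 : ℝ)..a, c * (F (s + τ) - F s) := by
    refine integral_mono_Ici he ?_ le_rfl ha fun x hx => hs x hx.1
    exact (by fun_prop : Continuous fun s => c * (F (s + τ) - F s)).continuousOn
  have hsh : Continuous fun s => F (s + τ) := by fun_prop
  -- The integral of `F (s + τ) - F s` telescopes to boundary windows of length `τ`; since `F` is
  -- nondecreasing and nonnegative on `[0, ∞)`, only `τ * F (a + τ)` survives as an upper bound.
  have h2 : ∫ s in (0 : ℝ)..a, c * (F (s + τ) - F s) =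
      c * ((∫ s in a..a + τ, F s) - ∫ s in (0 : ℝ)..τ, F s) := by
    rw [intervalIntegral.integral_const_mul, intervalIntegral.integral_sub
      (hsh.intervalIntegrable _ _) (hii _ _), intervalIntegral.integral_comp_add_right,
      zero_add]
    congr 1
    have e1 := intervalIntegral.integral_add_adjacent_intervals (hii 0 τ) (hii τ (a + τ))
    have e2 := intervalIntegral.integral_add_adjacent_intervals (hii 0 a) (hii a (a + τ))
    linarith
  have h3 : ∫ s in a..a + τ, F s ≤ τ * F (a + τ) := by
    have : ∫ _ in a..a + τ, F (a + τ) = τ * F (a + τ) := by simp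
    rw [← this]
    exact intervalIntegral.integral_mono_on (by linarith) (hii _ _) (by simp)
      fun x hx => hmono hx.2
  have h4 : 0 ≤ ∫ s in (0 : ℝ)..τ, F s :=
    intervalIntegral.integral_nonneg hτ fun x hx => by
      rw [← hF0]; exact hmono hx.1
  rw [hcongr le_rfl (by linarith)]
  rw [h2] at h1
  calc _ ≤ _ := h1
    _ ≤ c * (τ * F (a + τ)) := by gcongr; linarith
    _ = _ := by rw [hF]; ring

end Calculus

/-! ### Window estimates from admissibility and observability. -/

section Observer

variable {𝕜 : Type*} [RCLike 𝕜] {H : Type*} [NormedAddCommGroup H] [InnerProductSpace 𝕜 H]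
  [NormedSpace ℝ H] {G : Type*} [NormedAddCommGroup G] [InnerProductSpace 𝕜 G]

/-- The operator `b`, acting on `(r, q)`, is admissible and observes the free equation. -/
def IsObserver (Λ : H →L[𝕜] H) (b : H × H →L[𝕜] G) : Prop :=
  ∃ T D R : ℝ, 0 < T ∧ 0 < D ∧ 0 < R ∧
    (∀ f r q : ℝ → H, IsWaveSol Λ f (Icc 0 T) r q → ∫ t in (0 : ℝ)..T, ‖b (r t, q t)‖ ^ 2 ≤
      D * (waveEnergy Λ 0 (r 0) (q 0) + waveEnergy Λ 0 (r T) (q T) +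
        (∫ t in (0 : ℝ)..T, waveEnergy Λ 0 (r t) (q t)) + ∫ t in (0 : ℝ)..T, ‖f t‖ ^ 2)) ∧
    ∀ r q : ℝ → H, IsWaveSol Λ (fun _ => 0) (Ici 0) r q →
      R * waveEnergy Λ 0 (r 0) (q 0) ≤ ∫ t in (0 : ℝ)..T, ‖b (r t, q t)‖ ^ 2

/-- Every pair is the initial value of a strong solution of the free equation. -/
def HasFreeSol (Λ : H →L[𝕜] H) : Prop :=
  ∀ r₀ q₀ : H, ∃ r q : ℝ → H, r 0 = r₀ ∧ q 0 = q₀ ∧ IsWaveSol Λ (fun _ => 0) (Ici 0) r q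

theorem IsWaveSol.continuousOn_obs {Λ : H →L[𝕜] H} {f r q : ℝ → H} {S : Set ℝ}
    (h : IsWaveSol Λ f S r q) (b : H × H →L[𝕜] G) :
    ContinuousOn (fun t => ‖b (r t, q t)‖ ^ 2) S :=
  (b.continuous.comp_continuousOn (h.continuous_fst.prodMk h.continuous_snd)).norm.pow 2

variable [IsScalarTower ℝ 𝕜 H] {Λ : H →L[𝕜] H} {b : H × H →L[𝕜] G}

/-- The free solution with the same initial data is observed from below. The difference has zero
initial data and source `f`, so admissibility and the energy inequality bound its observation by the
integral of `‖f‖²`. One observation time is enough, as the equation is invariant under time shifts.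
-/
theorem IsObserver.window (hb : IsObserver Λ b) (hΛ : ∀ x y, inner 𝕜 (Λ x) y = inner 𝕜 x (Λ y))
    (hfree : HasFreeSol Λ) : ∃ τ c : ℝ, 0 < τ ∧ 0 < c ∧ ∀ f r q : ℝ → H,
      IsWaveSol Λ f (Ici 0) r q → ∀ s, 0 ≤ s →
        waveEnergy Λ 0 (r s) (q s) ≤ c * ∫ t in s..s + τ, (‖b (r t, q t)‖ ^ 2 + ‖f t‖ ^ 2) := by
  obtain ⟨T, D, R, hT, hD, hR, hadm, hobs⟩ := hb
  have hpos : 0 < 2 + 2 * D * (1 + T + T ^ 2) := by positivity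
  refine ⟨T, (2 + 2 * D * (1 + T + T ^ 2)) / R, hT, by positivity, ?_⟩
  have main : ∀ f r q : ℝ → H, IsWaveSol Λ f (Ici 0) r q → waveEnergy Λ 0 (r 0) (q 0) ≤
      (2 + 2 * D * (1 + T + T ^ 2)) / R *
        ∫ t in (0 : ℝ)..T, (‖b (r t, q t)‖ ^ 2 + ‖f t‖ ^ 2) := by
    intro f r q h
    obtain ⟨r', q', hr0, hq0, h'⟩ := hfree (r 0) (q 0)
    have hd := (h.sub h').mono (Icc_subset_Ici_self : Icc (0 : ℝ) T ⊆ Ici 0)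
    have hobs' := hobs r' q' h'
    rw [hr0, hq0] at hobs'
    have hadm' := hadm _ _ _ hd
    have hcf : ContinuousOn (fun t => ‖f t‖ ^ 2) (Ici 0) := h.continuous_source.norm.pow 2
    have hco := h.continuousOn_obs b
    have hco' := h'.continuousOn_obs b
    have hcd := (h.sub h').continuousOn_obs b
    set F := ∫ t in (0 : ℝ)..T, ‖f t‖ ^ 2 with hF
    set O := ∫ t in (0 : ℝ)..T, ‖b (r t, q t)‖ ^ 2 with hO
    have hF0 : 0 ≤ F := intervalIntegral.integral_nonneg hT.le fun x _ => sq_nonneg _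
    have hO0 : 0 ≤ O := intervalIntegral.integral_nonneg hT.le fun x _ => sq_nonneg _
    have hz : waveEnergy Λ 0 (r 0 - r' 0) (q 0 - q' 0) = 0 := by
      simp [hr0, hq0, waveEnergy]
    have hE : ∀ t ∈ Icc 0 T, waveEnergy Λ 0 (r t - r' t) (q t - q' t) ≤ T * F := by
      intro t ht
      have h1 := hd.sqrt_energy_le_zero hΛ (left_mem_Icc.2 hT.le) ht
      simp only [sub_zero] at h1
      rw [hz, Real.sqrt_zero, zero_add] at h1
      have h2 := sq_integral_le hT.le
        (h.continuous_source.norm.mono (Icc_subset_Ici_self : Icc (0 : ℝ) T ⊆ Ici 0))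
      rw [sub_zero] at h2
      rw [← Real.sq_sqrt (waveEnergy_nonneg Λ 0 (r t - r' t) (q t - q' t))]
      exact (pow_le_pow_left₀ (Real.sqrt_nonneg _) h1 2).trans h2
    have hEi : ∫ t in (0 : ℝ)..T, waveEnergy Λ 0 (r t - r' t) (q t - q' t) ≤ T * (T * F) := by
      have : ∫ _ in (0 : ℝ)..T, T * F = T * (T * F) := by simp
      rw [← this]
      exact integral_mono_Ici ((h.sub h').continuousOn_energy 0) continuousOn_const le_rfl hT.le hE
    -- The terms `1`, `T` and `T ^ 2` come from the source, from the energy at time `T`, and from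
    -- the integral of the energy.
    have hdiff : ∫ t in (0 : ℝ)..T, ‖b (r t - r' t, q t - q' t)‖ ^ 2 ≤ D * (1 + T + T ^ 2) * F := by
      refine hadm'.trans ?_
      rw [hz, mul_assoc]
      gcongr
      have := hE T (right_mem_Icc.2 hT.le)
      have e1 : ∫ t in (0 : ℝ)..T, ‖f t - 0‖ ^ 2 = F := by simp only [sub_zero, hF]
      linear_combination this + hEi + e1
    have hfr : ∫ t in (0 : ℝ)..T, ‖b (r' t, q' t)‖ ^ 2 ≤
        2 * O + 2 * ∫ t in (0 : ℝ)..T, ‖b (r t - r' t, q t - q' t)‖ ^ 2 := by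
      rw [hO, ← intervalIntegral.integral_const_mul, ← intervalIntegral.integral_const_mul,
        ← intervalIntegral.integral_add]
      · refine integral_mono_Ici hco' ((hco.const_mul 2).add (hcd.const_mul 2)) le_rfl hT.le
          fun t _ => ?_
        have : b (r' t, q' t) = b (r t, q t) - b (r t - r' t, q t - q' t) := by
          rw [← map_sub]; simp
        rw [this]
        exact norm_sub_sq_le_two_mul _ _
      · exact (intervalIntegrable_of_Ici hco le_rfl hT.le).const_mul _
      · exact (intervalIntegrable_of_Ici hcd le_rfl hT.le).const_mul _
    rw [intervalIntegral.integral_add (intervalIntegrable_of_Ici hco le_rfl hT.le)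
      (intervalIntegrable_of_Ici hcf le_rfl hT.le), div_mul_eq_mul_div, le_div_iff₀ hR, mul_comm]
    refine hobs'.trans (hfr.trans ?_)
    have h5 : 0 ≤ D * (1 + T + T ^ 2) := by positivity
    nlinarith [mul_nonneg h5 hO0]
  intro f r q h s hs
  have := main _ _ _ (h.shift hs)
  simp only [add_zero] at this
  rwa [intervalIntegral.integral_comp_add_left
    (fun t => ‖b (r t, q t)‖ ^ 2 + ‖f t‖ ^ 2), add_zero] at this

end Observer

/-! ### Cascades and their primitives in time. -/

section Cascade

variable {𝕜 : Type*} [RCLike 𝕜] {H : Type*} [NormedAddCommGroup H] [InnerProductSpace 𝕜 H]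

/-- The source term of the `i`-th equation of the cascade, in terms of `r_i = A w_i`. -/
def waveSource (Λ : H →L[𝕜] H) (C : ℕ → H →L[𝕜] H) (r : ℕ → ℝ → H) (i : ℕ) (t : ℝ) : H :=
  if 2 ≤ i then -(C i (Λ (Λ (r (i - 1) t)))) else 0

/-- The coupling operators `C i` act boundedly in the negative norms `‖Λ ^ k ·‖`, and they dominate
the operators `P i`. -/
structure IsCoupling (Λ : H →L[𝕜] H) (C P : ℕ → H →L[𝕜] H) (n : ℕ) : Prop where
  bounded : ∀ i k : ℕ, 2 ≤ i → i ≤ n → k + i ≤ n + 1 → ∃ c : ℝ, 0 ≤ c ∧ ∀ u : H,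
    ‖(Λ ^ k) (C i u)‖ ≤ c * ‖(Λ ^ k) u‖
  coercive : ∀ i : ℕ, 2 ≤ i → i ≤ n → ∃ α : ℝ, 0 < α ∧ ∀ w : H,
    α * ‖P i w‖ ^ 2 ≤ RCLike.re (inner 𝕜 (C i w) w)

variable {Λ : H →L[𝕜] H} {C P : ℕ → H →L[𝕜] H} {n : ℕ} {r q : ℕ → ℝ → H}

theorem IsCoupling.mono {m : ℕ} (h : IsCoupling Λ C P n)
    (hmn : m ≤ n) : IsCoupling Λ C P m :=
  ⟨fun i k h1 h2 h3 => h.bounded i k h1 (by omega) (by omega),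
    fun i h1 h2 => h.coercive i h1 (by omega)⟩

theorem IsCoupling.source_le (h : IsCoupling Λ C P n) {i k : ℕ} (hi : i ≤ n) (hk : k + i ≤ n + 1) :
    ∃ c : ℝ, 0 ≤ c ∧ ∀ (r : ℕ → ℝ → H) (t : ℝ),
      (2 ≤ i → ‖(Λ ^ k) (waveSource Λ C r i t)‖ ≤ c * ‖(Λ ^ k) (Λ (Λ (r (i - 1) t)))‖) ∧
      (¬ 2 ≤ i → (Λ ^ k) (waveSource Λ C r i t) = 0) := by
  by_cases h2 : 2 ≤ i
  · obtain ⟨c, hc, hb⟩ := h.bounded i k h2 hi hk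
    refine ⟨c, hc, fun r t => ⟨fun _ => ?_, fun h' => absurd h2 h'⟩⟩
    simp only [waveSource, if_pos h2, map_neg, norm_neg]
    exact hb _
  · exact ⟨0, le_rfl, fun r t => ⟨fun h' => absurd h' h2, fun _ => by simp [waveSource, h2]⟩⟩

/-- A primitive in time of a solution of the cascade: its component `r`. -/
noncomputable def primitive (Λ : H →L[𝕜] H) (C : ℕ → H →L[𝕜] H) (q : ℕ → ℝ → H) : ℕ → ℝ → H
  | 0, _ => 0
  | i + 1, t => (if 2 ≤ i + 1 then -(C (i + 1) (Λ (Λ (primitive Λ C q i t)))) else 0) -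
      Λ (q (i + 1) t)

theorem primitive_eq (i : ℕ) (hi : 1 ≤ i) (t : ℝ) :
    primitive Λ C q i t = waveSource Λ C (primitive Λ C q) i t - Λ (q i t) := by
  obtain ⟨i, rfl⟩ := Nat.exists_eq_add_of_le' hi
  rfl

/-- The energy of a solution is controlled by the energies, one level higher, of its primitive. -/
theorem IsCoupling.energy_le_primitive (hC : IsCoupling Λ C P (n + 1)) {i : ℕ} (h1 : 1 ≤ i)
    (h2 : i ≤ n) : ∃ c : ℝ, 0 ≤ c ∧ ∀ (r q : ℕ → ℝ → H) (t : ℝ),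
      waveEnergy Λ (n + 1 - i) (r i t) (q i t) ≤
        c * (waveEnergy Λ (n - i) (primitive Λ C q i t) (Λ (r i t)) + if 2 ≤ i then
          waveEnergy Λ (n - (i - 1)) (primitive Λ C q (i - 1) t) (Λ (r (i - 1) t)) else 0) := by
  obtain ⟨c, hc, hb⟩ := hC.source_le (i := i) (k := n + 1 - i) (by omega) (by omega)
  refine ⟨2 + 2 * (‖Λ‖ * c) ^ 2, by positivity, fun r q t => ?_⟩
  set z := primitive Λ C q with hz
  set E' := (if 2 ≤ i then waveEnergy Λ (n - (i - 1)) (z (i - 1) t) (Λ (r (i - 1) t)) else 0)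
    with hE'
  have hE'0 : 0 ≤ E' := by
    rw [hE']; split_ifs
    · exact waveEnergy_nonneg _ _ _ _
    · exact le_rfl
  have hk : n + 1 - i = (n - i) + 1 := by omega
  have hpow : ∀ x, (Λ ^ (n + 1 - i)) x = (Λ ^ (n - i)) (Λ x) := fun x => by
    rw [hk, pow_succ, mul_apply_eq_comp]
  have hf : ‖(Λ ^ (n + 1 - i)) (waveSource Λ C z i t)‖ ^ 2 ≤ (‖Λ‖ * c) ^ 2 * E' := by
    by_cases hi : 2 ≤ i
    · have h3 := (hb z t).1 hi
      have h4 : ‖(Λ ^ (n + 1 - i)) (Λ (Λ (z (i - 1) t)))‖ ≤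
          ‖Λ‖ * ‖(Λ ^ (n + 1 - i)) (Λ (z (i - 1) t))‖ := by
        rw [pow_apply_comm]; exact Λ.le_opNorm _
      have h5 : ‖(Λ ^ (n + 1 - i)) (waveSource Λ C z i t)‖ ≤
          (‖Λ‖ * c) * ‖(Λ ^ (n + 1 - i)) (Λ (z (i - 1) t))‖ := by
        refine h3.trans ?_
        rw [mul_comm ‖Λ‖ c, mul_assoc]
        gcongr
      have h6 : ‖(Λ ^ (n + 1 - i)) (Λ (z (i - 1) t))‖ ^ 2 ≤ E' := by
        rw [hE', if_pos hi, show n - (i - 1) = n + 1 - i by omega]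
        unfold waveEnergy
        nlinarith [sq_nonneg ‖(Λ ^ (n + 1 - i)) (Λ (Λ (r (i - 1) t)))‖]
      refine (pow_le_pow_left₀ (norm_nonneg _) h5 2).trans ?_
      rw [mul_pow]
      gcongr
    · rw [(hb z t).2 hi]
      have := mul_nonneg (sq_nonneg (‖Λ‖ * c)) hE'0
      simpa using this
  -- This is the equation of the primitive `Z`, read as `w_i' = Z_i'' = -C Z_{i-1} - A Z_i`: a
  -- velocity is recovered from the positions of the primitive, one level weaker.
  have hq : Λ (q i t) = waveSource Λ C z i t - z i t := by
    rw [hz, primitive_eq i h1]; abel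
  have h7 : ‖(Λ ^ (n + 1 - i)) (Λ (q i t))‖ ^ 2 ≤
      2 * ((‖Λ‖ * c) ^ 2 * E') + 2 * ‖(Λ ^ (n - i)) (Λ (z i t))‖ ^ 2 := by
    rw [hq, map_sub]
    refine (norm_sub_sq_le_two_mul _ _).trans ?_
    rw [hpow (z i t)]
    gcongr
  have h8 : ‖(Λ ^ (n + 1 - i)) (Λ (r i t))‖ ^ 2 = ‖(Λ ^ (n - i)) (Λ (Λ (r i t)))‖ ^ 2 := by
    rw [hpow]
  have h9 : 0 ≤ (‖Λ‖ * c) ^ 2 := by positivity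
  unfold waveEnergy
  rw [h8]
  have e1 := sq_nonneg ‖(Λ ^ (n - i)) (Λ (z i t))‖
  have e2 := sq_nonneg ‖(Λ ^ (n - i)) (Λ (Λ (r i t)))‖
  nlinarith [mul_nonneg h9 e1, mul_nonneg h9 e2]

variable [NormedSpace ℝ H]

/-- A strong solution of the cascade of length `n`. -/
def IsWaveCascade (Λ : H →L[𝕜] H) (C : ℕ → H →L[𝕜] H) (n : ℕ) (r q : ℕ → ℝ → H) : Prop :=
  ∀ i, 1 ≤ i → i ≤ n → IsWaveSol Λ (waveSource Λ C r i) (Ici 0) (r i) (q i)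

/-- The observability of the cascade of length `n` through its last component. -/
def IsObservable {G : Type*} [NormedAddCommGroup G] [InnerProductSpace 𝕜 G]
    (Λ : H →L[𝕜] H) (C : ℕ → H →L[𝕜] H) (n : ℕ) (b : H × H →L[𝕜] G) : Prop :=
  ∃ Tstar K : ℝ, 1 ≤ Tstar ∧ 0 < K ∧ ∀ r q : ℕ → ℝ → H, IsWaveCascade Λ C n r q → ∀ T, Tstar < T →
    ∀ i, 1 ≤ i → i ≤ n → T ^ (2 * (n - i) + 1) * waveEnergy Λ (n - i) (r i 0) (q i 0) ≤
      K * ∫ t in (0 : ℝ)..T, ‖b (r n t, q n t)‖ ^ 2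

theorem IsWaveCascade.mono {m : ℕ} (h : IsWaveCascade Λ C n r q) (hmn : m ≤ n) :
    IsWaveCascade Λ C m r q := fun i h1 h2 => h i h1 (h2.trans hmn)

theorem IsWaveCascade.shift (h : IsWaveCascade Λ C n r q) {a : ℝ} (ha : 0 ≤ a) :
    IsWaveCascade Λ C n (fun i t => r i (a + t)) (fun i t => q i (a + t)) :=
  fun i h1 h2 => (h i h1 h2).shift ha

variable [IsScalarTower ℝ 𝕜 H]

theorem hasDerivWithinAt_waveSource {z z' : ℕ → ℝ → H} {i : ℕ} {t : ℝ} {S : Set ℝ}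
    (h : 2 ≤ i → HasDerivWithinAt (z (i - 1)) (z' (i - 1) t) S t) :
    HasDerivWithinAt (waveSource Λ C z i) (waveSource Λ C z' i t) S t := by
  by_cases h2 : 2 ≤ i
  · have : HasDerivWithinAt (fun s => -((C i ∘L Λ ∘L Λ) (z (i - 1) s)))
        (-((C i ∘L Λ ∘L Λ) (z' (i - 1) t))) S t := (hasDerivWithinAt_clm _ (h h2)).fun_neg
    convert this using 1
    · funext s; simp [waveSource, h2]
    · simp [waveSource, h2]
  · have h3 : waveSource Λ C z i = fun _ => 0 := by funext s; simp [waveSource, h2]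
    have h4 : waveSource Λ C z' i t = 0 := by simp [waveSource, h2]
    rw [h3, h4]
    exact hasDerivWithinAt_const _ _ _

/-- The primitive is defined algebraically by its own wave equation, which fixes the constants of
integration. Differentiating `z = f(z) - w'` and inserting the equation of `w` leaves `r`; induction
on `i` supplies the derivative of `f(z)`. -/
theorem IsWaveCascade.hasDeriv_primitive (h : IsWaveCascade Λ C n r q) {i : ℕ} (h1 : 1 ≤ i)
    (h2 : i ≤ n) {t : ℝ} (ht : 0 ≤ t) :
    HasDerivWithinAt (primitive Λ C q i) (r i t) (Ici 0) t := by
  induction i, h1 using Nat.le_induction generalizing t with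
  | base =>
    have hs := hasDerivWithinAt_waveSource (Λ := Λ) (C := C) (z := primitive Λ C q) (z' := r)
      (i := 1) (t := t) (S := Ici 0) (by omega)
    have := hs.fun_sub ((h 1 le_rfl h2).deriv_snd t ht)
    have e : (primitive Λ C q 1) =
        fun s => waveSource Λ C (primitive Λ C q) 1 s - Λ (q 1 s) :=
      funext fun s => primitive_eq 1 le_rfl s
    rw [e]
    exact this.congr_deriv (by abel)
  | succ i hi ih =>
    have hs := hasDerivWithinAt_waveSource (Λ := Λ) (C := C) (z := primitive Λ C q) (z' := r)
      (i := i + 1) (t := t) (S := Ici 0) (fun _ => ih (by omega) ht)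
    have := hs.fun_sub ((h (i + 1) (by omega) h2).deriv_snd t ht)
    have e : (primitive Λ C q (i + 1)) =
        fun s => waveSource Λ C (primitive Λ C q) (i + 1) s - Λ (q (i + 1) s) :=
      funext fun s => primitive_eq (i + 1) (by omega) s
    rw [e]
    exact this.congr_deriv (by abel)

/-- The primitives in time form again a strong solution of the cascade. -/
theorem IsWaveCascade.primitive (h : IsWaveCascade Λ C n r q) :
    IsWaveCascade Λ C n (primitive Λ C q) (fun i t => Λ (r i t)) := by
  intro i h1 h2
  have hs : ∀ t ∈ Ici (0 : ℝ), HasDerivWithinAt (waveSource Λ C (CascadeObs.primitive Λ C q) i)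
      (waveSource Λ C r i t) (Ici 0) t := fun t ht => hasDerivWithinAt_waveSource fun _ =>
    h.hasDeriv_primitive (by omega) (by omega) ht
  refine ⟨fun t ht => (hs t ht).continuousWithinAt,
    fun t ht => (h.hasDeriv_primitive h1 h2 ht).continuousWithinAt,
    Λ.continuous.comp_continuousOn (h i h1 h2).continuous_fst,
    fun t ht => hasDerivWithinAt_clm Λ (h.hasDeriv_primitive h1 h2 ht), fun t ht => ?_⟩
  refine (hasDerivWithinAt_clm Λ ((h i h1 h2).deriv_fst t ht)).congr_deriv ?_
  rw [primitive_eq i h1]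
  abel

end Cascade

theorem le_two_mul_of_sqrt_le {a b I : ℝ} (ha : 0 ≤ a) (hb : 0 ≤ b) (h : √a ≤ √b + I) :
    a ≤ 2 * b + 2 * I ^ 2 := by
  have h1 := pow_le_pow_left₀ (Real.sqrt_nonneg a) h 2
  rw [Real.sq_sqrt ha] at h1
  nlinarith [Real.sq_sqrt hb, sq_nonneg (√b - I)]

/-! ### The first `n` components are controlled by the coupling integral. -/

section Step

variable {𝕜 : Type*} [RCLike 𝕜] {H : Type*} [NormedAddCommGroup H] [InnerProductSpace 𝕜 H]

/-- The integral of the last coupling term over `[L, 2 L]`. -/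
noncomputable def couplingIntegral (Λ : H →L[𝕜] H) (C : ℕ → H →L[𝕜] H) (n : ℕ)
    (r : ℕ → ℝ → H) (L : ℝ) : ℝ :=
  ∫ t in L..2 * L, RCLike.re (inner 𝕜 (C (n + 1) (Λ (Λ (r n t)))) (Λ (Λ (r n t))))

/-- The observation of the velocity `w' = Λ q` through `Q`. -/
noncomputable def velocityObs (Λ Q : H →L[𝕜] H) : H × H →L[𝕜] H :=
  (Q ∘L Λ) ∘L ContinuousLinearMap.snd 𝕜 H H

variable {Λ : H →L[𝕜] H} {C P : ℕ → H →L[𝕜] H} {n : ℕ} {r q : ℕ → ℝ → H}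

theorem IsCoupling.re_inner_nonneg (hC : IsCoupling Λ C P n) {i : ℕ} (h1 : 2 ≤ i) (h2 : i ≤ n)
    (w : H) : 0 ≤ RCLike.re (inner 𝕜 (C i w) w) := by
  obtain ⟨α, hα, h⟩ := hC.coercive i h1 h2
  exact le_trans (by positivity) (h w)

theorem IsCoupling.couplingIntegral_nonneg (hC : IsCoupling Λ C P (n + 1)) (hn : 1 ≤ n) {L : ℝ}
    (hL : 0 ≤ L) : 0 ≤ couplingIntegral Λ C n r L :=
  intervalIntegral.integral_nonneg (by linarith) fun t _ =>
    hC.re_inner_nonneg (by omega) le_rfl _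

variable [NormedSpace ℝ H]

theorem IsWaveCascade.continuousOn_coupling (h : IsWaveCascade Λ C n r q) (hn : 1 ≤ n) :
    ContinuousOn (fun t => RCLike.re (inner 𝕜 (C (n + 1) (Λ (Λ (r n t)))) (Λ (Λ (r n t)))))
      (Ici 0) := by
  have hw : ContinuousOn (fun t => Λ (Λ (r n t))) (Ici 0) :=
    (Λ.continuous.comp Λ.continuous).comp_continuousOn (h n hn le_rfl).continuous_fst
  exact RCLike.continuous_re.comp_continuousOn
    (((C (n + 1)).continuous.comp_continuousOn hw).inner (𝕜 := 𝕜) hw)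

variable [IsScalarTower ℝ 𝕜 H]

/-- The observability of the cascade of length `n` through `P (n + 1)`, applied to a primitive in
time. -/
theorem IsObservable.energy_le_couplingIntegral (hC : IsCoupling Λ C P (n + 1)) (hn : 1 ≤ n)
    (hobs : IsObservable Λ C n (velocityObs Λ (P (n + 1)))) :
    ∃ Tstar : ℝ, 1 ≤ Tstar ∧ ∀ i, 1 ≤ i → i ≤ n → ∃ c : ℝ, 0 ≤ c ∧ ∀ r q : ℕ → ℝ → H,
      IsWaveCascade Λ C n r q → ∀ L, Tstar < L →
        L ^ (2 * (n - i) + 1) * waveEnergy Λ (n + 1 - i) (r i L) (q i L) ≤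
          c * couplingIntegral Λ C n r L := by
  obtain ⟨T₁, K, hT₁, hK, hobs⟩ := hobs
  obtain ⟨α, hα, hco⟩ := hC.coercive (n + 1) (by omega) le_rfl
  refine ⟨T₁, hT₁, fun i h1 h2 => ?_⟩
  obtain ⟨c, hc, hle⟩ := hC.energy_le_primitive h1 h2
  refine ⟨c * (K / α + K / α), by positivity, fun r q h L hL => ?_⟩
  have hL0 : 0 ≤ L := by linarith
  have hL1 : 1 ≤ L := by linarith
  set X := couplingIntegral Λ C n r L with hX
  have hX0 : 0 ≤ X := hC.couplingIntegral_nonneg hn hL0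
  have hz : ∀ j, 1 ≤ j → j ≤ n → L ^ (2 * (n - j) + 1) *
      waveEnergy Λ (n - j) (primitive Λ C q j L) (Λ (r j L)) ≤ K / α * X := by
    intro j hj1 hj2
    -- Observability over a time `L`, applied to the primitive shifted by `L`: its velocity is
    -- `w_n`, so the observation is that of `P (n + 1) w_n` on `[L, 2L]`, which the coupling
    -- dominates.
    have h3 := hobs _ _ (h.primitive.shift hL0) L hL j hj1 hj2
    simp only [add_zero] at h3
    refine h3.trans ?_
    rw [div_mul_eq_mul_div, mul_div_assoc]
    refine mul_le_mul_of_nonneg_left ?_ hK.le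
    rw [le_div_iff₀ hα, mul_comm]
    have h4 : ∫ t in (0 : ℝ)..L, ‖velocityObs Λ (P (n + 1))
        (primitive Λ C q n (L + t), Λ (r n (L + t)))‖ ^ 2 =
        ∫ t in L..2 * L, ‖P (n + 1) (Λ (Λ (r n t)))‖ ^ 2 := by
      have := intervalIntegral.integral_comp_add_left (a := 0) (b := L)
        (fun t => ‖P (n + 1) (Λ (Λ (r n t)))‖ ^ 2) L
      rw [add_zero, ← two_mul] at this
      rw [← this]
      rfl
    rw [h4, ← intervalIntegral.integral_const_mul]
    have hw : ContinuousOn (fun t => Λ (Λ (r n t))) (Ici 0) :=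
      (Λ.continuous.comp Λ.continuous).comp_continuousOn (h n hn le_rfl).continuous_fst
    exact integral_mono_Ici
      ((((P (n + 1)).continuous.comp_continuousOn hw).norm.pow 2).const_mul α)
      (h.continuousOn_coupling hn) hL0 (by linarith) fun t _ => hco _
  refine (mul_le_mul_of_nonneg_left (hle r q L) (by positivity)).trans ?_
  rw [mul_left_comm, mul_assoc]
  refine mul_le_mul_of_nonneg_left ?_ hc
  rw [mul_add, add_mul]
  refine add_le_add (hz i h1 h2) ?_
  split_ifs with hi
  · refine le_trans ?_ (hz (i - 1) (by omega) (by omega))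
    refine mul_le_mul_of_nonneg_right ?_ (waveEnergy_nonneg _ _ _ _)
    -- Component `i - 1` carries the larger exponent `2 (n - i) + 3`, so its bound is stronger than
    -- needed when `L ≥ 1`.
    exact pow_le_pow_right₀ hL1 (by omega)
  · rw [mul_zero]; positivity

/-- Over an interval of length `4L`, Cauchy–Schwarz bounds the square of the integrated source by
`(4L)²` times its sup squared. The two extra powers of `L` in the source hypothesis pay for this,
and `32 = 2 · 16`. -/
theorem IsWaveSol.energy_growth (hΛ : ∀ x y, inner 𝕜 (Λ x) y = inner 𝕜 x (Λ y)) {f r q : ℝ → H}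
    (h : IsWaveSol Λ f (Ici 0) r q) {k κ : ℕ} {L c c' X : ℝ} (hL : 0 < L)
    (hE : L ^ κ * waveEnergy Λ k (r L) (q L) ≤ c * X)
    (hf : ∀ t ∈ Icc 0 (4 * L), L ^ (κ + 2) * ‖(Λ ^ k) (f t)‖ ^ 2 ≤ c' * X) {t : ℝ}
    (ht : t ∈ Icc 0 (4 * L)) :
    L ^ κ * waveEnergy Λ k (r t) (q t) ≤ (2 * c + 32 * c') * X := by
  have h1 := (h.mono (Icc_subset_Ici_self : Icc (0 : ℝ) (4 * L) ⊆ Ici 0)).sqrt_energy_le hΛ k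
    (s := L) ⟨hL.le, by linarith⟩ ht
  have h2 := le_two_mul_of_sqrt_le (waveEnergy_nonneg _ _ _ _) (waveEnergy_nonneg _ _ _ _) h1
  have hcf : ContinuousOn (fun x => ‖(Λ ^ k) (f x)‖) (Ici 0) :=
    ((Λ ^ k).continuous.comp_continuousOn h.continuous_source).norm
  have h3 := sq_integral_le (by linarith : (0 : ℝ) ≤ 4 * L) (hcf.mono Icc_subset_Ici_self)
  have hLκ : 0 < L ^ κ := by positivity
  have hLκ2 : 0 < L ^ (κ + 2) := by positivity
  have h4 : ∫ x in (0 : ℝ)..4 * L, ‖(Λ ^ k) (f x)‖ ^ 2 ≤ 4 * L * (c' * X / L ^ (κ + 2)) := by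
    have : ∫ _ in (0 : ℝ)..4 * L, c' * X / L ^ (κ + 2) = 4 * L * (c' * X / L ^ (κ + 2)) := by
      rw [intervalIntegral.integral_const, sub_zero, smul_eq_mul]
    rw [← this]
    refine integral_mono_Ici (hcf.pow 2) continuousOn_const le_rfl (by linarith) fun x hx => ?_
    rw [le_div_iff₀ hLκ2, mul_comm]
    exact hf x hx
  have h5 : (∫ x in (0 : ℝ)..4 * L, ‖(Λ ^ k) (f x)‖) ^ 2 ≤
      4 * L * (4 * L * (c' * X / L ^ (κ + 2))) := by
    refine h3.trans ?_
    rw [sub_zero]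
    gcongr
  have h6 : L ^ κ * (4 * L * (4 * L * (c' * X / L ^ (κ + 2)))) = 16 * (c' * X) := by
    rw [pow_add]
    field_simp
    ring
  calc L ^ κ * waveEnergy Λ k (r t) (q t)
      ≤ L ^ κ * (2 * waveEnergy Λ k (r L) (q L) + 2 * (4 * L * (4 * L * (c' * X / L ^ (κ + 2))))) := by
        gcongr
        linarith
    _ = 2 * (L ^ κ * waveEnergy Λ k (r L) (q L)) +
        2 * (L ^ κ * (4 * L * (4 * L * (c' * X / L ^ (κ + 2))))) := by ring
    _ ≤ (2 * c + 32 * c') * X := by rw [h6]; linarith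

/-- All energies and sources of the first `n` components are controlled on `[0, 4 L]`. -/
theorem IsObservable.uniform_bounds (hΛ : ∀ x y, inner 𝕜 (Λ x) y = inner 𝕜 x (Λ y))
    (hC : IsCoupling Λ C P (n + 1)) (hn : 1 ≤ n)
    (hobs : IsObservable Λ C n (velocityObs Λ (P (n + 1)))) :
    ∃ Tstar : ℝ, 1 ≤ Tstar ∧ ∀ i, 1 ≤ i → i ≤ n → ∃ c : ℝ, 0 ≤ c ∧ ∀ r q : ℕ → ℝ → H,
      IsWaveCascade Λ C n r q → ∀ L, Tstar < L → ∀ t ∈ Icc 0 (4 * L),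
        L ^ (2 * (n - i) + 1) * waveEnergy Λ (n + 1 - i) (r i t) (q i t) ≤
          c * couplingIntegral Λ C n r L ∧
        L ^ (2 * (n - i) + 1 + 2) * ‖(Λ ^ (n + 1 - i)) (waveSource Λ C r i t)‖ ^ 2 ≤
          c * couplingIntegral Λ C n r L := by
  obtain ⟨T₁, hT₁, hA⟩ := hobs.energy_le_couplingIntegral hC hn
  refine ⟨T₁, hT₁, fun i h1 h2 => ?_⟩
  -- Only the source has to be bounded at each stage: the bound at time `L` and the energy growth
  -- then give the energy on all of `[0, 4L]`.
  have conclude : ∀ j, 1 ≤ j → j ≤ n → (∃ c' : ℝ, 0 ≤ c' ∧ ∀ r q : ℕ → ℝ → H,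
      IsWaveCascade Λ C n r q → ∀ L, T₁ < L → ∀ t ∈ Icc 0 (4 * L),
        L ^ (2 * (n - j) + 1 + 2) * ‖(Λ ^ (n + 1 - j)) (waveSource Λ C r j t)‖ ^ 2 ≤
          c' * couplingIntegral Λ C n r L) → ∃ c : ℝ, 0 ≤ c ∧ ∀ r q : ℕ → ℝ → H,
      IsWaveCascade Λ C n r q → ∀ L, T₁ < L → ∀ t ∈ Icc 0 (4 * L),
        L ^ (2 * (n - j) + 1) * waveEnergy Λ (n + 1 - j) (r j t) (q j t) ≤
          c * couplingIntegral Λ C n r L ∧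
        L ^ (2 * (n - j) + 1 + 2) * ‖(Λ ^ (n + 1 - j)) (waveSource Λ C r j t)‖ ^ 2 ≤
          c * couplingIntegral Λ C n r L := by
    rintro j hj1 hj2 ⟨c', hc', hf⟩
    obtain ⟨c, hc, hAj⟩ := hA j hj1 hj2
    refine ⟨2 * c + 32 * c', by positivity, fun r q h L hL t ht => ⟨?_, ?_⟩⟩
    · exact (h j hj1 hj2).energy_growth hΛ (by linarith) (hAj r q h L hL) (hf r q h L hL) ht
    · refine (hf r q h L hL t ht).trans ?_
      have := hC.couplingIntegral_nonneg (r := r) hn (by linarith : (0 : ℝ) ≤ L)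
      gcongr
      linarith
  induction i, h1 using Nat.le_induction with
  | base =>
    refine conclude 1 le_rfl h2 ⟨0, le_rfl, fun r q h L hL t ht => ?_⟩
    simp [waveSource]
  | succ i hi ih =>
    obtain ⟨c, hc, hb⟩ := ih (by omega)
    obtain ⟨cs, hcs, hs⟩ := hC.source_le (i := i + 1) (k := n + 1 - (i + 1)) (by omega) (by omega)
    refine conclude (i + 1) (by omega) h2 ⟨cs ^ 2 * c, by positivity, fun r q h L hL t ht => ?_⟩
    have h3 := (hb r q h L hL t ht).1
    have h4 := (hs r t).1 (by omega)
    have hL0 : 0 ≤ L := by linarith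
    have h5 : ‖(Λ ^ (n + 1 - (i + 1))) (Λ (Λ (r i t)))‖ ^ 2 ≤
        waveEnergy Λ (n + 1 - i) (r i t) (q i t) := by
      rw [show n + 1 - i = n + 1 - (i + 1) + 1 by omega]
      unfold waveEnergy
      rw [pow_succ Λ, mul_apply_eq_comp]
      exact le_add_of_nonneg_right (sq_nonneg _)
    have h6 : ‖(Λ ^ (n + 1 - (i + 1))) (waveSource Λ C r (i + 1) t)‖ ^ 2 ≤
        cs ^ 2 * waveEnergy Λ (n + 1 - i) (r i t) (q i t) := by
      refine (pow_le_pow_left₀ (norm_nonneg _) h4 2).trans ?_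
      rw [mul_pow]
      gcongr
      exact h5
    -- The exponent required for the source of component `i + 1` is exactly the exponent already
    -- obtained for the energy of component `i`, so the induction loses no power of `L`.
    rw [show 2 * (n - (i + 1)) + 1 + 2 = 2 * (n - i) + 1 by omega, mul_assoc]
    calc _ ≤ L ^ (2 * (n - i) + 1) * (cs ^ 2 * waveEnergy Λ (n + 1 - i) (r i t) (q i t)) := by
          gcongr
      _ = cs ^ 2 * (L ^ (2 * (n - i) + 1) * waveEnergy Λ (n + 1 - i) (r i t) (q i t)) := by ring
      _ ≤ _ := by gcongr

end Step

/-! ### The cross functional and the induction on the length. -/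

section Main

variable {𝕜 : Type*} [RCLike 𝕜] {H : Type*} [NormedAddCommGroup H] [InnerProductSpace 𝕜 H]
  {Λ : H →L[𝕜] H} {C P : ℕ → H →L[𝕜] H} {n : ℕ} {r q : ℕ → ℝ → H}

theorem norm_le_sqrt_energy (k : ℕ) (x y : H) :
    ‖(Λ ^ k) (Λ x)‖ ≤ √(waveEnergy Λ k x y) ∧ ‖(Λ ^ k) (Λ y)‖ ≤ √(waveEnergy Λ k x y) := by
  constructor
  · exact Real.le_sqrt_of_sq_le (le_add_of_nonneg_right (sq_nonneg _))
  · exact Real.le_sqrt_of_sq_le (le_add_of_nonneg_left (sq_nonneg _))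

theorem abs_re_inner_le (hΛ : ∀ x y, inner 𝕜 (Λ x) y = inner 𝕜 x (Λ y)) (x y : H) :
    |RCLike.re (inner 𝕜 x (Λ y))| ≤ ‖Λ x‖ * ‖y‖ := by
  rw [← hΛ]
  exact (RCLike.abs_re_le_norm _).trans (norm_inner_le_norm _ _)

/-- The cross functional `⟨w_n', w_{n+1}⟩ - ⟨w_n, w_{n+1}'⟩`. -/
noncomputable def crossTerm (Λ : H →L[𝕜] H) (n : ℕ) (r q : ℕ → ℝ → H) (t : ℝ) : ℝ :=
  RCLike.re (inner 𝕜 (Λ (q n t)) (Λ (Λ (r (n + 1) t)))) -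
    RCLike.re (inner 𝕜 (Λ (Λ (r n t))) (Λ (q (n + 1) t)))

/-- Moving one `Λ` across the first inner product measures `w_n` one level below the natural energy
and `w_{n+1}` at the natural one, which are the levels available in the induction step. -/
theorem abs_crossTerm_le (hΛ : ∀ x y, inner 𝕜 (Λ x) y = inner 𝕜 x (Λ y)) (t : ℝ) :
    |crossTerm Λ n r q t| ≤ 2 * (√(waveEnergy Λ 1 (r n t) (q n t)) *
      √(waveEnergy Λ 0 (r (n + 1) t) (q (n + 1) t))) := by
  have h1 := norm_le_sqrt_energy (Λ := Λ) 1 (r n t) (q n t)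
  have h0 := norm_le_sqrt_energy (Λ := Λ) 0 (r (n + 1) t) (q (n + 1) t)
  simp only [pow_one, pow_zero, one_apply_eq_self] at h1 h0
  have e1 : |RCLike.re (inner 𝕜 (Λ (q n t)) (Λ (Λ (r (n + 1) t))))| ≤
      √(waveEnergy Λ 1 (r n t) (q n t)) * √(waveEnergy Λ 0 (r (n + 1) t) (q (n + 1) t)) :=
    (abs_re_inner_le hΛ _ _).trans (mul_le_mul h1.2 h0.1 (norm_nonneg _) (Real.sqrt_nonneg _))
  have e2 : |RCLike.re (inner 𝕜 (Λ (Λ (r n t))) (Λ (q (n + 1) t)))| ≤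
      √(waveEnergy Λ 1 (r n t) (q n t)) * √(waveEnergy Λ 0 (r (n + 1) t) (q (n + 1) t)) :=
    ((RCLike.abs_re_le_norm _).trans (norm_inner_le_norm _ _)).trans
      (mul_le_mul h1.1 h0.2 (norm_nonneg _) (Real.sqrt_nonneg _))
  unfold crossTerm
  refine (abs_sub _ _).trans ?_
  linarith

variable [NormedSpace ℝ H] [IsScalarTower ℝ 𝕜 H]

/-- The two terms containing `A` cancel by symmetry. The source of equation `n + 1` contributes the
coupling term with a positive sign, and the source of equation `n` gives the remainder. -/
theorem IsWaveCascade.deriv_crossTerm (hΛ : ∀ x y, inner 𝕜 (Λ x) y = inner 𝕜 x (Λ y))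
    (hn : 1 ≤ n) (h : IsWaveCascade Λ C (n + 1) r q) {t : ℝ} (ht : 0 ≤ t) :
    HasDerivWithinAt (crossTerm Λ n r q)
      (RCLike.re (inner 𝕜 (C (n + 1) (Λ (Λ (r n t)))) (Λ (Λ (r n t)))) +
        RCLike.re (inner 𝕜 (waveSource Λ C r n t) (Λ (Λ (r (n + 1) t))))) (Ici 0) t := by
  have hs := h n hn (by omega)
  have hs' := h (n + 1) (by omega) le_rfl
  have d1 := hasDerivWithinAt_re_inner (𝕜 := 𝕜) (hs.deriv_snd t ht)
    (hasDerivWithinAt_clm Λ (hs'.deriv_fst t ht))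
  have d2 := hasDerivWithinAt_re_inner (𝕜 := 𝕜) (hasDerivWithinAt_clm Λ (hs.deriv_fst t ht))
    (hs'.deriv_snd t ht)
  refine (d1.fun_sub d2).congr_deriv ?_
  have e : waveSource Λ C r (n + 1) t = -(C (n + 1) (Λ (Λ (r n t)))) := by
    simp [waveSource, show 2 ≤ n + 1 by omega]
  rw [e, inner_sub_left, inner_sub_right, inner_neg_right, hΛ (Λ (r n t)) (r (n + 1) t),
    hΛ (r n t)]
  simp only [map_sub, map_neg]
  rw [inner_re_symm (𝕜 := 𝕜) (Λ (Λ (r n t))) (C (n + 1) (Λ (Λ (r n t))))]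
  ring

theorem IsWaveCascade.integral_coupling (hΛ : ∀ x y, inner 𝕜 (Λ x) y = inner 𝕜 x (Λ y))
    (hn : 1 ≤ n) (h : IsWaveCascade Λ C (n + 1) r q) {s t : ℝ} (hs : 0 ≤ s) (hst : s ≤ t) :
    (∫ x in s..t, RCLike.re (inner 𝕜 (C (n + 1) (Λ (Λ (r n x)))) (Λ (Λ (r n x))))) +
      ∫ x in s..t, RCLike.re (inner 𝕜 (waveSource Λ C r n x) (Λ (Λ (r (n + 1) x)))) =
      crossTerm Λ n r q t - crossTerm Λ n r q s := by
  have hc1 := (h.mono (Nat.le_succ n)).continuousOn_coupling hn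
  have hc2 : ContinuousOn (fun x => RCLike.re (inner 𝕜 (waveSource Λ C r n x)
      (Λ (Λ (r (n + 1) x))))) (Ici 0) :=
    RCLike.continuous_re.comp_continuousOn ((h n hn (by omega)).continuous_source.inner (𝕜 := 𝕜)
      ((Λ.continuous.comp Λ.continuous).comp_continuousOn
        (h (n + 1) (by omega) le_rfl).continuous_fst))
  have hsub : Icc s t ⊆ Ici (0 : ℝ) := fun x hx => hs.trans hx.1
  rw [← intervalIntegral.integral_add (intervalIntegrable_of_Ici hc1 hs (hs.trans hst))
    (intervalIntegrable_of_Ici hc2 hs (hs.trans hst))]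
  exact integral_eq_sub_of_hasDerivWithinAt
    (fun x hx => (h.deriv_crossTerm hΛ hn (hsub hx)).mono hsub) ((hc1.add hc2).mono hsub)
    le_rfl hst le_rfl

/-- The coupling integrand is nonnegative, so its integral over `[L, 2L]` is at most the one over
any `[s, t]` with `s ≤ L` and `t ≥ 2L`. With `S` the integral on the right, the two boundary values
of the cross functional cost `2 (η / L) S` each and the source of equation `n` costs `(η / L) S`,
which explains the factor `5`. -/
theorem IsWaveCascade.couplingIntegral_le (hΛ : ∀ x y, inner 𝕜 (Λ x) y = inner 𝕜 x (Λ y))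
    (hC : IsCoupling Λ C P (n + 1)) (hn : 1 ≤ n) (h : IsWaveCascade Λ C (n + 1) r q)
    {L η : ℝ} (hL : 0 < L) (hη : 0 ≤ η)
    (hE : ∀ t ∈ Icc 0 (3 * L), √(waveEnergy Λ 1 (r n t) (q n t)) ≤ η)
    (hf : ∀ t ∈ Icc 0 (3 * L), ‖Λ (waveSource Λ C r n t)‖ ≤ η / L) :
    couplingIntegral Λ C n r L ≤ 5 * (η / L) *
      ∫ t in (0 : ℝ)..3 * L, √(waveEnergy Λ 0 (r (n + 1) t) (q (n + 1) t)) := by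
  set e : ℝ → ℝ := fun t => √(waveEnergy Λ 0 (r (n + 1) t) (q (n + 1) t)) with he
  have hec : ContinuousOn e (Ici 0) := ((h (n + 1) (by omega) le_rfl).continuousOn_energy 0).sqrt
  have he0 : ∀ t, 0 ≤ e t := fun t => Real.sqrt_nonneg _
  set S := ∫ t in (0 : ℝ)..3 * L, e t with hS
  -- The endpoints are chosen where `e` is at most its mean over `[0, L]` and over `[2L, 3L]`:
  -- boundary values are thus replaced by integrals.
  obtain ⟨s, hs, hsS⟩ := exists_mul_le_integral (a := 0) (b := L) hL.le
    (hec.mono Icc_subset_Ici_self)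
  obtain ⟨t, ht, htS⟩ := exists_mul_le_integral (a := 2 * L) (b := 3 * L) (by linarith)
    (hec.mono fun x hx => (by linarith [hx.1] : (0 : ℝ) ≤ x))
  have hsS' : e s ≤ S / L := by
    rw [le_div_iff₀ hL]
    have := integral_mono_interval_Ici hec he0 le_rfl le_rfl hL.le (by linarith : L ≤ 3 * L)
    linarith
  have htS' : e t ≤ S / L := by
    rw [le_div_iff₀ hL]
    have := integral_mono_interval_Ici hec he0 le_rfl (by linarith : 0 ≤ 2 * L)
      (by linarith : 2 * L ≤ 3 * L) le_rfl
    linarith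
  have hst : s ≤ t := by linarith [hs.2, ht.1]
  have hid := h.integral_coupling hΛ hn hs.1 hst
  have hX : couplingIntegral Λ C n r L ≤
      ∫ x in s..t, RCLike.re (inner 𝕜 (C (n + 1) (Λ (Λ (r n x)))) (Λ (Λ (r n x)))) :=
    integral_mono_interval_Ici ((h.mono (Nat.le_succ n)).continuousOn_coupling hn)
      (fun x => hC.re_inner_nonneg (by omega) le_rfl _) hs.1 hs.2 (by linarith) ht.1
  have hcr : ∀ x ∈ Icc 0 (3 * L), e x ≤ S / L → |crossTerm Λ n r q x| ≤ 2 * (η * (S / L)) := by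
    intro x hx hxS
    refine (abs_crossTerm_le hΛ x).trans ?_
    have := hE x hx
    have h1 := he0 x
    gcongr
  have h1 := hcr s ⟨hs.1, by linarith [hs.2]⟩ hsS'
  have h2 := hcr t ⟨by linarith [ht.1], ht.2⟩ htS'
  have h3 : |∫ x in s..t, RCLike.re (inner 𝕜 (waveSource Λ C r n x) (Λ (Λ (r (n + 1) x))))| ≤
      η / L * S := by
    have hc2 : ContinuousOn (fun x => RCLike.re (inner 𝕜 (waveSource Λ C r n x)
        (Λ (Λ (r (n + 1) x))))) (Ici 0) :=
      RCLike.continuous_re.comp_continuousOn ((h n hn (by omega)).continuous_source.inner (𝕜 := 𝕜)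
        ((Λ.continuous.comp Λ.continuous).comp_continuousOn
          (h (n + 1) (by omega) le_rfl).continuous_fst))
    refine (intervalIntegral.abs_integral_le_integral_abs hst).trans ?_
    have h4 : ∫ x in s..t, |RCLike.re (inner 𝕜 (waveSource Λ C r n x) (Λ (Λ (r (n + 1) x))))| ≤
        ∫ x in s..t, η / L * e x := by
      refine integral_mono_Ici hc2.abs (hec.const_mul _) hs.1 hst fun x hx => ?_
      refine (abs_re_inner_le hΛ _ _).trans ?_
      have h5 := hf x ⟨hs.1.trans hx.1, hx.2.trans ht.2⟩
      have h6 := (norm_le_sqrt_energy (Λ := Λ) 0 (r (n + 1) x) (q (n + 1) x)).1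
      simp only [pow_zero, one_apply_eq_self] at h6
      exact mul_le_mul h5 h6 (norm_nonneg _) (by positivity)
    refine h4.trans ?_
    rw [intervalIntegral.integral_const_mul]
    gcongr
    exact integral_mono_interval_Ici hec he0 le_rfl hs.1 hst ht.2
  have e1 := abs_le.1 h1
  have e2 := abs_le.1 h2
  have e3 := abs_le.1 h3
  have e4 : η * (S / L) = η / L * S := by ring
  rw [e4] at e1 e2
  linarith [e1.1, e2.2, e3.1]

variable {G : Type*} [NormedAddCommGroup G] [InnerProductSpace 𝕜 G] {b : H × H →L[𝕜] G}

/-- The free energy is conserved, so integrating the window estimate over `[0, T - τ]` gains a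
factor `T - τ ≥ T / 2`. -/
theorem IsObservable.one (hΛ : ∀ x y, inner 𝕜 (Λ x) y = inner 𝕜 x (Λ y)) (hfree : HasFreeSol Λ)
    (hb : IsObserver Λ b) : IsObservable Λ C 1 b := by
  obtain ⟨τ, c, hτ, hc, hwin⟩ := hb.window hΛ hfree
  refine ⟨max 1 (2 * τ), 2 * (c * τ), le_max_left _ _, by positivity, fun r q h T hT i hi1 hi2 => ?_⟩
  obtain rfl : i = 1 := le_antisymm hi2 hi1
  have hT1 : 1 < T := (le_max_left _ _).trans_lt hT
  have hTτ : 2 * τ < T := (le_max_right _ _).trans_lt hT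
  have hs := h 1 le_rfl le_rfl
  have hsrc : waveSource Λ C r 1 = fun _ => 0 := by funext t; simp [waveSource]
  rw [hsrc] at hs
  set e : ℝ → ℝ := fun t => waveEnergy Λ 0 (r 1 t) (q 1 t) with he
  have hec : ContinuousOn e (Ici 0) := hs.continuousOn_energy 0
  have hoc := hs.continuousOn_obs b
  have hwin' : ∀ s, 0 ≤ s → e s ≤ c * ∫ t in s..s + τ, ‖b (r 1 t, q 1 t)‖ ^ 2 := by
    intro s h0
    simpa using hwin _ _ _ hs s h0
  have h1 := integral_le_of_window hec hoc (fun x => sq_nonneg _) hc.le hτ.le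
    (by linarith : 0 ≤ T - τ) hwin'
  rw [sub_add_cancel] at h1
  have h2 : (T - τ) * e 0 ≤ ∫ s in (0 : ℝ)..T - τ, e s := by
    have : ∫ _ in (0 : ℝ)..T - τ, e 0 = (T - τ) * e 0 := by simp
    rw [← this]
    refine integral_mono_Ici continuousOn_const hec le_rfl (by linarith) fun x hx => ?_
    have h3 := (hs.mono (Icc_subset_Ici_self : Icc (0 : ℝ) (T - τ) ⊆ Ici 0)).sqrt_energy_le_zero hΛ
      (s := x) (t := 0) hx ⟨le_rfl, by linarith⟩
    simp only [norm_zero, intervalIntegral.integral_zero, add_zero] at h3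
    exact (Real.sqrt_le_sqrt_iff (waveEnergy_nonneg _ _ _ _)).1 h3
  have he0 : 0 ≤ e 0 := waveEnergy_nonneg _ _ _ _
  have h4 : T * e 0 ≤ 2 * ((T - τ) * e 0) := by nlinarith
  simp only [Nat.sub_self, mul_zero, zero_add, pow_one]
  change T * e 0 ≤ _
  linarith

/-- The observability of the cascade of length `n + 1`, from the one of length `n`. -/
theorem IsObservable.succ (hΛ : ∀ x y, inner 𝕜 (Λ x) y = inner 𝕜 x (Λ y)) (hfree : HasFreeSol Λ)
    (hC : IsCoupling Λ C P (n + 1)) (hn : 1 ≤ n)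
    (hobs : IsObservable Λ C n (velocityObs Λ (P (n + 1)))) (hb : IsObserver Λ b) :
    IsObservable Λ C (n + 1) b := by
  obtain ⟨T₁, hT₁, hbd⟩ := hobs.uniform_bounds hΛ hC hn
  obtain ⟨τ, cw, hτ, hcw, hwin⟩ := hb.window hΛ hfree
  obtain ⟨c, hc, hbn⟩ := hbd n hn le_rfl
  simp only [Nat.sub_self, mul_zero, zero_add, pow_one, Nat.add_sub_cancel_left] at hbn
  have hcall : ∃ cm : ℝ, 0 ≤ cm ∧ ∀ i, 1 ≤ i → i ≤ n → ∀ r q : ℕ → ℝ → H,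
      IsWaveCascade Λ C n r q → ∀ L, T₁ < L →
        L ^ (2 * (n - i) + 1) * waveEnergy Λ (n + 1 - i) (r i 0) (q i 0) ≤
          cm * couplingIntegral Λ C n r L := by
    choose! f hf using hbd
    -- The sum of the constants serves as a common bound for all components.
    refine ⟨∑ i ∈ Finset.Icc 1 n, f i, Finset.sum_nonneg fun i hi => ?_, fun i h1 h2 r q h L hL => ?_⟩
    · rw [Finset.mem_Icc] at hi
      exact (hf i hi.1 hi.2).1
    · refine ((hf i h1 h2).2 r q h L hL 0 ⟨le_rfl, by linarith⟩).1.trans ?_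
      refine mul_le_mul_of_nonneg_right ?_ (hC.couplingIntegral_nonneg hn (by linarith))
      exact Finset.single_le_sum (f := f) (fun j hj => (hf j (Finset.mem_Icc.1 hj).1
        (Finset.mem_Icc.1 hj).2).1) (Finset.mem_Icc.2 ⟨h1, h2⟩)
  obtain ⟨cm, hcm, hcall⟩ := hcall
  -- The squared source of equation `n + 1` is at most `‖C (n + 1)‖² c X / L` on an interval of
  -- length `4L`.
  set c₂ := 4 * ‖C (n + 1)‖ ^ 2 * c with hc₂
  have hc₂0 : 0 ≤ c₂ := by positivity
  -- Here `75 = 25 · 3`: the square of the factor `5` in `couplingIntegral_le`, and the length `3L`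
  -- in Cauchy–Schwarz.
  set c₄ := 75 * c * (cw * τ) with hc₄
  have hc₄0 : 0 ≤ c₄ := by positivity
  -- The first summand serves the components `i ≤ n`, the second the last component, and `1` makes
  -- the constant positive.
  set K₀ := cm * (2 * c₄) + (2 * (cw * τ) * (1 + c₂ * (2 * c₄)) + 8 * c₂ * (2 * c₄)) + 1 with hK₀
  have hK₀0 : 0 < K₀ := by positivity
  -- With `T = 4L`, this threshold gives `L > T₁`, `L ≥ τ` and `L ≥ 2 c₄ c₂`; the last one allows
  -- the absorption of `X`. The power of `4` in the other constant converts powers of `T` into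
  -- powers of `L`.
  refine ⟨4 * (T₁ + τ + 2 * c₄ * c₂), 4 ^ (2 * (n + 1) + 1) * K₀, ?_, by positivity, ?_⟩
  · nlinarith [mul_nonneg hc₄0 hc₂0]
  intro r q h T hT i hi1 hi2
  obtain ⟨L, rfl⟩ : ∃ L, T = 4 * L := ⟨T / 4, by ring⟩
  have hcc : 0 ≤ 2 * c₄ * c₂ := by positivity
  have hLT : T₁ < L := by linarith
  have hLτ : τ ≤ L := by linarith
  have hLc : 2 * c₄ * c₂ ≤ L := by linarith
  have hL1 : 1 ≤ L := by linarith
  have hL0 : 0 < L := by linarith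
  have hh := h.mono (Nat.le_succ n)
  set X := couplingIntegral Λ C n r L with hX
  have hX0 : 0 ≤ X := hC.couplingIntegral_nonneg hn hL0.le
  have hs := h (n + 1) (by omega) le_rfl
  set O := ∫ t in (0 : ℝ)..4 * L, ‖b (r (n + 1) t, q (n + 1) t)‖ ^ 2 with hO
  have hO0 : 0 ≤ O := intervalIntegral.integral_nonneg (by linarith) fun x _ => sq_nonneg _
  set E : ℝ → ℝ := fun t => waveEnergy Λ 0 (r (n + 1) t) (q (n + 1) t) with hE
  have hE0 : ∀ t, 0 ≤ E t := fun t => waveEnergy_nonneg _ _ _ _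
  have hEc : ContinuousOn E (Ici 0) := hs.continuousOn_energy 0
  have hoc := hs.continuousOn_obs b
  have hfc : ContinuousOn (fun t => ‖waveSource Λ C r (n + 1) t‖ ^ 2) (Ici 0) :=
    hs.continuous_source.norm.pow 2
  have hF : ∫ t in (0 : ℝ)..4 * L, ‖waveSource Λ C r (n + 1) t‖ ^ 2 ≤ c₂ * X := by
    have hconst : ∫ _ in (0 : ℝ)..4 * L, ‖C (n + 1)‖ ^ 2 * (c * X / L) = c₂ * X := by
      rw [intervalIntegral.integral_const, sub_zero, smul_eq_mul, hc₂]
      field_simp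
    rw [← hconst]
    refine integral_mono_Ici hfc continuousOn_const le_rfl (by linarith) fun t ht => ?_
    have h1 := (hbn r q hh L hLT t ht).1
    have h2 : waveSource Λ C r (n + 1) t = -(C (n + 1) (Λ (Λ (r n t)))) := by
      simp [waveSource, show 2 ≤ n + 1 by omega]
    rw [h2, norm_neg]
    have h3 : ‖Λ (Λ (r n t))‖ ^ 2 ≤ c * X / L := by
      rw [le_div_iff₀ hL0]
      refine le_trans ?_ h1
      rw [mul_comm]
      have h4 : ‖Λ (Λ (r n t))‖ ^ 2 ≤ waveEnergy Λ 1 (r n t) (q n t) := by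
        unfold waveEnergy
        simp only [pow_one]
        exact le_add_of_nonneg_right (sq_nonneg _)
      gcongr
    refine (pow_le_pow_left₀ (norm_nonneg _) ((C (n + 1)).le_opNorm _) 2).trans ?_
    rw [mul_pow]
    gcongr
  -- Windows starting in `[0, 3L]` end before `3L + τ ≤ 4L`, inside the observation interval.
  have hD : ∫ t in (0 : ℝ)..3 * L, E t ≤ cw * τ * (O + c₂ * X) := by
    have hofc : ContinuousOn (fun t => ‖b (r (n + 1) t, q (n + 1) t)‖ ^ 2 +
        ‖waveSource Λ C r (n + 1) t‖ ^ 2) (Ici 0) := hoc.add hfc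
    refine (integral_le_of_window hEc hofc (fun x => by positivity) hcw.le hτ.le
      (by linarith : 0 ≤ 3 * L) (hwin _ _ _ hs)).trans ?_
    refine mul_le_mul_of_nonneg_left ?_ (by positivity)
    refine (integral_mono_interval_Ici hofc (fun x => by positivity) le_rfl le_rfl
      (by linarith) (by linarith : 3 * L + τ ≤ 4 * L)).trans ?_
    rw [intervalIntegral.integral_add (intervalIntegrable_of_Ici hoc le_rfl (by linarith))
      (intervalIntegrable_of_Ici hfc le_rfl (by linarith))]
    linarith
  have hXO : L ^ 2 * X ≤ 2 * c₄ * O := by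
    -- By the bounds for component `n`, its weakened energy is at most `η²` and its weakened source
    -- at most `η / L`.
    set η := √(c * X / L) with hη
    have hη2 : η ^ 2 = c * X / L := Real.sq_sqrt (by positivity)
    have hcr := h.couplingIntegral_le hΛ hC hn hL0 (Real.sqrt_nonneg (c * X / L))
      (fun t ht => ?_) (fun t ht => ?_)
    · set S := ∫ t in (0 : ℝ)..3 * L, √(E t) with hS
      have hS0 : 0 ≤ S := intervalIntegral.integral_nonneg (by linarith) fun x _ => Real.sqrt_nonneg _
      have hS2 : S ^ 2 ≤ 3 * L * (cw * τ * (O + c₂ * X)) := by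
        have := sq_integral_le (by linarith : (0 : ℝ) ≤ 3 * L)
          ((hEc.sqrt).mono (Icc_subset_Ici_self : Icc (0 : ℝ) (3 * L) ⊆ Ici 0))
        simp only [Real.sq_sqrt (hE0 _), sub_zero] at this
        refine this.trans ?_
        gcongr
      have h1 : X ^ 2 ≤ (5 * (η / L) * S) ^ 2 := pow_le_pow_left₀ hX0 hcr 2
      have h2 : (5 * (η / L) * S) ^ 2 = 25 * (c * X) * S ^ 2 / L ^ 3 := by
        rw [mul_pow, mul_pow, div_pow, hη2]
        field_simp
        ring
      have h3 : 25 * (c * X) * S ^ 2 / L ^ 3 ≤ X * (c₄ * (O + c₂ * X)) / L ^ 2 := by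
        rw [div_le_div_iff₀ (by positivity) (by positivity)]
        calc 25 * (c * X) * S ^ 2 * L ^ 2
            ≤ 25 * (c * X) * (3 * L * (cw * τ * (O + c₂ * X))) * L ^ 2 := by gcongr
          _ = X * (c₄ * (O + c₂ * X)) * L ^ 3 := by rw [hc₄]; ring
      have h4 : L ^ 2 * X ^ 2 ≤ X * (c₄ * (O + c₂ * X)) := by
        have := (h1.trans_eq h2).trans h3
        rwa [le_div_iff₀ (by positivity), mul_comm] at this
      -- The inequality just obtained is quadratic in `X`; one factor is divided out when `X > 0`,
      -- then `c₄ c₂ X` is absorbed into half of `L² X`.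
      rcases hX0.eq_or_lt with h0 | hpos
      · rw [← h0, mul_zero]; positivity
      have h5 : L ^ 2 * X ≤ c₄ * (O + c₂ * X) := by
        refine le_of_mul_le_mul_left ?_ hpos
        calc X * (L ^ 2 * X) = L ^ 2 * X ^ 2 := by ring
          _ ≤ _ := h4
      have h6 : 2 * c₄ * c₂ * X ≤ L ^ 2 * X := by
        refine mul_le_mul_of_nonneg_right ?_ hX0
        nlinarith
      linarith
    · have h1 := (hbn r q hh L hLT t ⟨ht.1, by linarith [ht.2]⟩).1
      refine Real.sqrt_le_sqrt ?_
      rw [le_div_iff₀ hL0, mul_comm]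
      exact h1
    · have h1 := (hbn r q hh L hLT t ⟨ht.1, by linarith [ht.2]⟩).2
      rw [le_div_iff₀ hL0]
      refine Real.le_sqrt_of_sq_le ?_
      rw [le_div_iff₀ hL0]
      refine le_trans (le_of_eq ?_) h1
      ring
  have hX1 : X ≤ L ^ 2 * X := le_mul_of_one_le_left hX0 (one_le_pow₀ hL1)
  have hgoal : L ^ (2 * (n + 1 - i) + 1) * waveEnergy Λ (n + 1 - i) (r i 0) (q i 0) ≤ K₀ * O := by
    rcases Nat.lt_or_ge n i with hi | hi
    · obtain rfl : i = n + 1 := by omega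
      simp only [Nat.sub_self, mul_zero, zero_add, pow_one]
      change L * E 0 ≤ K₀ * O
      -- A time `s` of small energy is found in `[0, L]`, and the energy inequality is run backward
      -- from `s` to `0`. The source costs a factor of order `L`, offset by the smallness of `X`.
      obtain ⟨s, hs0, hsE⟩ := exists_mul_le_integral (a := 0) (b := L) hL0.le
        (hEc.mono Icc_subset_Ici_self)
      rw [sub_zero] at hsE
      have h1 : L * E s ≤ cw * τ * (O + c₂ * X) :=
        hsE.trans ((integral_mono_interval_Ici hEc hE0 le_rfl le_rfl hL0.le (by linarith)).trans hD)
      have h2 := (hs.mono (Icc_subset_Ici_self : Icc (0 : ℝ) (4 * L) ⊆ Ici 0)).sqrt_energy_le_zero hΛ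
        (s := s) (t := 0) ⟨hs0.1, by linarith [hs0.2]⟩ ⟨le_rfl, by linarith⟩
      have h3 := le_two_mul_of_sqrt_le (hE0 0) (hE0 s) h2
      have h4 := sq_integral_le (by linarith : (0 : ℝ) ≤ 4 * L)
        (hs.continuous_source.norm.mono (Icc_subset_Ici_self : Icc (0 : ℝ) (4 * L) ⊆ Ici 0))
      rw [sub_zero] at h4
      have h5 : E 0 ≤ 2 * E s + 8 * L * (c₂ * X) := by
        have : 4 * L * (∫ t in (0 : ℝ)..4 * L, ‖waveSource Λ C r (n + 1) t‖ ^ 2) ≤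
          4 * L * (c₂ * X) := by gcongr
        linarith
      have h6 : L * E 0 ≤ 2 * (cw * τ * (O + c₂ * X)) + 8 * c₂ * (L ^ 2 * X) := by
        have := mul_le_mul_of_nonneg_left h5 hL0.le
        linarith
      have h7 : 2 * (cw * τ * (O + c₂ * X)) ≤ 2 * (cw * τ) * (1 + c₂ * (2 * c₄)) * O := by
        have : c₂ * X ≤ c₂ * (2 * c₄ * O) := by gcongr; linarith
        have h8 : cw * τ * (O + c₂ * X) ≤ cw * τ * (O + c₂ * (2 * c₄ * O)) := by gcongr
        linarith
      have h8 : 8 * c₂ * (L ^ 2 * X) ≤ 8 * c₂ * (2 * c₄) * O := by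
        rw [mul_assoc (8 * c₂)]
        gcongr
      have h9 : 0 ≤ cm * (2 * c₄) * O := by positivity
      rw [hK₀]
      linarith
    · have h1 := hcall i hi1 hi r q hh L hLT
      have h2 : L ^ (2 * (n + 1 - i) + 1) = L ^ 2 * L ^ (2 * (n - i) + 1) := by
        rw [← pow_add]; congr 1; omega
      rw [h2, mul_assoc]
      calc _ ≤ L ^ 2 * (cm * X) := by gcongr
        _ = cm * (L ^ 2 * X) := by ring
        _ ≤ cm * (2 * c₄ * O) := by gcongr
        _ ≤ K₀ * O := by
          have h9 : 0 ≤ (2 * (cw * τ) * (1 + c₂ * (2 * c₄)) + 8 * c₂ * (2 * c₄)) * O := by positivity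
          rw [hK₀]
          linarith
  rw [mul_pow, mul_assoc, mul_assoc]
  refine mul_le_mul ?_ hgoal (by have := waveEnergy_nonneg Λ (n + 1 - i) (r i 0) (q i 0); positivity)
    (by positivity)
  exact pow_le_pow_right₀ (by norm_num) (by omega)

/-- The operators `P i`, acting on the velocity, observe the free equation. -/
def ObservesVelocity (Λ : H →L[𝕜] H) (P : ℕ → H →L[𝕜] H) (n : ℕ) : Prop :=
  ∀ i, 2 ≤ i → i ≤ n → IsObserver Λ (velocityObs Λ (P i))

/-- The observability of the cascade through an arbitrary observer of its last component. -/
theorem IsObserver.isObservable (hΛ : ∀ x y, inner 𝕜 (Λ x) y = inner 𝕜 x (Λ y))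
    (hfree : HasFreeSol Λ) (hC : IsCoupling Λ C P n) (hP : ObservesVelocity Λ P n) (hn : 1 ≤ n)
    (hb : IsObserver Λ b) : IsObservable Λ C n b := by
  -- The intermediate observers are the operators `P`, with values in `H`. The induction is
  -- therefore run for `H`-valued observers only, and the `G`-valued one enters in the last step.
  have key : ∀ m, 1 ≤ m → m ≤ n → ∀ b' : H × H →L[𝕜] H, IsObserver Λ b' →
      IsObservable Λ C m b' := by
    intro m hm
    induction m, hm using Nat.le_induction with
    | base => exact fun _ b' hb' => IsObservable.one hΛ hfree hb'
    | succ m hm ih =>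
      intro hmn b' hb'
      exact IsObservable.succ hΛ hfree (hC.mono hmn) hm
        (ih (by omega) _ (hP (m + 1) (by omega) hmn)) hb'
  rcases hn.eq_or_lt with rfl | hn
  · exact IsObservable.one hΛ hfree hb
  · obtain ⟨m, rfl⟩ : ∃ m, n = m + 1 := ⟨n - 1, by omega⟩
    exact IsObservable.succ hΛ hfree hC (by omega)
      (key m (by omega) (by omega) _ (hP (m + 1) (by omega) le_rfl)) hb

end Main

/-! ### Translation of the hypotheses and of strong solutions into the variables `(r, q)`. -/

section Translate

variable {𝕜 : Type*} [RCLike 𝕜] {H : Type*} [NormedAddCommGroup H] [InnerProductSpace 𝕜 H]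
  [CompleteSpace H] {A : H →ₗ.[𝕜] H} {Λ : H →L[𝕜] H}

namespace IsInvSqrt

theorem inner_pow_left (hΛ : IsInvSqrt A Λ) (hA : A1 A) (k : ℕ) (x y : H) :
    inner 𝕜 ((Λ ^ k) x) y = inner 𝕜 x ((Λ ^ k) y) := by
  induction k generalizing x y with
  | zero => simp
  | succ k ih =>
    rw [pow_succ, mul_apply_eq_comp, mul_apply_eq_comp, ih, hΛ.inner_left hA, pow_apply_comm]

/-- `A⁻¹`, as a linear map into the domain of `A`. -/
noncomputable def lift (hΛ : IsInvSqrt A Λ) (hA : A1 A) : H →ₗ[𝕜] A.domain :=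
  ((Λ ∘L Λ : H →L[𝕜] H) : H →ₗ[𝕜] H).codRestrict A.domain
    fun g => (hΛ.exists_mem_domain hA g).1

theorem coe_lift (hΛ : IsInvSqrt A Λ) (hA : A1 A) (g : H) : (hΛ.lift hA g : H) = Λ (Λ g) := rfl

theorem apply_lift (hΛ : IsInvSqrt A Λ) (hA : A1 A) (g : H) : A (hΛ.lift hA g) = g :=
  (hΛ.exists_mem_domain hA g).2

theorem lift_apply (hΛ : IsInvSqrt A Λ) (hA : A1 A) (x : A.domain) : hΛ.lift hA (A x) = x :=
  Subtype.ext (hΛ.apply_apply_domain hA x)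

theorem energy_eq (hΛ : IsInvSqrt A Λ) (hA : A1 A) (k : ℕ) (p v : H) :
    energy A (1 - (k : ℤ)) (Λ p) v = 1 / 2 * (‖(Λ ^ k) p‖ ^ 2 + ‖(Λ ^ k) v‖ ^ 2) := by
  unfold energy
  rw [hΛ.normH_apply hA, show (1 : ℤ) - k - 1 = -(k : ℤ) by ring, hΛ.normH_neg hA,
    hΛ.normH_neg hA]

theorem energy_eq_waveEnergy (hΛ : IsInvSqrt A Λ) (hA : A1 A) (k : ℕ) (r q : H) :
    energy A (1 - (k : ℤ)) (Λ (Λ r)) (Λ q) = 1 / 2 * waveEnergy Λ k r q :=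
  hΛ.energy_eq hA k (Λ r) (Λ q)

theorem energy_one_eq (hΛ : IsInvSqrt A Λ) (hA : A1 A) (r q : H) :
    energy A 1 (Λ (Λ r)) (Λ q) = 1 / 2 * waveEnergy Λ 0 r q := by
  simpa using hΛ.energy_eq_waveEnergy hA 0 r q

theorem normH_one (hΛ : IsInvSqrt A Λ) (hA : A1 A) (p : H) : normH A 1 (Λ p) = ‖p‖ := by
  rw [hΛ.normH_apply hA, sub_self, hA.normH_zero]

theorem memH_one (hΛ : IsInvSqrt A Λ) (hA : A1 A) (p : H) : MemH A 1 (Λ p) := by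
  rw [hΛ.memH_iff hA, sub_self]
  exact hA.memH_zero p

theorem exists_of_memH_one (hΛ : IsInvSqrt A Λ) (hA : A1 A) {u : H} (hu : MemH A 1 u) :
    ∃ p, Λ p = u := hΛ.exists_of_memH_succ hA 0 (by simpa using hu)

/-- An operator whose adjoint is bounded in `H_k` is bounded in `H_{-k}`. -/
theorem norm_pow_le_of_adjoint (hΛ : IsInvSqrt A Λ) (hA : A1 A) {T : H →L[𝕜] H} {k : ℕ} {c : ℝ}
    (h : ∀ u : H, MemH A k u → MemH A k (ContinuousLinearMap.adjoint T u) ∧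
      normH A k (ContinuousLinearMap.adjoint T u) ≤ c * normH A k u) (u : H) :
    ‖(Λ ^ k) (T u)‖ ≤ |c| * ‖(Λ ^ k) u‖ := by
  set x := (Λ ^ k) (T u) with hx
  obtain ⟨h1, h2⟩ := h ((Λ ^ k) x) (hΛ.memH_pow hA k x)
  obtain ⟨z, hz⟩ := hΛ.exists_pow_of_memH hA k h1
  rw [← hz, hΛ.normH_pow hA, hΛ.normH_pow hA] at h2
  have h3 : ‖z‖ ≤ |c| * ‖x‖ := h2.trans (by gcongr; exact le_abs_self c)
  -- Duality: `‖x‖² = ⟨Λᵏ T u, x⟩ = ⟨u, T* Λᵏ x⟩`, and `T* Λᵏ x` lies in the range of `Λᵏ` because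
  -- the adjoint preserves `H_k`.
  have h4 : inner 𝕜 x x = inner 𝕜 ((Λ ^ k) u) z := by
    conv_lhs => rw [hx, hΛ.inner_pow_left hA, ← ContinuousLinearMap.adjoint_inner_right, ← hx, ← hz]
    rw [hΛ.inner_pow_left hA]
  have h5 : ‖x‖ * ‖x‖ ≤ (|c| * ‖(Λ ^ k) u‖) * ‖x‖ := by
    calc ‖x‖ * ‖x‖ = RCLike.re (inner 𝕜 x x) := (inner_self_eq_norm_mul_norm x).symm
      _ ≤ ‖inner 𝕜 x x‖ := RCLike.re_le_norm _
      _ ≤ ‖(Λ ^ k) u‖ * ‖z‖ := by rw [h4]; exact norm_inner_le_norm _ _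
      _ ≤ ‖(Λ ^ k) u‖ * (|c| * ‖x‖) := by gcongr
      _ = _ := by ring
  rcases (norm_nonneg x).eq_or_lt with h0 | h0
  · rw [← h0]; positivity
  · exact le_of_mul_le_mul_right h5 h0

end IsInvSqrt

theorem A2.isCoupling {C P : ℕ → H →L[𝕜] H} {n : ℕ} (h : A2 A C P n) (hΛ : IsInvSqrt A Λ)
    (hA : A1 A) : IsCoupling Λ C P n where
  bounded i k h1 h2 h3 := by
    obtain ⟨c, hc⟩ := h.adjoint_bounded i k h1 h2 h3
    exact ⟨|c|, abs_nonneg c, hΛ.norm_pow_le_of_adjoint hA hc⟩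
  coercive := h.coercive

theorem cascadeSource_eq (hΛ : IsInvSqrt A Λ) (hA : A1 A) (C : ℕ → H →L[𝕜] H)
    (w : ℕ → ℝ → A.domain) :
    cascadeSource C (fun j t => (w j t : H)) = waveSource Λ C (fun j t => A (w j t)) := by
  funext i t
  simp only [cascadeSource, waveSource, hΛ.apply_apply_domain hA]

variable [NormedSpace ℝ H]

variable {G : Type*} [NormedAddCommGroup G] [InnerProductSpace 𝕜 G]

/-- The observation operator `B`, as a bounded operator on the pairs `(r, q)`. -/
theorem A4.exists_obs {B : A.domain × H →ₗ[𝕜] G} (h : A4 A B) (hΛ : IsInvSqrt A Λ) (hA : A1 A) :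
    ∃ b : H × H →L[𝕜] G, ∀ r q, b (r, q) = B (hΛ.lift hA r, Λ q) := by
  obtain ⟨c, hc⟩ := h.bounded
  let b₀ : H × H →ₗ[𝕜] G := B ∘ₗ ((hΛ.lift hA).prodMap (Λ : H →ₗ[𝕜] H))
  refine ⟨b₀.mkContinuous (|c| * (1 + ‖Λ‖)) fun x => ?_, fun r q => rfl⟩
  obtain ⟨r, q⟩ := x
  change ‖B (hΛ.lift hA r, Λ q)‖ ≤ _
  refine (hc _ _).trans ?_
  rw [hΛ.apply_lift hA]
  have h1 : ‖r‖ ≤ ‖(r, q)‖ := norm_fst_le (r, q)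
  have h2 : ‖Λ q‖ ≤ ‖Λ‖ * ‖(r, q)‖ :=
    (Λ.le_opNorm q).trans (mul_le_mul_of_nonneg_left (norm_snd_le (r, q)) (norm_nonneg _))
  calc c * (‖r‖ + ‖Λ q‖) ≤ |c| * (‖r‖ + ‖Λ q‖) := by gcongr; exact le_abs_self c
    _ ≤ |c| * (‖(r, q)‖ + ‖Λ‖ * ‖(r, q)‖) := by gcongr
    _ = _ := by ring

variable [IsScalarTower ℝ 𝕜 H]

/-- The `H_1`-norm of `Λ x` is `‖x‖`, so continuity of the velocity in `H_1` is continuity of `q` in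
`H`, and differentiability of `w` in `H_1` is differentiability of `Λ (A w)` in `H`. -/
theorem IsStrongSol.exists_isWaveSol {f v : ℝ → H} {S : Set ℝ} {w : ℝ → A.domain}
    (h : IsStrongSol A f S w v) (hΛ : IsInvSqrt A Λ) (hA : A1 A) :
    ∃ q : ℝ → H, (∀ t ∈ S, Λ (q t) = v t) ∧ IsWaveSol Λ f S (fun t => A (w t)) q := by
  have hex : ∀ t, t ∈ S → ∃ p, Λ p = v t := fun t ht =>
    hΛ.exists_of_memH_one hA (h.continuous_snd t ht).1
  choose! q hq using hex
  refine ⟨q, hq, h.continuous_source, h.continuous_fst, fun t ht => ?_, fun t ht => ?_,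
    fun t ht => ?_⟩
  · rw [ContinuousWithinAt, tendsto_iff_norm_sub_tendsto_zero]
    refine (h.continuous_snd t ht).2.congr' ?_
    filter_upwards [self_mem_nhdsWithin] with s hs
    rw [← hq s hs, ← hq t ht, ← map_sub, hΛ.normH_one hA]
  · rw [hasDerivWithinAt_iff_tendsto_slope, tendsto_iff_norm_sub_tendsto_zero]
    refine (h.deriv_fst t ht).congr' ?_
    filter_upwards [self_mem_nhdsWithin] with s hs
    rw [← hq t ht, ← hΛ.apply_apply_domain hA (w s), ← hΛ.apply_apply_domain hA (w t), ← map_sub,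
      ← map_real_smul_clm, ← map_sub, hΛ.normH_one hA, slope_def_module]
  · exact (h.deriv_snd t ht).congr (fun s hs => hq s hs) (hq t ht)

theorem IsWaveSol.isStrongSol {f r q : ℝ → H} {S : Set ℝ} (h : IsWaveSol Λ f S r q)
    (hΛ : IsInvSqrt A Λ) (hA : A1 A) :
    IsStrongSol A f S (fun t => hΛ.lift hA (r t)) (fun t => Λ (q t)) where
  continuous_source := h.continuous_source
  continuous_fst := by simpa only [hΛ.apply_lift hA] using h.continuous_fst
  continuous_snd t ht := by
    refine ⟨hΛ.memH_one hA _, ?_⟩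
    simp only [← map_sub, hΛ.normH_one hA]
    exact tendsto_iff_norm_sub_tendsto_zero.1 (h.continuous_snd t ht)
  deriv_fst t ht := by
    have := h.deriv_fst t ht
    rw [hasDerivWithinAt_iff_tendsto_slope, tendsto_iff_norm_sub_tendsto_zero] at this
    simp only [hΛ.coe_lift hA]
    refine this.congr fun s => ?_
    rw [← map_sub, ← map_real_smul_clm, ← map_sub, hΛ.normH_one hA, slope_def_module]
  deriv_snd t ht := by simpa only [hΛ.apply_lift hA] using h.deriv_snd t ht

theorem IsWaveSol.isWeakSol {f r q : ℝ → H} {S : Set ℝ} (h : IsWaveSol Λ f S r q)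
    (hΛ : IsInvSqrt A Λ) (hA : A1 A) :
    IsWeakSol A f S (fun t => Λ (Λ (r t))) (fun t => Λ (q t)) where
  continuous_fst t ht := by
    refine ⟨hΛ.memH_one hA _, ?_⟩
    simp only [← map_sub Λ (Λ _), hΛ.normH_one hA]
    exact tendsto_iff_norm_sub_tendsto_zero.1 (h.deriv_fst t ht).continuousWithinAt
  continuous_snd := Λ.continuous.comp_continuousOn h.continuous_snd
  deriv_fst t ht := hasDerivWithinAt_clm Λ (h.deriv_fst t ht)
  deriv_snd φ t ht := by
    have := (hasDerivWithinAt_const t S (φ : H)).inner 𝕜 (h.deriv_snd t ht)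
    simp only [inner_zero_left, add_zero] at this
    refine this.congr_deriv ?_
    rw [inner_sub_right, ← hΛ.inner_left hA, ← hΛ.inner_left hA, hΛ.apply_apply_domain hA]

theorem IsStrongCascadeSol.exists_isWaveCascade {C : ℕ → H →L[𝕜] H} {n : ℕ}
    {w : ℕ → ℝ → A.domain} {v : ℕ → ℝ → H} (h : IsStrongCascadeSol A C n w v)
    (hΛ : IsInvSqrt A Λ) (hA : A1 A) :
    ∃ q : ℕ → ℝ → H, (∀ i, 1 ≤ i → i ≤ n → ∀ t, 0 ≤ t → Λ (q i t) = v i t) ∧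
      IsWaveCascade Λ C n (fun i t => A (w i t)) q := by
  have hex : ∀ i, 1 ≤ i ∧ i ≤ n → ∃ q : ℝ → H, (∀ t ∈ Ici (0 : ℝ), Λ (q t) = v i t) ∧
      IsWaveSol Λ (waveSource Λ C (fun i t => A (w i t)) i) (Ici 0) (fun t => A (w i t)) q := by
    intro i hi
    have := h i hi.1 hi.2
    rw [cascadeSource_eq hΛ hA] at this
    exact this.exists_isWaveSol hΛ hA
  choose! q hq using hex
  exact ⟨q, fun i h1 h2 t ht => (hq i ⟨h1, h2⟩).1 t ht, fun i h1 h2 => (hq i ⟨h1, h2⟩).2⟩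

theorem IsWaveCascade.isStrongCascadeSol {C : ℕ → H →L[𝕜] H} {n : ℕ} {r q : ℕ → ℝ → H}
    (h : IsWaveCascade Λ C n r q) (hΛ : IsInvSqrt A Λ) (hA : A1 A) :
    IsStrongCascadeSol A C n (fun i t => hΛ.lift hA (r i t)) (fun i t => Λ (q i t)) := by
  intro i h1 h2
  have := (h i h1 h2).isStrongSol hΛ hA
  rw [cascadeSource_eq hΛ hA]
  simpa only [hΛ.apply_lift hA] using this

/-- Admissibility is immediate, because `P i` is bounded and the energy controls the norm of the
velocity. -/
theorem A3.observesVelocity {P : ℕ → H →L[𝕜] H} {n : ℕ} (h : A3 A P n) (hΛ : IsInvSqrt A Λ)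
    (hA : A1 A) : ObservesVelocity Λ P n := by
  intro i h1 h2
  obtain ⟨T₀, hT₀, hT⟩ := h i h1 h2
  obtain ⟨γ, hγ, hobs⟩ := hT (T₀ + 1) (by linarith)
  have hT1 : 0 ≤ T₀ + 1 := by linarith
  refine ⟨T₀ + 1, ‖P i‖ ^ 2 + 1, γ / 2, by linarith, by positivity, by positivity, ?_, ?_⟩
  · intro f r q hs
    have hbc : ContinuousOn (fun t => ‖velocityObs Λ (P i) (r t, q t)‖ ^ 2) (Icc 0 (T₀ + 1)) :=
      hs.continuousOn_obs _
    have hec := hs.continuousOn_energy 0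
    have h3 : ∫ t in (0 : ℝ)..T₀ + 1, ‖velocityObs Λ (P i) (r t, q t)‖ ^ 2 ≤
        (‖P i‖ ^ 2 + 1) * ∫ t in (0 : ℝ)..T₀ + 1, waveEnergy Λ 0 (r t) (q t) := by
      rw [← intervalIntegral.integral_const_mul]
      refine intervalIntegral.integral_mono_on hT1 ?_ ?_ fun t ht => ?_
      · exact ContinuousOn.intervalIntegrable (by rwa [uIcc_of_le hT1])
      · exact ContinuousOn.intervalIntegrable (by rw [uIcc_of_le hT1]; exact hec.const_mul _)
      · change ‖P i (Λ (q t))‖ ^ 2 ≤ _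
        refine (pow_le_pow_left₀ (norm_nonneg _) ((P i).le_opNorm _) 2).trans ?_
        rw [mul_pow]
        have : ‖Λ (q t)‖ ^ 2 ≤ waveEnergy Λ 0 (r t) (q t) :=
          le_add_of_nonneg_left (a := ‖Λ (q t)‖ ^ 2) (sq_nonneg ‖Λ (r t)‖)
        exact mul_le_mul (by linarith) this (sq_nonneg _) (by positivity)
    refine h3.trans (mul_le_mul_of_nonneg_left ?_ (by positivity))
    have e1 := waveEnergy_nonneg Λ 0 (r 0) (q 0)
    have e2 := waveEnergy_nonneg Λ 0 (r (T₀ + 1)) (q (T₀ + 1))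
    have e3 : 0 ≤ ∫ t in (0 : ℝ)..T₀ + 1, ‖f t‖ ^ 2 :=
      intervalIntegral.integral_nonneg hT1 fun x _ => sq_nonneg _
    linarith
  · intro r q hs
    have := hobs _ _ (hs.isWeakSol hΛ hA)
    rw [hΛ.energy_one_eq hA] at this
    calc _ = γ * (1 / 2 * waveEnergy Λ 0 (r 0) (q 0)) := by ring
      _ ≤ _ := this

theorem A4.wave_admissible {B : A.domain × H →ₗ[𝕜] G} (h : A4 A B) (hΛ : IsInvSqrt A Λ)
    (hA : A1 A) {b : H × H →L[𝕜] G} (hb : ∀ r q, b (r, q) = B (hΛ.lift hA r, Λ q)) (T : ℝ)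
    (hT : 0 < T) : ∃ D : ℝ, 0 < D ∧ ∀ f r q : ℝ → H, IsWaveSol Λ f (Icc 0 T) r q →
      ∫ t in (0 : ℝ)..T, ‖b (r t, q t)‖ ^ 2 ≤
        D * (waveEnergy Λ 0 (r 0) (q 0) + waveEnergy Λ 0 (r T) (q T) +
          (∫ t in (0 : ℝ)..T, waveEnergy Λ 0 (r t) (q t)) + ∫ t in (0 : ℝ)..T, ‖f t‖ ^ 2) := by
  obtain ⟨D, hD, hadm⟩ := h.admissible T hT
  refine ⟨D, hD, fun f r q hs => ?_⟩
  have := hadm _ _ _ (hs.isStrongSol hΛ hA)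
  simp only [hΛ.coe_lift hA, hΛ.energy_one_eq hA, intervalIntegral.integral_const_mul] at this
  simp only [hb]
  refine this.trans (mul_le_mul_of_nonneg_left ?_ hD.le)
  have e1 := waveEnergy_nonneg Λ 0 (r 0) (q 0)
  have e2 := waveEnergy_nonneg Λ 0 (r T) (q T)
  have e3 : 0 ≤ ∫ t in (0 : ℝ)..T, waveEnergy Λ 0 (r t) (q t) :=
    intervalIntegral.integral_nonneg hT.le fun x _ => waveEnergy_nonneg _ _ _ _
  linarith

theorem A5.isObserver {B : A.domain × H →ₗ[𝕜] G} (h : A5 A B) (h4 : A4 A B) (hΛ : IsInvSqrt A Λ)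
    (hA : A1 A) {b : H × H →L[𝕜] G} (hb : ∀ r q, b (r, q) = B (hΛ.lift hA r, Λ q)) :
    IsObserver Λ b := by
  obtain ⟨T₀, hT₀, hT⟩ := h
  obtain ⟨R, hR, hobs⟩ := hT (T₀ + 1) (by linarith)
  obtain ⟨D, hD, hadm⟩ := h4.wave_admissible hΛ hA hb (T₀ + 1) (by linarith)
  refine ⟨T₀ + 1, D, R / 2, by linarith, hD, by positivity, hadm, fun r q hs => ?_⟩
  have := hobs _ _ (hs.isStrongSol hΛ hA)
  simp only [hΛ.coe_lift hA, hΛ.energy_one_eq hA] at this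
  simp only [hb]
  calc _ = R * (1 / 2 * waveEnergy Λ 0 (r 0) (q 0)) := by ring
    _ ≤ _ := this

/-- The observability inequality for the strong solutions of the cascade. -/
theorem exists_strong_observability (hA : A1 A) {n : ℕ} (hn : 1 ≤ n) {C P : ℕ → H →L[𝕜] H}
    (hA2 : A2 A C P n) (hA3 : A3 A P n) {B : A.domain × H →ₗ[𝕜] G} (hA4 : A4 A B) (hA5 : A5 A B) :
    ∃ Tstar K : ℝ, 1 ≤ Tstar ∧ 0 < K ∧ ∀ (w : ℕ → ℝ → A.domain) (v : ℕ → ℝ → H),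
      IsStrongCascadeSol A C n w v → ∀ T, Tstar < T → ∀ i, 1 ≤ i → i ≤ n →
        energy A (1 + (i : ℤ) - (n : ℤ)) (w i 0) (v i 0) ≤
          K / T ^ (2 * (n - i) + 1) * ∫ t in (0 : ℝ)..T, ‖B (w n t, v n t)‖ ^ 2 := by
  obtain ⟨Λ, hΛ⟩ := hA.exists_isInvSqrt
  obtain ⟨b, hb⟩ := hA4.exists_obs hΛ hA
  obtain ⟨Tstar, K, hT, hK, hobs⟩ := (hA5.isObserver hA4 hΛ hA hb).isObservable (hΛ.inner_left hA)
    (fun r₀ q₀ => hA.exists_free hΛ r₀ q₀) (hA2.isCoupling hΛ hA) (hA3.observesVelocity hΛ hA) hn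
  refine ⟨Tstar, K / 2, hT, by positivity, fun w v h T hTT i h1 h2 => ?_⟩
  obtain ⟨q, hq, hw⟩ := h.exists_isWaveCascade hΛ hA
  have h3 := hobs _ _ hw T hTT i h1 h2
  have hTpos : 0 < T := by linarith
  -- The level `1 + i - n` is `1 - k` with `k = n - i`; the factor `1 / 2` in the energy is why the
  -- constant is `K / 2`.
  have h4 : energy A (1 + (i : ℤ) - (n : ℤ)) (w i 0) (v i 0) =
      1 / 2 * waveEnergy Λ (n - i) (A (w i 0)) (q i 0) := by
    rw [← hΛ.energy_eq_waveEnergy hA, hΛ.apply_apply_domain hA, hq i h1 h2 0 le_rfl]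
    congr 1
    push_cast [Nat.cast_sub h2]
    ring
  have h5 : ∫ t in (0 : ℝ)..T, ‖b (A (w n t), q n t)‖ ^ 2 =
      ∫ t in (0 : ℝ)..T, ‖B (w n t, v n t)‖ ^ 2 := by
    refine intervalIntegral.integral_congr fun t ht => ?_
    rw [uIcc_of_le hTpos.le] at ht
    simp only [hb, hΛ.lift_apply hA, hq n hn le_rfl t ht.1]
  rw [h5] at h3
  rw [h4, div_mul_eq_mul_div (K / 2), le_div_iff₀ (by positivity)]
  linarith

end Translate

/-! ### Mean values in time. -/

section Average

variable {H : Type*} [NormedAddCommGroup H] {g : ℝ → H}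

theorem continuous_comp_max (hg : ContinuousOn g (Ici 0)) : Continuous fun x => g (max x 0) :=
  hg.comp_continuous (by fun_prop) fun x => by simp

variable [NormedSpace ℝ H]

/-- The mean value of `g` over `[t, t + h]`, where `g` is extended to negative times by `g 0`. -/
noncomputable def timeAvg (h : ℝ) (g : ℝ → H) (t : ℝ) : H := h⁻¹ • ∫ x in t..t + h, g (max x 0)

theorem timeAvg_congr {g' : ℝ → H} (hgg' : ∀ t, 0 ≤ t → g t = g' t) (h t : ℝ) :
    timeAvg h g t = timeAvg h g' t := by
  unfold timeAvg
  congr 1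
  exact intervalIntegral.integral_congr fun x _ => hgg' _ (le_max_right _ _)

theorem timeAvg_eq (g : ℝ → H) {h t : ℝ} (hh : 0 ≤ h) (ht : 0 ≤ t) :
    timeAvg h g t = h⁻¹ • ∫ x in t..t + h, g x := by
  unfold timeAvg
  congr 1
  refine intervalIntegral.integral_congr fun x hx => ?_
  rw [uIcc_of_le (by linarith)] at hx
  simp only [max_eq_left (ht.trans hx.1)]

variable [CompleteSpace H]

/-- Uniform continuity of `g` on `[0, T + 1]`, which contains all averaging windows once `h < 1`. -/
theorem eventually_timeAvg (hg : ContinuousOn g (Ici 0)) (T : ℝ) {ε : ℝ} (hε : 0 < ε) :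
    ∀ᶠ h in 𝓝[>] (0 : ℝ), ∀ t ∈ Icc 0 T, ‖timeAvg h g t - g t‖ ≤ ε := by
  have huc := isCompact_Icc.uniformContinuousOn_of_continuous
    (hg.mono (Icc_subset_Ici_self : Icc (0 : ℝ) (T + 1) ⊆ Ici 0))
  rw [Metric.uniformContinuousOn_iff_le] at huc
  obtain ⟨δ, hδ, huc⟩ := huc ε hε
  filter_upwards [Ioo_mem_nhdsGT (lt_min hδ one_pos)] with h hh t ht
  have hh0 : 0 < h := hh.1
  have hhδ : h < δ := hh.2.trans_le (min_le_left _ _)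
  have hh1 : h < 1 := hh.2.trans_le (min_le_right _ _)
  have hc := continuous_comp_max hg
  have e1 : g t = h⁻¹ • ∫ _ in t..t + h, g t := by
    rw [intervalIntegral.integral_const, add_sub_cancel_left, smul_smul,
      inv_mul_cancel₀ hh0.ne', one_smul]
  unfold timeAvg
  rw [e1, ← smul_sub, ← intervalIntegral.integral_sub (hc.intervalIntegrable _ _) (by simp),
    norm_smul, norm_inv, Real.norm_of_nonneg hh0.le, inv_mul_le_iff₀ hh0]
  refine (intervalIntegral.norm_integral_le_of_norm_le_const (C := ε) fun x hx => ?_).trans_eq ?_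
  · rw [uIoc_of_le (by linarith)] at hx
    have hx0 : 0 ≤ x := ht.1.trans hx.1.le
    rw [max_eq_left hx0, ← dist_eq_norm]
    refine huc x ⟨hx0, by linarith [hx.2, ht.2]⟩ t ⟨ht.1, by linarith [ht.2]⟩ ?_
    rw [Real.dist_eq, abs_of_nonneg (by linarith [hx.1])]
    linarith [hx.2]
  · rw [add_sub_cancel_left, abs_of_pos hh0, mul_comm]

theorem hasDerivAt_timeAvg (hg : ContinuousOn g (Ici 0)) (h t : ℝ) :
    HasDerivAt (timeAvg h g) (h⁻¹ • (g (max (t + h) 0) - g (max t 0))) t := by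
  have hc := continuous_comp_max hg
  have hd : ∀ s, HasDerivAt (fun t => ∫ x in (0 : ℝ)..t, g (max x 0)) (g (max s 0)) s := fun s =>
    intervalIntegral.integral_hasDerivAt_right (hc.intervalIntegrable _ _)
      (hc.stronglyMeasurableAtFilter _ _) hc.continuousAt
  have h1 : HasDerivAt (fun t => ∫ x in (0 : ℝ)..t + h, g (max x 0)) (g (max (t + h) 0)) t := by
    simpa using! (hd (t + h)).scomp t ((hasDerivAt_id t).add_const h)
  have h2 : timeAvg h g = fun t => h⁻¹ • ((∫ x in (0 : ℝ)..t + h, g (max x 0)) -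
      ∫ x in (0 : ℝ)..t, g (max x 0)) := by
    funext s
    rw [intervalIntegral.integral_interval_sub_left (hc.intervalIntegrable _ _)
      (hc.intervalIntegrable _ _)]
    rfl
  rw [h2]
  exact (h1.fun_sub (hd t)).const_smul h⁻¹

theorem timeAvg_of_hasDeriv {g' : ℝ → H} (hg' : ContinuousOn g' (Ici 0))
    (hd : ∀ t ∈ Ici (0 : ℝ), HasDerivWithinAt g (g' t) (Ici 0) t) {h t : ℝ} (hh : 0 ≤ h)
    (ht : 0 ≤ t) : timeAvg h g' t = h⁻¹ • (g (t + h) - g t) := by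
  have hsub : Icc t (t + h) ⊆ Ici (0 : ℝ) := fun x hx => ht.trans hx.1
  rw [timeAvg_eq _ hh ht]
  congr 1
  exact integral_eq_sub_of_hasDerivWithinAt (fun x hx => (hd x (hsub hx)).mono hsub)
    (hg'.mono hsub) le_rfl (by linarith) le_rfl

theorem clm_timeAvg {𝕜 : Type*} [RCLike 𝕜] [NormedSpace 𝕜 H] [IsScalarTower ℝ 𝕜 H] {E : Type*}
    [NormedAddCommGroup E] [NormedSpace 𝕜 E] [NormedSpace ℝ E] [IsScalarTower ℝ 𝕜 E]
    [CompleteSpace E] (L : H →L[𝕜] E) (hg : ContinuousOn g (Ici 0)) (h t : ℝ) :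
    L (timeAvg h g t) = timeAvg h (fun x => L (g x)) t := by
  unfold timeAvg
  have h1 := (L.restrictScalars ℝ).intervalIntegral_comp_comm (μ := volume)
    ((continuous_comp_max hg).intervalIntegrable t (t + h))
  have h2 : L (h⁻¹ • ∫ x in t..t + h, g (max x 0)) = h⁻¹ • L (∫ x in t..t + h, g (max x 0)) :=
    (L.restrictScalars ℝ).map_smul _ _
  rw [h2]
  congr 1
  exact h1.symm

end Average

/-! ### Regularisation of weak solutions by averaging. -/

section Weak

variable {𝕜 : Type*} [RCLike 𝕜] {H : Type*} [NormedAddCommGroup H] [InnerProductSpace 𝕜 H]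
  [CompleteSpace H] {A : H →ₗ.[𝕜] H} {Λ : H →L[𝕜] H} [NormedSpace ℝ H]

theorem IsWeakSol.exists_fst {f w v : ℝ → H} {S : Set ℝ} (h : IsWeakSol A f S w v)
    (hΛ : IsInvSqrt A Λ) (hA : A1 A) :
    ∃ p : ℝ → H, ContinuousOn p S ∧ ∀ t ∈ S, Λ (p t) = w t := by
  have hex : ∀ t, t ∈ S → ∃ p, Λ p = w t := fun t ht =>
    hΛ.exists_of_memH_one hA (h.continuous_fst t ht).1
  choose! p hp using hex
  refine ⟨p, fun t ht => ?_, hp⟩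
  rw [ContinuousWithinAt, tendsto_iff_norm_sub_tendsto_zero]
  refine (h.continuous_fst t ht).2.congr' ?_
  filter_upwards [self_mem_nhdsWithin] with s hs
  rw [← hp s hs, ← hp t ht, ← map_sub, hΛ.normH_one hA]

variable [IsScalarTower ℝ 𝕜 H]

/-- The mean values in time of a weak solution form a strong solution. -/
theorem IsWeakSol.exists_average {f w v p : ℝ → H} (hw : IsWeakSol A f (Ici 0) w v)
    (hΛ : IsInvSqrt A Λ) (hA : A1 A) (hf : ContinuousOn f (Ici 0)) (hp : ContinuousOn p (Ici 0))
    (hpw : ∀ t ∈ Ici (0 : ℝ), Λ (p t) = w t) {h : ℝ} (hh : 0 < h) :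
    ∃ r q : ℝ → H, IsWaveSol Λ (timeAvg h f) (Ici 0) r q ∧
      ∀ t, 0 ≤ t → Λ (r t) = timeAvg h p t ∧ Λ (q t) = timeAvg h v t := by
  have hwc : ContinuousOn w (Ici 0) := fun t ht => (hw.deriv_fst t ht).continuousWithinAt
  have hvc := hw.continuous_snd
  have hm : MapsTo (fun t : ℝ => t + h) (Ici 0) (Ici 0) := fun t ht => by
    simp only [mem_Ici] at *; linarith
  have hcadd : ContinuousOn (fun t : ℝ => t + h) (Ici 0) := by fun_prop
  have hdadd : ∀ t, HasDerivWithinAt (fun t : ℝ => t + h) 1 (Ici 0) t := fun t =>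
    ((hasDerivAt_id t).add_const h).hasDerivWithinAt
  have hfa : ContinuousOn (timeAvg h f) (Ici 0) := fun t _ =>
    (hasDerivAt_timeAvg hf h t).continuousAt.continuousWithinAt
  -- Both curves come from the averaged equation `A w_h = f_h - w_h''`: the second derivative of the
  -- average is a difference quotient of `v`, and its first derivative is one of `w = Λ p`.
  set r : ℝ → H := fun t => timeAvg h f t - h⁻¹ • (v (t + h) - v t) with hr
  set q : ℝ → H := fun t => h⁻¹ • (p (t + h) - p t) with hq
  have hΛp : ∀ t, Λ (timeAvg h p t) = timeAvg h w t := fun t => by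
    rw [clm_timeAvg Λ hp]
    exact timeAvg_congr (fun s hs => hpw s hs) h t
  have hΛr : ∀ t, 0 ≤ t → Λ (r t) = timeAvg h p t := by
    intro t ht
    refine hΛ.injective hA ?_
    rw [hΛp]
    -- The weak formulation is integrated over `[t, t + h]` with test vector `Λ² ψ ∈ D(A)`, for
    -- which `A Λ² ψ = ψ` is arbitrary.
    refine ext_inner_left 𝕜 fun ψ => ?_
    obtain ⟨hφ, hφA⟩ := hΛ.exists_mem_domain hA ψ
    have hd := hw.deriv_snd ⟨_, hφ⟩
    rw [hφA] at hd
    simp only at hd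
    have hc : ContinuousOn (fun s => inner 𝕜 (Λ (Λ ψ)) (f s) - inner 𝕜 ψ (w s)) (Ici 0) :=
      (continuousOn_const.inner (𝕜 := 𝕜) hf).sub (continuousOn_const.inner (𝕜 := 𝕜) hwc)
    have h1 := timeAvg_of_hasDeriv hc hd hh.le ht
    have h2 : timeAvg h (fun s => inner 𝕜 (Λ (Λ ψ)) (f s) - inner 𝕜 ψ (w s)) t =
        inner 𝕜 (Λ (Λ ψ)) (timeAvg h f t) - inner 𝕜 ψ (timeAvg h w t) := by
      have e1 := clm_timeAvg (innerSL 𝕜 (Λ (Λ ψ))) hf h t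
      have e2 := clm_timeAvg (innerSL 𝕜 ψ) hwc h t
      simp only [innerSL_apply_apply] at e1 e2
      rw [e1, e2]
      unfold timeAvg
      rw [← smul_sub, ← intervalIntegral.integral_sub]
      · exact (continuous_comp_max
          (continuousOn_const.inner (𝕜 := 𝕜) hf)).intervalIntegrable _ _
      · exact (continuous_comp_max
          (continuousOn_const.inner (𝕜 := 𝕜) hwc)).intervalIntegrable _ _
    rw [h2] at h1
    have h3 : inner 𝕜 (Λ (Λ ψ)) (h⁻¹ • (v (t + h) - v t)) =
        h⁻¹ • (inner 𝕜 (Λ (Λ ψ)) (v (t + h)) - inner 𝕜 (Λ (Λ ψ)) (v t)) := by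
      rw [← inner_sub_right]
      exact ((innerSL 𝕜 (Λ (Λ ψ))).restrictScalars ℝ).map_smul _ _
    rw [← h3, sub_eq_iff_eq_add] at h1
    rw [← hΛ.inner_left hA, ← hΛ.inner_left hA, hr]
    simp only
    rw [inner_sub_right, h1]
    abel
  have hΛq : ∀ t, 0 ≤ t → Λ (q t) = h⁻¹ • (w (t + h) - w t) := by
    intro t ht
    simp only [hq]
    rw [map_real_smul_clm, map_sub, hpw t ht, hpw (t + h) (hm ht)]
  refine ⟨r, q, ⟨hfa, ?_, ?_, fun t ht => ?_, fun t ht => ?_⟩, fun t ht => ⟨hΛr t ht, ?_⟩⟩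
  · exact hfa.sub (((hvc.comp hcadd hm).sub hvc).const_smul h⁻¹)
  · exact ((hp.comp hcadd hm).sub hp).const_smul h⁻¹
  · have h1 := (hasDerivAt_timeAvg hp h t).hasDerivWithinAt (s := Ici 0)
    rw [max_eq_left (hm ht), max_eq_left ht] at h1
    exact h1.congr (fun s hs => hΛr s hs) (hΛr t ht)
  · have h1 : HasDerivWithinAt (fun s => w (s + h)) (v (t + h)) (Ici 0) t := by
      simpa using! (hw.deriv_fst (t + h) (hm ht)).scomp t (hdadd t) hm
    have h2 := (h1.fun_sub (hw.deriv_fst t ht)).const_smul h⁻¹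
    refine (h2.congr (fun s hs => hΛq s hs) (hΛq t ht)).congr_deriv ?_
    simp only [hr]
    abel
  · rw [hΛq t ht, timeAvg_of_hasDeriv hvc hw.deriv_fst hh.le ht]

/-- Averaging commutes with the bounded operators `C i`, so the averages of all components solve the
same cascade. -/
theorem IsCascadeSol.exists_average {C : ℕ → H →L[𝕜] H} {n : ℕ} {w v : ℕ → ℝ → H}
    (hw : IsCascadeSol A C n w v) (hΛ : IsInvSqrt A Λ) (hA : A1 A) :
    ∃ p : ℕ → ℝ → H, (∀ i, 1 ≤ i → i ≤ n → ContinuousOn (p i) (Ici 0)) ∧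
      (∀ i, 1 ≤ i → i ≤ n → ∀ t, 0 ≤ t → Λ (p i t) = w i t) ∧
      ∀ h : ℝ, 0 < h → ∃ r q : ℕ → ℝ → H, IsWaveCascade Λ C n r q ∧
        ∀ i, 1 ≤ i → i ≤ n → ∀ t, 0 ≤ t →
          Λ (r i t) = timeAvg h (p i) t ∧ Λ (q i t) = timeAvg h (v i) t := by
  have hex : ∀ i, 1 ≤ i ∧ i ≤ n → ∃ p : ℝ → H, ContinuousOn p (Ici 0) ∧
      ∀ t ∈ Ici (0 : ℝ), Λ (p t) = w i t := fun i hi => (hw i hi.1 hi.2).exists_fst hΛ hA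
  choose! p hp using hex
  refine ⟨p, fun i h1 h2 => (hp i ⟨h1, h2⟩).1, fun i h1 h2 => (hp i ⟨h1, h2⟩).2, fun h hh => ?_⟩
  have hwc : ∀ i, 1 ≤ i → i ≤ n → ContinuousOn (w i) (Ici 0) := fun i h1 h2 t ht =>
    ((hw i h1 h2).deriv_fst t ht).continuousWithinAt
  have hfc : ∀ i, 1 ≤ i → i ≤ n → ContinuousOn (cascadeSource C w i) (Ici 0) := by
    intro i h1 h2
    unfold cascadeSource
    split_ifs with hi
    · exact ((C i).continuous.comp_continuousOn (hwc (i - 1) (by omega) (by omega))).neg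
    · exact continuousOn_const
  have hex2 : ∀ i, 1 ≤ i ∧ i ≤ n → ∃ r q : ℝ → H,
      IsWaveSol Λ (timeAvg h (cascadeSource C w i)) (Ici 0) r q ∧
      ∀ t, 0 ≤ t → Λ (r t) = timeAvg h (p i) t ∧ Λ (q t) = timeAvg h (v i) t := fun i hi =>
    (hw i hi.1 hi.2).exists_average hΛ hA (hfc i hi.1 hi.2) (hp i hi).1 (hp i hi).2 hh
  choose! r q hrq using hex2
  refine ⟨r, q, fun i h1 h2 => ?_, fun i h1 h2 => (hrq i ⟨h1, h2⟩).2⟩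
  refine (hrq i ⟨h1, h2⟩).1.congr_source fun t ht => ?_
  by_cases hi : 2 ≤ i
  · have hj : 1 ≤ i - 1 ∧ i - 1 ≤ n := by omega
    have e1 : timeAvg h (cascadeSource C w i) t = (-(C i)) (timeAvg h (w (i - 1)) t) := by
      rw [clm_timeAvg (-(C i)) (hwc (i - 1) hj.1 hj.2)]
      refine timeAvg_congr (fun s _ => ?_) h t
      simp [cascadeSource, hi]
    rw [e1, waveSource, if_pos hi, ((hrq (i - 1) hj).2 t ht).1, clm_timeAvg Λ (hp (i - 1) hj).1,
      timeAvg_congr (hp (i - 1) hj).2]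
    simp
  · simp [waveSource, cascadeSource, hi, timeAvg]

end Weak

/-! ### Convergence of squared `L²` norms. -/

section SquareIntegrable

variable {G : Type*} [NormedAddCommGroup G] {T : ℝ}

theorem memLp_two_of_continuousOn {g : ℝ → G} (hg : ContinuousOn g (Icc 0 T)) :
    MemLp g 2 (volume.restrict (Ioc 0 T)) := by
  obtain ⟨c, hc⟩ := isCompact_Icc.exists_bound_of_continuousOn hg
  refine MemLp.of_bound ((hg.aestronglyMeasurable_of_isCompact isCompact_Icc
    measurableSet_Icc).mono_measure (Measure.restrict_mono Ioc_subset_Icc_self le_rfl)) c ?_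
  filter_upwards [ae_restrict_mem measurableSet_Ioc] with t ht
  exact hc t (Ioc_subset_Icc_self ht)

theorem toReal_eLpNorm_two_sq (hT : 0 ≤ T) {g : ℝ → G}
    (hg : MemLp g 2 (volume.restrict (Ioc 0 T))) :
    (eLpNorm g 2 (volume.restrict (Ioc 0 T))).toReal ^ 2 = ∫ t in (0 : ℝ)..T, ‖g t‖ ^ 2 := by
  have h0 : 0 ≤ ∫ t in Ioc 0 T, ‖g t‖ ^ 2 := integral_nonneg fun t => by positivity
  rw [intervalIntegral.integral_of_le hT,
    hg.eLpNorm_eq_integral_rpow_norm (by norm_num) (by norm_num),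
    ENNReal.toReal_ofReal (by positivity)]
  simp only [ENNReal.toReal_ofNat, Real.rpow_ofNat]
  rw [← Real.rpow_natCast, ← Real.rpow_mul h0]
  norm_num

theorem tendsto_integral_norm_sq (hT : 0 ≤ T) {F : ℕ → ℝ → G} {y : ℝ → G}
    (hF : ∀ m, MemLp (F m) 2 (volume.restrict (Ioc 0 T)))
    (hy : MemLp y 2 (volume.restrict (Ioc 0 T)))
    (h : Tendsto (fun m => eLpNorm (fun t => F m t - y t) 2 (volume.restrict (Ioc 0 T))) atTop
      (𝓝 0)) :
    Tendsto (fun m => ∫ t in (0 : ℝ)..T, ‖F m t‖ ^ 2) atTop (𝓝 (∫ t in (0 : ℝ)..T, ‖y t‖ ^ 2)) := by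
  set μ := volume.restrict (Ioc (0 : ℝ) T)
  have h0 : Tendsto (fun m => (eLpNorm (fun t => F m t - y t) 2 μ).toReal) atTop (𝓝 0) := by
    simpa using! (ENNReal.tendsto_toReal ENNReal.zero_ne_top).comp h
  have h1 : Tendsto (fun m => (eLpNorm (F m) 2 μ).toReal) atTop (𝓝 (eLpNorm y 2 μ).toReal) := by
    rw [tendsto_iff_dist_tendsto_zero]
    refine squeeze_zero (fun _ => dist_nonneg) (fun m => ?_) h0
    have hd : MemLp (fun t => F m t - y t) 2 μ := (hF m).sub hy
    have t1 : eLpNorm (F m) 2 μ ≤ eLpNorm (fun t => F m t - y t) 2 μ + eLpNorm y 2 μ := by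
      have := eLpNorm_add_le hd.1 hy.1 (p := 2) (by norm_num)
      refine le_trans (le_of_eq ?_) this
      congr 1
      funext t
      simp
    have t2 : eLpNorm y 2 μ ≤ eLpNorm (F m) 2 μ + eLpNorm (fun t => F m t - y t) 2 μ := by
      have := eLpNorm_sub_le (hF m).1 hd.1 (p := 2) (by norm_num)
      refine le_trans (le_of_eq ?_) this
      congr 1
      funext t
      simp
    have s1 := ENNReal.toReal_mono (ENNReal.add_ne_top.2 ⟨hd.2.ne, hy.2.ne⟩) t1
    have s2 := ENNReal.toReal_mono (ENNReal.add_ne_top.2 ⟨(hF m).2.ne, hd.2.ne⟩) t2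
    rw [ENNReal.toReal_add hd.2.ne hy.2.ne] at s1
    rw [ENNReal.toReal_add (hF m).2.ne hd.2.ne] at s2
    rw [Real.dist_eq, abs_le]
    constructor <;> linarith
  have h2 := h1.pow 2
  rw [toReal_eLpNorm_two_sq hT hy] at h2
  exact h2.congr fun m => toReal_eLpNorm_two_sq hT (hF m)

end SquareIntegrable

/-! ### Existence of observations and passage to the limit. -/

section Observation

variable {𝕜 : Type*} [RCLike 𝕜] {H : Type*} [NormedAddCommGroup H] [InnerProductSpace 𝕜 H]
  {Λ : H →L[𝕜] H} {C : ℕ → H →L[𝕜] H}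

theorem norm_waveSource_sub_le {r r' : ℕ → ℝ → H} {i : ℕ} {t e : ℝ} (he : 0 ≤ e)
    (h : 2 ≤ i → ‖Λ (r (i - 1) t) - Λ (r' (i - 1) t)‖ ≤ e) :
    ‖waveSource Λ C r i t - waveSource Λ C r' i t‖ ≤ ‖C i‖ * ‖Λ‖ * e := by
  unfold waveSource
  split_ifs with hi
  · have e1 : ‖Λ (Λ (r (i - 1) t)) - Λ (Λ (r' (i - 1) t))‖ ≤ ‖Λ‖ * e := by
      rw [← map_sub]
      exact (Λ.le_opNorm _).trans (mul_le_mul_of_nonneg_left (h hi) (norm_nonneg _))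
    rw [neg_sub_neg, norm_sub_rev, ← map_sub, mul_assoc]
    exact ((C i).le_opNorm _).trans (mul_le_mul_of_nonneg_left e1 (norm_nonneg _))
  · rw [sub_self, norm_zero]
    positivity

variable [CompleteSpace H] {A : H →ₗ.[𝕜] H} {n : ℕ}
  {G : Type*} [NormedAddCommGroup G] [InnerProductSpace 𝕜 G] {B : A.domain × H →ₗ[𝕜] G}

/-- The levels `1 - k` are at most `1`, so these energies are continuous for the convergence of
initial data in `H_1 × H`: only the bounded operators `Λ ^ k` occur. -/
theorem IsInvSqrt.tendsto_energy (hΛ : IsInvSqrt A Λ) (hA : A1 A) (k : ℕ) {p : H} {a b : ℕ → H}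
    {v : H} (ha : Tendsto a atTop (𝓝 p)) (hb : Tendsto b atTop (𝓝 v)) :
    Tendsto (fun m => energy A (1 - (k : ℤ)) (Λ (a m)) (b m)) atTop
      (𝓝 (energy A (1 - (k : ℤ)) (Λ p) v)) := by
  simp only [hΛ.energy_eq hA]
  have h1 := ((((Λ ^ k).continuous.tendsto p).comp ha).norm.pow 2)
  have h2 := ((((Λ ^ k).continuous.tendsto v).comp hb).norm.pow 2)
  exact (h1.add h2).const_mul _

variable [NormedSpace ℝ H]

/-- On strong solutions, the observation depends continuously on the solution. -/
theorem A4.exists_integral_obs_sub_le (h : A4 A B) (hΛ : IsInvSqrt A Λ) (hA : A1 A)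
    {b : H × H →L[𝕜] G} (hb : ∀ r q, b (r, q) = B (hΛ.lift hA r, Λ q)) (C : ℕ → H →L[𝕜] H)
    {n : ℕ} (hn : 1 ≤ n) {T : ℝ} (hT : 0 < T) :
    ∃ M : ℝ, 0 ≤ M ∧ ∀ (r q r' q' : ℕ → ℝ → H) (e : ℝ), 0 ≤ e → IsWaveCascade Λ C n r q →
      IsWaveCascade Λ C n r' q' →
      (∀ i, 1 ≤ i → i ≤ n → ∀ t ∈ Icc 0 T, ‖Λ (r i t) - Λ (r' i t)‖ ≤ e ∧
        ‖Λ (q i t) - Λ (q' i t)‖ ≤ e) →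
      ∫ t in (0 : ℝ)..T, ‖b (r n t, q n t) - b (r' n t, q' n t)‖ ^ 2 ≤ (M * e) ^ 2 := by
  obtain ⟨D, hD, hadm⟩ := h.wave_admissible hΛ hA hb T hT
  set c₀ := ‖C n‖ * ‖Λ‖ with hc₀
  -- The energy of the difference is at most `2 e²`: twice this at the two endpoints, `T` times this
  -- for its integral, and `T c₀² e²` for the coupling source.
  refine ⟨√(D * (4 + 2 * T + T * c₀ ^ 2)), Real.sqrt_nonneg _,
    fun r q r' q' e he hr hr' hd => ?_⟩
  rw [mul_pow, Real.sq_sqrt (by positivity)]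
  have hs := ((hr n hn le_rfl).sub (hr' n hn le_rfl)).mono (Icc_subset_Ici_self : Icc 0 T ⊆ Ici 0)
  have h1 := hadm _ _ _ hs
  have hE : ∀ t ∈ Icc 0 T, waveEnergy Λ 0 (r n t - r' n t) (q n t - q' n t) ≤ 2 * e ^ 2 := by
    intro t ht
    obtain ⟨d1, d2⟩ := hd n hn le_rfl t ht
    have s1 := pow_le_pow_left₀ (norm_nonneg _) d1 2
    have s2 := pow_le_pow_left₀ (norm_nonneg _) d2 2
    simp only [waveEnergy, pow_zero, one_apply_eq_self, map_sub]
    linarith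
  have hF : ∀ t ∈ Icc 0 T, ‖waveSource Λ C r n t - waveSource Λ C r' n t‖ ^ 2 ≤
      c₀ ^ 2 * e ^ 2 := by
    intro t ht
    rw [← mul_pow]
    exact pow_le_pow_left₀ (norm_nonneg _) (norm_waveSource_sub_le he fun h2 =>
      (hd (n - 1) (by omega) (by omega) t ht).1) 2
  have hmono : ∀ (g : ℝ → ℝ) (c : ℝ), ContinuousOn g (Icc 0 T) → (∀ t ∈ Icc 0 T, g t ≤ c) →
      ∫ t in (0 : ℝ)..T, g t ≤ T * c := by
    intro g c hg hgc
    refine (intervalIntegral.integral_mono_on hT.le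
      (hg.intervalIntegrable_of_Icc hT.le) intervalIntegrable_const hgc).trans_eq ?_
    simp
  have i1 := hmono _ _ (hs.continuousOn_energy 0) hE
  have i2 : ∫ t in (0 : ℝ)..T, ‖waveSource Λ C r n t - waveSource Λ C r' n t‖ ^ 2 ≤
      T * (c₀ ^ 2 * e ^ 2) := hmono _ _ (hs.continuous_source.norm.pow 2) hF
  have e0 := hE 0 ⟨le_rfl, hT.le⟩
  have eT := hE T ⟨hT.le, le_rfl⟩
  simp only [← map_sub, Prod.mk_sub_mk]
  refine h1.trans ?_
  rw [mul_assoc]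
  refine mul_le_mul_of_nonneg_left ?_ hD.le
  linarith

theorem IsStrongCascadeSol.memLp_obs {w : ℕ → ℝ → A.domain} {v : ℕ → ℝ → H}
    (h : IsStrongCascadeSol A C n w v) (hA : A1 A) (hA4 : A4 A B) (hn : 1 ≤ n) (T : ℝ) :
    MemLp (fun t => B (w n t, v n t)) 2 (volume.restrict (Ioc 0 T)) := by
  obtain ⟨Λ, hΛ⟩ := hA.exists_isInvSqrt
  obtain ⟨b, hb⟩ := hA4.exists_obs hΛ hA
  obtain ⟨q, hq, hw⟩ := h.exists_isWaveCascade hΛ hA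
  refine memLp_two_of_continuousOn ?_
  have hs := (hw n hn le_rfl).mono (Icc_subset_Ici_self : Icc 0 T ⊆ Ici 0)
  refine (b.continuous.comp_continuousOn (hs.continuous_fst.prodMk hs.continuous_snd)).congr
    fun t ht => ?_
  change _ = b (A (w n t), q n t)
  rw [hb, hΛ.lift_apply hA, hq n hn le_rfl t ht.1]

/-- An observability inequality for strong solutions passes to the finite energy solutions. -/
theorem IsObservation.energy_le {w v : ℕ → ℝ → H} {T : ℝ} {y : ℝ → G}
    (hy : IsObservation A C n B w v T y) (hw : IsCascadeSol A C n w v) (hA : A1 A) (hA4 : A4 A B)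
    (hn : 1 ≤ n) (hT : 0 ≤ T) {i : ℕ} (h1 : 1 ≤ i) (h2 : i ≤ n) {d : ℝ}
    (hd : ∀ (a : ℕ → ℝ → A.domain) (b : ℕ → ℝ → H), IsStrongCascadeSol A C n a b →
      energy A (1 + (i : ℤ) - (n : ℤ)) (a i 0) (b i 0) ≤
        d * ∫ t in (0 : ℝ)..T, ‖B (a n t, b n t)‖ ^ 2) :
    energy A (1 + (i : ℤ) - (n : ℤ)) (w i 0) (v i 0) ≤ d * ∫ t in (0 : ℝ)..T, ‖y t‖ ^ 2 := by
  obtain ⟨Λ, hΛ⟩ := hA.exists_isInvSqrt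
  obtain ⟨hyL, a, b, hab, hinit, hlim⟩ := hy
  obtain ⟨p, -, hpw⟩ := (hw i h1 h2).exists_fst hΛ hA
  have hk : (1 + (i : ℤ) - (n : ℤ)) = 1 - ((n - i : ℕ) : ℤ) := by omega
  have hΛa : ∀ m, Λ (Λ (A (a m i 0))) = a m i 0 := fun m => by
    rw [hΛ.apply_apply_domain hA]
  have ha : Tendsto (fun m => Λ (A (a m i 0))) atTop (𝓝 (p 0)) := by
    rw [tendsto_iff_norm_sub_tendsto_zero]
    refine (hinit i h1 h2).1.congr fun m => ?_
    rw [← hΛa m, ← hpw 0 self_mem_Ici, ← map_sub, hΛ.normH_one hA]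
  have he := hΛ.tendsto_energy hA (n - i) ha (hinit i h1 h2).2
  simp only [hΛa, hpw 0 self_mem_Ici, ← hk] at he
  exact le_of_tendsto_of_tendsto' he
    ((tendsto_integral_norm_sq hT (fun m => (hab m).memLp_obs hA hA4 hn T) hyL hlim).const_mul d)
    fun m => hd _ _ (hab m)

variable [IsScalarTower ℝ 𝕜 H]

/-- Averages that approximate the solution within `2⁻ᵐ`, uniformly on `[0, T]` in `H_1 × H`, have
observations that are Cauchy in `L²` by admissibility; completeness of `L²(0, T; G)` provides the
limit. -/
theorem IsCascadeSol.exists_isObservation [CompleteSpace G] {w v : ℕ → ℝ → H}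
    (hw : IsCascadeSol A C n w v) (hA : A1 A) (hA4 : A4 A B) (hn : 1 ≤ n) {T : ℝ} (hT : 0 < T) :
    ∃ y : ℝ → G, IsObservation A C n B w v T y := by
  obtain ⟨Λ, hΛ⟩ := hA.exists_isInvSqrt
  obtain ⟨b, hb⟩ := hA4.exists_obs hΛ hA
  obtain ⟨M, hM, hbd⟩ := hA4.exists_integral_obs_sub_le hΛ hA hb C hn hT
  obtain ⟨p, hpc, hpw, havg⟩ := hw.exists_average hΛ hA
  have hex : ∀ m : ℕ, ∃ r q : ℕ → ℝ → H, IsWaveCascade Λ C n r q ∧ ∀ i, 1 ≤ i → i ≤ n →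
      ∀ t ∈ Icc 0 T, ‖Λ (r i t) - p i t‖ ≤ (1 / 2) ^ m ∧ ‖Λ (q i t) - v i t‖ ≤ (1 / 2) ^ m := by
    intro m
    have hev : ∀ᶠ h in 𝓝[>] (0 : ℝ), ∀ i ∈ Finset.Icc 1 n, ∀ t ∈ Icc 0 T,
        ‖timeAvg h (p i) t - p i t‖ ≤ (1 / 2) ^ m ∧ ‖timeAvg h (v i) t - v i t‖ ≤ (1 / 2) ^ m := by
      rw [Filter.eventually_all_finset]
      intro i hi
      obtain ⟨h1, h2⟩ := Finset.mem_Icc.1 hi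
      filter_upwards [eventually_timeAvg (hpc i h1 h2) T (ε := (1 / 2) ^ m) (by positivity),
        eventually_timeAvg (hw i h1 h2).continuous_snd T (ε := (1 / 2) ^ m) (by positivity)]
        with h a1 a2 t ht using ⟨a1 t ht, a2 t ht⟩
    obtain ⟨h, hh, hpos⟩ := (hev.and self_mem_nhdsWithin).exists
    obtain ⟨r, q, hrq, hΛrq⟩ := havg h hpos
    refine ⟨r, q, hrq, fun i h1 h2 t ht => ?_⟩
    rw [(hΛrq i h1 h2 t ht.1).1, (hΛrq i h1 h2 t ht.1).2]
    exact hh i (Finset.mem_Icc.2 ⟨h1, h2⟩) t ht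
  choose r q hrq happ using hex
  set μ := volume.restrict (Ioc (0 : ℝ) T)
  set F : ℕ → ℝ → G := fun m t => B (hΛ.lift hA (r m n t), Λ (q m n t)) with hFdef
  have hstrong : ∀ m, IsStrongCascadeSol A C n (fun i t => hΛ.lift hA (r m i t))
      (fun i t => Λ (q m i t)) := fun m => (hrq m).isStrongCascadeSol hΛ hA
  have hF : ∀ m, MemLp (F m) 2 μ := fun m => (hstrong m).memLp_obs hA hA4 hn T
  -- The distance estimate gives `2 M 2⁻ᴺ`; the extra `1` makes the inequality in the Cauchy
  -- criterion strict, also when `M = 0`.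
  have hpow : Summable fun N : ℕ => (2 * M + 1) * (1 / 2 : ℝ) ^ N :=
    (summable_geometric_of_lt_one (by norm_num) (by norm_num)).mul_left _
  have hcau : ∀ N m k : ℕ, N ≤ m → N ≤ k → eLpNorm (F m - F k) 2 μ <
      ENNReal.ofReal ((2 * M + 1) * (1 / 2) ^ N) := by
    intro N m k hm hk
    have hd : MemLp (F m - F k) 2 μ := (hF m).sub (hF k)
    have hle : ∀ {j}, N ≤ j → ((1 : ℝ) / 2) ^ j ≤ (1 / 2) ^ N := fun hj =>
      pow_le_pow_of_le_one (by norm_num) (by norm_num) hj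
    have hclose : ∀ {x y z : H}, ‖x - z‖ ≤ (1 / 2) ^ m → ‖y - z‖ ≤ (1 / 2) ^ k →
        ‖x - y‖ ≤ 2 * (1 / 2) ^ N := by
      intro x y z h1 h2
      have h3 := norm_sub_le (x - z) (y - z)
      rw [sub_sub_sub_cancel_right] at h3
      linarith [hle hm, hle hk]
    have h1 := hbd (r m) (q m) (r k) (q k) (2 * (1 / 2) ^ N) (by positivity) (hrq m) (hrq k)
      fun i i1 i2 t ht => ⟨hclose (happ m i i1 i2 t ht).1 (happ k i i1 i2 t ht).1,
        hclose (happ m i i1 i2 t ht).2 (happ k i i1 i2 t ht).2⟩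
    simp only [hb] at h1
    have h2 := toReal_eLpNorm_two_sq hT.le hd
    have h3 : (eLpNorm (F m - F k) 2 μ).toReal ≤ M * (2 * (1 / 2) ^ N) :=
      le_of_sq_le_sq (h2.trans_le h1) (by positivity)
    rw [← ENNReal.ofReal_toReal hd.2.ne]
    have h4 : (0 : ℝ) < (1 / 2) ^ N := by positivity
    exact (ENNReal.ofReal_lt_ofReal_iff (by positivity)).2 (by linarith)
  obtain ⟨y, hy, hlim⟩ := Lp.cauchy_complete_eLpNorm (by norm_num) hF hpow.tsum_ofReal_ne_top hcau
  have h12 : Tendsto (fun m : ℕ => (1 / 2 : ℝ) ^ m) atTop (𝓝 0) :=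
    tendsto_pow_atTop_nhds_zero_of_lt_one (by norm_num) (by norm_num)
  have h0 : (0 : ℝ) ∈ Icc 0 T := ⟨le_rfl, hT.le⟩
  refine ⟨y, hy, fun m i t => hΛ.lift hA (r m i t), fun m i t => Λ (q m i t), hstrong,
    fun i h1 h2 => ⟨?_, ?_⟩, hlim⟩
  · refine squeeze_zero (fun _ => Real.sqrt_nonneg _) (fun m => ?_) h12
    rw [hΛ.coe_lift hA, ← hpw i h1 h2 0 le_rfl, ← map_sub, hΛ.normH_one hA]
    exact (happ m i h1 h2 0 h0).1
  · rw [tendsto_iff_norm_sub_tendsto_zero]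
    exact squeeze_zero (fun _ => norm_nonneg _) (fun m => (happ m i h1 h2 0 h0).2) h12

end Observation

end CascadeObs

open CascadeObs in
theorem theorem2p5 {𝕜 H G : Type*} [RCLike 𝕜]
    [NormedAddCommGroup H] [InnerProductSpace 𝕜 H] [CompleteSpace H]
    [NormedSpace ℝ H] [IsScalarTower ℝ 𝕜 H]
    [NormedAddCommGroup G] [InnerProductSpace 𝕜 G] [CompleteSpace G]
    (A : H →ₗ.[𝕜] H) (hA1 : A1 A)
    (n : ℕ) (hn : 2 ≤ n)
    (C P : ℕ → H →L[𝕜] H) (hA2 : A2 A C P n) (hA3 : A3 A P n)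
    (B : A.domain × H →ₗ[𝕜] G) (hA4 : A4 A B) (hA5 : A5 A B) :
    ∃ (Tstar K : ℝ) (d : ℕ → ℝ → ℝ), 0 < Tstar ∧ 0 < K ∧
      (∀ T : ℝ, Tstar < T →
        (∀ i, 1 ≤ i → i ≤ n → 0 < d i T) ∧
        (∀ i, 1 ≤ i → i < n → d i T ≤ K / T ^ 3) ∧
        d n T ≤ K / T) ∧
      ∀ w v : ℕ → ℝ → H, IsCascadeSol A C n w v → ∀ T : ℝ, Tstar < T →
        (∃ y : ℝ → G, IsObservation A C n B w v T y) ∧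
        ∀ y : ℝ → G, IsObservation A C n B w v T y → ∀ i, 1 ≤ i → i ≤ n →
          energy A (1 + (i : ℤ) - (n : ℤ)) (w i 0) (v i 0) ≤
            d i T * ∫ t in (0 : ℝ)..T, ‖y t‖ ^ 2 := by
  have hn1 : 1 ≤ n := by omega
  obtain ⟨Tstar, K, hT1, hK, hobs⟩ := exists_strong_observability hA1 hn1 hA2 hA3 hA4 hA5
  -- The exponent is `1` for `i = n` and at least `3` for `i < n`, so the bound by `K / T ^ 3`
  -- follows from `T ≥ 1`.
  refine ⟨Tstar, K, fun i T => K / T ^ (2 * (n - i) + 1), by linarith, hK,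
    fun T hT => ⟨fun i _ _ => ?_, fun i _ hi => ?_, by simp⟩, fun w v hw T hT => ⟨?_, ?_⟩⟩
  · have : 0 < T := by linarith
    positivity
  · have hT' : 1 ≤ T := by linarith
    have : 0 < T := by linarith
    exact div_le_div_of_nonneg_left hK.le (by positivity) (pow_le_pow_right₀ hT' (by omega))
  · exact hw.exists_isObservation hA1 hA4 hn1 (by linarith)
  · intro y hy i h1 h2
    exact hy.energy_le hw hA1 hA4 hn1 (by linarith) h1 h2 fun a b hab => hobs a b hab T hT i h1 h2
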